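/- \textbf{Knapsack with Uncertainty (KU).} An instance consists of a capacity $Q\in\mathbb N$, a positive integer $r$, and $n'$ items, where item $i$ has a size $q_i\in\mathbb N$ and a profit $P_i$; the $P_i$ are independent random variables with $\Pr(P_i=1)=p_i$ and $\Pr(P_i=0)=1-p_i$, where $p_i\in[0,1]$ is rational. A set $I\subseteq\{1,\dots,n'\}$ is feasible if $\sum_{i\in I}q_i\le Q$, and the task is to find a feasible $I$ that maximizes $\Pr\left(\sum_{i\in I}P_i\ge r+1-|I|\right)$. Integers are written in binary, and each $p_i$ is given as $p_i=\frac{a_i}{b_i}\cdot 2^{-e_i}$ by natural numbers $a_i,b_i,e_i$ (with $b_i\ge 1$) written in binary; $n$ denotes the resulting length of the instance. For a constant $\alpha\ge1$, an $\alpha$-approximation algorithm for KU outputs, on every instance, a feasible set whose objective value is at least $1/\alpha$ times the objective value of every feasible set. It runs in FPT time parameterized by $r$ if its running time is at most $f(r)\,n^{d}$ for some computable function $f$ and some constant $d$. Here FPT is the class of parameterized problems decidable in time $f(k)\,n^{d}$ with $f$ computable and $d$ constant, where $k$ is the parameter and $n$ the input length, and $W[1]$ is the class of parameterized problems that, for some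 constant $h$, are fpt-reducible to the problem of deciding whether a given Boolean circuit of weft at most $1$ and depth at most $h$ accepts an assignment with exactly $k$ ones (parameter $k$). \textbf{Theorem.} Assuming $W[1]\ne\mathrm{FPT}$, there is no constant $\alpha\ge 1$ for which KU has an $\alpha$-approximation algorithm that runs in FPT time parameterized by $r$. -/

import Mathlib

open MeasureTheory ProbabilityTheory

/-! ## Machine model: a random access machine with logarithmic cost -/

namespace RAM

/-- The length of a list of natural numbers written in binary, with one separator per number.
(`Nat.size a` is the number of binary digits of `a`, and `Nat.size 0 = 0`.) -/
def size (l : List ℕ) : ℕ := (l.map fun a => Nat.size a + 1).sum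

/-- The memory consists of arrays; `m a i` is cell `i` of array `a`.  A program refers to only
finitely many arrays, since the array names in it are constants. -/
abbrev Memory := ℕ → ℕ → ℕ

/-- Expressions: numerals, reading a cell at a computed address, arithmetic on natural numbers. -/
inductive Expr where
  | const (n : ℕ)
  | read (array : ℕ) (index : Expr)
  | add (e₁ e₂ : Expr)
  | sub (e₁ e₂ : Expr)
  | mul (e₁ e₂ : Expr)
  | div (e₁ e₂ : Expr)

/-- Value of an expression (subtraction is truncated at zero, division rounds down). -/
def Expr.eval (m : Memory) : Expr → ℕ
  | .const n => n
  | .read a i => m a (i.eval m)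
  | .add e₁ e₂ => e₁.eval m + e₂.eval m
  | .sub e₁ e₂ => e₁.eval m - e₂.eval m
  | .mul e₁ e₂ => e₁.eval m * e₂.eval m
  | .div e₁ e₂ => e₁.eval m / e₂.eval m

/-- Logarithmic cost: every operation costs one plus the number of binary digits of its result,
in addition to the cost of its operands (for `read`: of the address). -/
def Expr.cost (m : Memory) : Expr → ℕ
  | .const n => Nat.size n + 1
  | .read a i => i.cost m + Nat.size (m a (i.eval m)) + 1
  | .add e₁ e₂ => e₁.cost m + e₂.cost m + Nat.size (e₁.eval m + e₂.eval m) + 1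
  | .sub e₁ e₂ => e₁.cost m + e₂.cost m + Nat.size (e₁.eval m - e₂.eval m) + 1
  | .mul e₁ e₂ => e₁.cost m + e₂.cost m + Nat.size (e₁.eval m * e₂.eval m) + 1
  | .div e₁ e₂ => e₁.cost m + e₂.cost m + Nat.size (e₁.eval m / e₂.eval m) + 1

/-- Programs.  `write a i e` is the assignment `a[i] := e`; tests succeed on nonzero values. -/
inductive Program where
  | skip
  | write (array : ℕ) (index value : Expr)
  | seq (c₁ c₂ : Program)
  | ite (e : Expr) (c₁ c₂ : Program)
  | while (e : Expr) (c : Program)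

/-- The memory `m` after the assignment `a[i] := v`. -/
def Memory.set (m : Memory) (a i v : ℕ) : Memory :=
  fun a' i' => if a' = a ∧ i' = i then v else m a' i'

/-- `Exec c m t m'`: started in memory `m`, the program `c` halts in memory `m'` and the total
cost of the executed operations is `t`. -/
inductive Exec : Program → Memory → ℕ → Memory → Prop where
  | skip (m : Memory) : Exec .skip m 1 m
  | write (m : Memory) (a : ℕ) (i e : Expr) :
      Exec (.write a i e) m (i.cost m + e.cost m + 1) (m.set a (i.eval m) (e.eval m))
  | seq {c₁ c₂ : Program} {m m₁ m₂ : Memory} {t₁ t₂ : ℕ} :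
      Exec c₁ m t₁ m₁ → Exec c₂ m₁ t₂ m₂ → Exec (.seq c₁ c₂) m (t₁ + t₂) m₂
  | ite_true {e : Expr} {c₁ c₂ : Program} {m m' : Memory} {t : ℕ} :
      e.eval m ≠ 0 → Exec c₁ m t m' → Exec (.ite e c₁ c₂) m (e.cost m + 1 + t) m'
  | ite_false {e : Expr} {c₁ c₂ : Program} {m m' : Memory} {t : ℕ} :
      e.eval m = 0 → Exec c₂ m t m' → Exec (.ite e c₁ c₂) m (e.cost m + 1 + t) m'
  | while_true {e : Expr} {c : Program} {m m₁ m₂ : Memory} {t₁ t₂ : ℕ} :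
      e.eval m ≠ 0 → Exec c m t₁ m₁ → Exec (.while e c) m₁ t₂ m₂ →
      Exec (.while e c) m (e.cost m + 1 + t₁ + t₂) m₂
  | while_false {e : Expr} {c : Program} {m : Memory} :
      e.eval m = 0 → Exec (.while e c) m (e.cost m + 1) m

/-- Initial memory on input `l`: array `0` holds the length of `l` and then its entries; all
other cells are zero. -/
def load (l : List ℕ) : Memory := fun a i => if a = 0 then (l.length :: l).getD i 0 else 0

/-- The output found in the memory after halting, in the same format as the input. -/
def unload (m : Memory) : List ℕ := (List.range (m 0 0)).map fun i => m 0 (i + 1)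

/-- On input `l`, the program halts with output `l'`, in time at most `t`.  The time includes
writing out the output, so that an output is never longer than the running time. -/
def RunsIn (c : Program) (l l' : List ℕ) (t : ℕ) : Prop :=
  ∃ (t₀ : ℕ) (m' : Memory), Exec c (load l) t₀ m' ∧ unload m' = l' ∧ t₀ + size l' ≤ t

end RAM

/-! ## Parameterized problems, FPT and the W-hierarchy -/

namespace Parameterized

open RAM

/-- A parameterized decision problem: a set of pairs (instance, parameter).  Instances are finite
words, here finite lists of natural numbers written in binary. -/
abbrev Problem := Set (List ℕ × ℕ)

/-- Fixed-parameter tractable problems: decidable in time `f(k) · n ^ d` with `f` computable,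
where `n` is the length of the input. -/
def FPT : Set Problem :=
  {L | ∃ (c : Program) (f : ℕ → ℕ) (d : ℕ), Computable f ∧
    ∀ (x : List ℕ) (k : ℕ), ∃ b : ℕ,
      RunsIn c (k :: x) [b] (f k * size (k :: x) ^ d) ∧ (b = 1 ↔ (x, k) ∈ L)}

/-- `L` is fpt-reducible (many-one) to `L'`. -/
def Reduces (L L' : Problem) : Prop :=
  ∃ (c : Program) (f g : ℕ → ℕ) (d : ℕ), Computable f ∧ Computable g ∧
    ∀ (x : List ℕ) (k : ℕ), ∃ (x' : List ℕ) (k' : ℕ),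
      RunsIn c (k :: x) (k' :: x') (f k * size (k :: x) ^ d) ∧
      k' ≤ g k ∧ ((x, k) ∈ L ↔ (x', k') ∈ L')

/-- Gates of a Boolean circuit; the arguments are the numbers of earlier nodes.  And- and or-gates
have unbounded fan-in. -/
inductive Gate where
  | not (j : ℕ)
  | and (js : List ℕ)
  | or (js : List ℕ)

/-- The nodes that feed into a gate. -/
def Gate.args : Gate → List ℕ
  | .not j => [j]
  | .and js => js
  | .or js => js

/-- Truth value of a gate, given the values of the nodes. -/
def Gate.eval (v : ℕ → Bool) : Gate → Bool
  | .not j => !v j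
  | .and js => js.all v
  | .or js => js.any v

/-- A gate is written as its type, its fan-in and its arguments. -/
def Gate.encode : Gate → List ℕ
  | .not j => [1, 1, j]
  | .and js => 2 :: js.length :: js
  | .or js => 3 :: js.length :: js

/-- A Boolean circuit with one output.  The nodes `0, …, numInputs - 1` are the inputs, and the
node `numInputs + i` is gate `i`.  Gates only use nodes with smaller numbers; nodes may be used
more than once. -/
structure Circuit where
  numInputs : ℕ
  gates : List Gate
  output : ℕ
  args_lt : ∀ (i : ℕ) (hi : i < gates.length), ∀ j ∈ (gates[i]).args, j < numInputs + i
  output_lt : output < numInputs + gates.length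

namespace Circuit

/-- The list of labels of all nodes, in order, when the inputs are labelled by `inp` and each gate
is labelled by `step` from the labels of the earlier nodes. -/
def labels {α : Type} (C : Circuit) (inp : List α) (step : Gate → List α → α) : List α :=
  C.gates.foldl (fun ls g => ls ++ [step g ls]) inp

/-- The circuit accepts the assignment `x`. -/
def Accepts (C : Circuit) (x : Fin C.numInputs → Bool) : Prop :=
  (C.labels (List.ofFn x) fun g ls => g.eval fun j => ls.getD j false).getD C.output false = true

/-- The largest number of gates satisfying `count`, on a path from an input (or from a gate
without arguments) to the output. -/
def pathMax (C : Circuit) (count : Gate → Bool) : ℕ :=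
  (C.labels (List.replicate C.numInputs 0) fun g ls =>
    (count g).toNat + (g.args.map fun j => ls.getD j 0).foldr max 0).getD C.output 0

/-- Depth: the largest number of gates on a path to the output. -/
def depth (C : Circuit) : ℕ := C.pathMax fun _ => true

/-- Weft: the largest number of large gates (fan-in more than two) on a path to the output. -/
def weft (C : Circuit) : ℕ := C.pathMax fun g => decide (2 < g.args.length)

/-- A circuit as a word.  All nodes are listed one by one, and an input node is written as `0`, so
that the length of the word is at least the number of nodes. -/
def encode (C : Circuit) : List ℕ :=
  C.numInputs :: C.output :: C.gates.length ::
    (List.replicate C.numInputs 0 ++ C.gates.flatMap Gate.encode)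

end Circuit

/-- Weighted circuit satisfiability for circuits of weft at most `t` and depth at most `h`: does
the circuit accept an assignment with exactly `k` ones?  The parameter is `k`. -/
def WeightedCircuitSat (t h : ℕ) : Problem :=
  {y | ∃ C : Circuit, C.weft ≤ t ∧ C.depth ≤ h ∧ y.1 = C.encode ∧
    ∃ x : Fin C.numInputs → Bool,
      (Finset.univ.filter fun i => x i = true).card = y.2 ∧ C.Accepts x}

/-- The class `W[t]`: the problems that are fpt-reducible to weighted circuit satisfiability for
circuits of weft at most `t` and of depth at most `h`, for some constant `h`. -/
def W (t : ℕ) : Set Problem := {L | ∃ h : ℕ, Reduces L (WeightedCircuitSat t h)}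

end Parameterized

/-! ## Knapsack with Uncertainty -/

namespace KnapsackUncertainty

open RAM

/-- An item with size `size`, whose profit is one with the rational probability
`(num / den) * 2 ^ (-exp)` and zero otherwise. -/
structure Item where
  size : ℕ
  num : ℕ
  den : ℕ
  exp : ℕ
  den_pos : 0 < den
  num_le : num ≤ den * 2 ^ exp

/-- The probability that the profit of the item is one. -/
noncomputable def Item.prob (a : Item) : unitInterval :=
  ⟨(a.num / a.den : ℝ) * ((2 : ℝ) ^ a.exp)⁻¹, by
    have hd : (0 : ℝ) < a.den := by exact_mod_cast a.den_pos
    have hn : (a.num : ℝ) ≤ a.den * 2 ^ a.exp := by exact_mod_cast a.num_le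
    refine ⟨by positivity, ?_⟩
    rw [← div_eq_mul_inv, div_div, div_le_one (by positivity)]
    exact hn⟩

/-- The item as a word: its four numbers, in binary. -/
def Item.encode (a : Item) : List ℕ := [a.size, a.num, a.den, a.exp]

/-- An instance: capacity `Q`, `n` items and a positive integer `r`. -/
structure Instance where
  r : ℕ
  r_pos : 0 < r
  Q : ℕ
  n : ℕ
  item : Fin n → Item

namespace Instance

/-- The instance as a word. -/
def encode (K : Instance) : List ℕ :=
  K.r :: K.Q :: K.n :: (List.ofFn K.item).flatMap Item.encode

/-- The joint law of the profits `P_1, …, P_n`: independent Bernoulli variables. -/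
noncomputable def law (K : Instance) : Measure (Fin K.n → ℕ) :=
  Measure.pi fun i => bernoulliMeasure 1 0 (K.item i).prob

/-- The chosen items fit into the knapsack. -/
def Feasible (K : Instance) (I : Finset (Fin K.n)) : Prop := ∑ i ∈ I, (K.item i).size ≤ K.Q

/-- The objective `Pr (∑ i ∈ I, P_i ≥ r + 1 - |I|)`. -/
noncomputable def objective (K : Instance) (I : Finset (Fin K.n)) : ℝ :=
  K.law.real {P | (K.r : ℤ) + 1 - (I.card : ℤ) ≤ ∑ i ∈ I, (P i : ℤ)}

end Instance

/-- The program `c` is an `α`-approximation algorithm for the problem that runs in FPT time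
parameterized by `r`: for some computable `f` and some constant `d`, on every instance it outputs,
within time `f(r) · n ^ d` for input length `n`, a feasible set `I` of items (as a list of distinct
item numbers) whose objective value is at least `1/α` times that of every feasible set. -/
def IsFPTApprox (α : ℝ) (c : Program) : Prop :=
  ∃ (f : ℕ → ℕ) (d : ℕ), Computable f ∧ ∀ K : Instance, ∃ l : List (Fin K.n), l.Nodup ∧
    RunsIn c K.encode (l.map Fin.val) (f K.r * RAM.size K.encode ^ d) ∧
    K.Feasible l.toFinset ∧
    ∀ J : Finset (Fin K.n), K.Feasible J → K.objective J ≤ α * K.objective l.toFinset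

end KnapsackUncertainty

/-! Suppose that KU has an FPT `α`-approximation. For each fixed `h`, it is used to decide weighted
satisfiability of circuits of weft one and depth at most `h` in FPT time (`exists_decider`).
Composed with the defining reductions this gives W[1] ⊆ FPT (`W_one_subset_FPT`); the converse
inclusion is routine, and the assumption W[1] ≠ FPT is contradicted.

Circuits to constraints. An assignment with `k` ones is stored as the `k + 1` intervals between
consecutive ones, with sentinels at both ends. A true input is the left end of an interval and a
false input is an inner point of one, so every literal, positive or negative, is witnessed by a
single interval. In a circuit of weft one, acceptance can be certified by at most `2 ^ h` edges,
each leading from a large gate to an argument that forces its value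
(`Net.IsVal.exists_certificate`). Once these edges are fixed, any derivation of the output false
reads only boundedly many intervals (`Net.bit_local`). So the circuit accepts if and only if
intervals and edges can be chosen such that no tuple of `arity h` intervals supports the output
false. This is a constraint satisfaction problem whose numbers of variables and constraints depend
only on `k` and `h`, over a domain of polynomial size (`Word.exists_accepting_iff`).

Constraints to exact knapsack. There is a slot for each variable, whose items are the values, and a
slot for each constraint, whose items are the satisfying tuples of values. Sizes are numbers in a
radix so large that no carries occur. One digit per slot enforces one item per slot. One digit per
place of a constraint receives the value from the variable item and the complement of the value from
the constraint item, and so enforces consistency (`Word.exists_assignment_iff`).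

The gap. Let `K` be the number of slots and `r = 2 * K - 1`. Feasible sets have at most `K` items;
fewer than `K` items give objective zero, and `K` items reach the threshold only if all profits are
one, so the objective is a product. A usable item of size `s` has probability `2 ^ (-γ * (C - s))`
with a common constant `C`. Hence the objective of `K` items is `2 ^ (-γ * (K * C - S))` for total
size `S`, and filling the capacity exactly beats every other feasible set by a factor of at least `2
^ γ > α` (`exists_exact_iff`). An approximate solution thus has total size equal to the capacity
whenever this is possible. The exponents are huge numbers, but they have polynomially many binary
digits, and `r` depends only on `k` and `h`.

The remaining work is a calculus of polynomial time on the machine (`PB`, `PT`, `PD`), by which the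
instance is seen to be computable, and the composition of programs on disjoint arrays
(`Exec.rename`). -/

namespace RAM

/-! ### Sizes of numbers -/

theorem size_add_le (a b : ℕ) : Nat.size (a + b) ≤ Nat.size a + Nat.size b + 1 := by
  rw [Nat.size_le]
  have h1 := Nat.lt_size_self a
  have h2 := Nat.lt_size_self b
  have h3 : 2 ^ a.size ≤ 2 ^ (a.size + b.size) := Nat.pow_le_pow_right (by norm_num) (by omega)
  have h4 : 2 ^ b.size ≤ 2 ^ (a.size + b.size) := Nat.pow_le_pow_right (by norm_num) (by omega)
  rw [pow_succ]
  omega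

theorem size_mul_le (a b : ℕ) : Nat.size (a * b) ≤ Nat.size a + Nat.size b := by
  rw [Nat.size_le, pow_add]
  exact Nat.mul_lt_mul'' (Nat.lt_size_self a) (Nat.lt_size_self b)

theorem size_le_self (a : ℕ) : Nat.size a ≤ a := by
  rw [Nat.size_le]; exact Nat.lt_two_pow_self

theorem size_sum_le (f : ℕ → ℕ) (n : ℕ) :
    Nat.size (∑ i ∈ Finset.range n, f i) ≤ ∑ i ∈ Finset.range n, (Nat.size (f i) + 1) := by
  induction n with
  | zero => simp
  | succ n ih =>
    rw [Finset.sum_range_succ, Finset.sum_range_succ]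
    have := size_add_le (∑ i ∈ Finset.range n, f i) (f n)
    omega

theorem size_prod_le (f : ℕ → ℕ) (n : ℕ) :
    Nat.size (∏ i ∈ Finset.range n, f i) ≤ 1 + ∑ i ∈ Finset.range n, Nat.size (f i) := by
  induction n with
  | zero => simp
  | succ n ih =>
    rw [Finset.prod_range_succ, Finset.sum_range_succ]
    have := size_mul_le (∏ i ∈ Finset.range n, f i) (f n)
    omega

theorem size_getD_le (l : List ℕ) (i : ℕ) : Nat.size (l.getD i 0) ≤ size l := by
  induction l generalizing i with
  | nil => simp
  | cons a l ih =>
    cases i with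
    | zero => simp [size]; omega
    | succ i => simpa [size] using (ih i).trans (by simp [size])

theorem length_le_size (l : List ℕ) : l.length ≤ size l := by
  induction l with
  | nil => simp
  | cons a l ih => simp [size] at ih ⊢; omega

/-! ### Contexts -/

/-- A type of contexts: an input word together with finitely many small variables. -/
class Ctx (α : Type) where
  depth : ℕ
  inp : α → List ℕ
  reg : α → ℕ → ℕ

/-- Contexts with more variables are iterated products with `ℕ`. The body of a bounded sum or of a
bounded quantifier is then again a function of a context. -/
instance : Ctx (List ℕ) := ⟨0, id, fun _ _ => 0⟩

instance {α : Type} [Ctx α] : Ctx (α × ℕ) :=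
  ⟨Ctx.depth α + 1, fun p => Ctx.inp p.1,
    fun p j => if j = Ctx.depth α then p.2 else Ctx.reg p.1 j⟩

variable {α : Type} [Ctx α]

/-- The input word of a context. -/
abbrev inp (a : α) : List ℕ := Ctx.inp a

/-- The size measure of a context. -/
def measure (a : α) : ℕ := size (Ctx.inp a) + 2

/-- All variables are bounded by the `D`-th power of the measure. -/
def Valid (D : ℕ) (a : α) : Prop := ∀ j < Ctx.depth α, Ctx.reg a j ≤ measure a ^ D

theorem two_le_measure (a : α) : 2 ≤ measure a := Nat.le_add_left _ _

/-- Polynomially bounded functions of the context. -/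
def PB (F : α → ℕ) : Prop := ∀ D, ∃ d, ∀ a, Valid D a → F a ≤ measure a ^ d

theorem valid_fst {D : ℕ} {p : α × ℕ} (h : Valid D p) : Valid D p.1 := by
  intro j hj
  have := h j (Nat.lt_succ_of_lt hj)
  simp only [Ctx.reg, if_neg hj.ne] at this
  exact this

theorem valid_snd {D : ℕ} {p : α × ℕ} (h : Valid D p) : p.2 ≤ measure p.1 ^ D := by
  have := h (Ctx.depth α) (Nat.lt_succ_self _)
  simp only [Ctx.reg, if_true] at this
  exact this

theorem measure_pow_mono (a : α) {d e : ℕ} (h : d ≤ e) : measure a ^ d ≤ measure a ^ e :=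
  Nat.pow_le_pow_right (by have := two_le_measure a; omega) h

/-- A new variable may need a larger exponent than the old ones. This is why `PB` asks for a bound
for every `D`. -/
theorem valid_mk {D d : ℕ} {a : α} {i : ℕ} (h : Valid D a) (hi : i ≤ measure a ^ d) :
    Valid (max D d) (a, i) := by
  intro j hj
  change _ ≤ measure a ^ _
  simp only [Ctx.reg]
  split_ifs with h'
  · exact hi.trans (measure_pow_mono a (le_max_right _ _))
  · exact (h j (lt_of_le_of_ne (Nat.lt_succ_iff.1 hj) h')).trans
      (measure_pow_mono a (le_max_left _ _))

namespace PB

variable {F G : α → ℕ}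

theorem of_le (hG : PB G) (h : ∀ a, F a ≤ G a) : PB F := fun D => by
  obtain ⟨d, hd⟩ := hG D
  exact ⟨d, fun a ha => (h a).trans (hd a ha)⟩

theorem const (n : ℕ) : PB (fun _ : α => n) := fun _ => ⟨n, fun a _ =>
  (Nat.lt_two_pow_self.le).trans (Nat.pow_le_pow_left (two_le_measure a) n)⟩

theorem mul (hF : PB F) (hG : PB G) : PB (fun a => F a * G a) := fun D => by
  obtain ⟨d, hd⟩ := hF D
  obtain ⟨e, he⟩ := hG D
  exact ⟨d + e, fun a ha => by rw [pow_add]; exact Nat.mul_le_mul (hd a ha) (he a ha)⟩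

theorem add (hF : PB F) (hG : PB G) : PB (fun a => F a + G a) := fun D => by
  obtain ⟨d, hd⟩ := hF D
  obtain ⟨e, he⟩ := hG D
  refine ⟨d + e + 1, fun a ha => ?_⟩
  have h1 := (hd a ha).trans (measure_pow_mono a (Nat.le_add_right d e))
  have h2 := (he a ha).trans (measure_pow_mono a (Nat.le_add_left e d))
  have h3 := Nat.mul_le_mul_left (measure a ^ (d + e)) (two_le_measure a)
  rw [pow_succ]
  dsimp only
  omega

theorem pow (hF : PB F) (n : ℕ) : PB (fun a => F a ^ n) := by
  induction n with
  | zero => simpa using const 1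
  | succ n ih => simpa only [pow_succ] using ih.mul hF

theorem size (hF : PB F) : PB (fun a => Nat.size (F a)) := hF.of_le fun _ => size_le_self _

theorem fst (hF : PB F) : PB (fun p : α × ℕ => F p.1) := fun D => by
  obtain ⟨d, hd⟩ := hF D
  exact ⟨d, fun p hp => hd p.1 (valid_fst hp)⟩

/-- For partial sums, the number of summands is itself a variable, which sits between the original
context and the summation index. -/
theorem skip {f : α → ℕ → ℕ} (hf : PB (fun p : α × ℕ => f p.1 p.2)) :
    PB (fun p : (α × ℕ) × ℕ => f p.1.1 p.2) := fun D => by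
  obtain ⟨d, hd⟩ := hf D
  refine ⟨d, fun p hp => hd (p.1.1, p.2) fun j hj => ?_⟩
  simp only [Ctx.reg]
  split_ifs with hj'
  · exact valid_snd hp
  · exact valid_fst (valid_fst hp) j (lt_of_le_of_ne (Nat.lt_succ_iff.1 hj) hj')

theorem snd : PB (fun p : α × ℕ => p.2) := fun D => ⟨D, fun _ hp => valid_snd hp⟩

theorem measure : PB (fun a : α => measure a) := fun _ => ⟨1, fun _ _ => by simp⟩

theorem length : PB (fun a : α => (inp a).length) :=
  PB.measure.of_le fun _ => (length_le_size _).trans (Nat.le_add_right _ _)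

theorem sum {b : α → ℕ} {f : α → ℕ → ℕ} (hb : PB b) (hf : PB (fun p : α × ℕ => f p.1 p.2)) :
    PB (fun a => ∑ i ∈ Finset.range (b a), f a i) := fun D => by
  obtain ⟨d, hd⟩ := hb D
  obtain ⟨e, he⟩ := hf (max D d)
  refine ⟨d + e, fun a ha => ?_⟩
  have h1 : ∀ i ∈ Finset.range (b a), f a i ≤ RAM.measure a ^ e := fun i hi =>
    he (a, i) (valid_mk ha ((Finset.mem_range.1 hi).le.trans (hd a ha)))
  refine (Finset.sum_le_sum h1).trans ?_
  rw [Finset.sum_const, Finset.card_range, smul_eq_mul, pow_add]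
  exact Nat.mul_le_mul_right _ (hd a ha)

theorem subst {f : α → ℕ → ℕ} {b : α → ℕ} (hf : PB (fun p : α × ℕ => f p.1 p.2)) (hb : PB b) :
    PB (fun a => f a (b a)) := fun D => by
  obtain ⟨d, hd⟩ := hb D
  obtain ⟨e, he⟩ := hf (max D d)
  exact ⟨e, fun a ha => he (a, b a) (valid_mk ha (hd a ha))⟩

end PB

/-! ### Program fragments -/

/-- Register `i` of the work array. -/
abbrev R (i : ℕ) : Expr := .read 1 (.const i)

/-- Assignment to register `i` of the work array. -/
abbrev setR (i : ℕ) (e : Expr) : Program := .write 1 (.const i) e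

@[simp] theorem eval_R (m : Memory) (i : ℕ) : (R i).eval m = m 1 i := rfl

@[simp] theorem set_same (m : Memory) (a i v : ℕ) : m.set a i v a i = v := by simp [Memory.set]

theorem set_ne (m : Memory) {a i v a' i' : ℕ} (h : ¬(a' = a ∧ i' = i)) :
    m.set a i v a' i' = m a' i' := by simp only [Memory.set, if_neg h]

theorem set_eq (m : Memory) (a i v a' i' : ℕ) :
    m.set a i v a' i' = if a' = a ∧ i' = i then v else m a' i' := rfl

/-- The memory holds the input word in array `0` and variable `j` in register `loc j`. -/
structure Rep (loc : ℕ → ℕ) (a : α) (m : Memory) : Prop where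
  length : m 0 0 = (inp a).length
  entry : ∀ i < (inp a).length, m 0 (i + 1) = (inp a).getD i 0
  var : ∀ j < Ctx.depth α, m 1 (loc j) = Ctx.reg a j

/-- The memories agree outside the registers from `r` on. -/
def Frame (r : ℕ) (m m' : Memory) : Prop := ∀ a i, ¬(a = 1 ∧ r ≤ i) → m' a i = m a i

theorem Frame.trans {r : ℕ} {m m' m'' : Memory} (h : Frame r m m') (h' : Frame r m' m'') :
    Frame r m m'' := fun a i hi => (h' a i hi).trans (h a i hi)

theorem Frame.mono {r s : ℕ} {m m' : Memory} (h : Frame s m m') (hrs : r ≤ s) : Frame r m m' :=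
  fun a i hi => h a i fun hh => hi ⟨hh.1, hrs.trans hh.2⟩

theorem Frame.set {r i : ℕ} (m : Memory) (hi : r ≤ i) (v : ℕ) : Frame r m (m.set 1 i v) :=
  fun _ _ hj => set_ne m fun hh => hj ⟨hh.1, hh.2 ▸ hi⟩

theorem Frame.reg {r i : ℕ} {m m' : Memory} (h : Frame r m m') (hi : i < r) : m' 1 i = m 1 i :=
  h 1 i (by omega)

theorem Rep.frame {loc : ℕ → ℕ} {a : α} {m m' : Memory} {r : ℕ} (h : Rep loc a m)
    (hloc : ∀ j < Ctx.depth α, loc j < r) (hf : Frame r m m') : Rep loc a m' where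
  length := by rw [hf 0 0 (by omega), h.length]
  entry i hi := by rw [hf 0 _ (by omega), h.entry i hi]
  var j hj := by rw [hf.reg (hloc j hj), h.var j hj]

theorem Rep.fst {loc : ℕ → ℕ} {p : α × ℕ} {m : Memory} (h : Rep loc p m) : Rep loc p.1 m where
  length := h.length
  entry := h.entry
  var j hj := by
    rw [h.var j (Nat.lt_succ_of_lt hj)]; simp [Ctx.reg, hj.ne]

/-- Storing a further variable in register `r`. -/
theorem Rep.push {loc : ℕ → ℕ} {a : α} {m : Memory} {r v : ℕ} (h : Rep loc a m)
    (hv : m 1 r = v) : Rep (Function.update loc (Ctx.depth α) r) (a, v) m where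
  length := h.length
  entry := h.entry
  var j hj := by
    by_cases hj' : j = Ctx.depth α
    · subst hj'; simp [Ctx.reg, hv]
    · rw [Function.update_of_ne hj',
        h.var j (lt_of_le_of_ne (Nat.lt_succ_iff.1 hj) hj')]
      simp [Ctx.reg, hj']

/-- Started in `m`, the program `c` halts in `m'` in time at most `T`. -/
def ExecLE (c : Program) (m : Memory) (T : ℕ) (m' : Memory) : Prop := ∃ t ≤ T, Exec c m t m'

theorem ExecLE.mono {c : Program} {m m' : Memory} {T T' : ℕ} (h : ExecLE c m T m') (hT : T ≤ T') :
    ExecLE c m T' m' := by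
  obtain ⟨t, ht, h⟩ := h
  exact ⟨t, ht.trans hT, h⟩

theorem ExecLE.seq {c₁ c₂ : Program} {m m₁ m₂ : Memory} {T₁ T₂ : ℕ} (h₁ : ExecLE c₁ m T₁ m₁)
    (h₂ : ExecLE c₂ m₁ T₂ m₂) : ExecLE (.seq c₁ c₂) m (T₁ + T₂) m₂ := by
  obtain ⟨t₁, ht₁, h₁⟩ := h₁
  obtain ⟨t₂, ht₂, h₂⟩ := h₂
  exact ⟨t₁ + t₂, by omega, h₁.seq h₂⟩

theorem ExecLE.write (m : Memory) (a : ℕ) (i e : Expr) :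
    ExecLE (.write a i e) m (i.cost m + e.cost m + 1) (m.set a (i.eval m) (e.eval m)) :=
  ⟨_, le_rfl, .write m a i e⟩

theorem ExecLE.setR (m : Memory) (i : ℕ) (e : Expr) :
    ExecLE (setR i e) m (Nat.size i + e.cost m + 2) (m.set 1 i (e.eval m)) :=
  (ExecLE.write m 1 (.const i) e).mono (by simp [Expr.cost]; omega)

theorem cost_R (m : Memory) (i : ℕ) : (R i).cost m = Nat.size i + Nat.size (m 1 i) + 2 := by
  simp only [Expr.cost, Expr.eval]; omega

theorem ExecLE.ite {e : Expr} {c₁ c₂ : Program} {m m' : Memory} {T : ℕ}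
    (h : ExecLE (if e.eval m ≠ 0 then c₁ else c₂) m T m') :
    ExecLE (.ite e c₁ c₂) m (e.cost m + 1 + T) m' := by
  obtain ⟨t, ht, h⟩ := h
  by_cases he : e.eval m = 0
  · rw [if_neg (by simpa using he)] at h
    exact ⟨_, by omega, .ite_false he h⟩
  · rw [if_pos he] at h
    exact ⟨_, by omega, .ite_true he h⟩

/-- Loops with a counter. -/
theorem ExecLE.loop (e : Expr) (c : Program) (Inv : ℕ → Memory → Prop) (T : ℕ → ℕ) (n S : ℕ)
    (htest : ∀ i ≤ n, ∀ m, Inv i m → (e.eval m = 0 ↔ i = n) ∧ e.cost m ≤ S)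
    (hbody : ∀ i < n, ∀ m, Inv i m → ∃ m', ExecLE c m (T i) m' ∧ Inv (i + 1) m')
    (m : Memory) (hm : Inv 0 m) :
    ∃ m', ExecLE (.while e c) m (∑ i ∈ Finset.range n, (T i + S + 1) + S + 1) m' ∧ Inv n m' := by
  -- Induction on the number `k` of remaining iterations.
  suffices H : ∀ k ≤ n, ∀ m, Inv (n - k) m → ∃ m', ExecLE (.while e c) m
      (∑ i ∈ Finset.Ico (n - k) n, (T i + S + 1) + S + 1) m' ∧ Inv n m' by
    have := H n le_rfl m (by simpa using hm)
    simpa using this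
  intro k
  induction k with
  | zero =>
    intro _ m hm
    obtain ⟨h1, h2⟩ := htest n le_rfl m (by simpa using hm)
    exact ⟨m, ⟨_, by simpa using h2, .while_false (h1.2 rfl)⟩, by simpa using hm⟩
  | succ k ih =>
    intro hk m hm
    have hlt : n - (k + 1) < n := by omega
    obtain ⟨h1, h2⟩ := htest _ hlt.le m hm
    obtain ⟨m', ⟨t, ht, hc⟩, hm'⟩ := hbody _ hlt m hm
    rw [show n - (k + 1) + 1 = n - k by omega] at hm'
    obtain ⟨m'', ⟨t', ht', hc'⟩, hm''⟩ := ih (by omega) m' hm'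
    refine ⟨m'', ⟨_, ?_, .while_true (fun h => hlt.ne (h1.1 h)) hc hc'⟩, hm''⟩
    rw [Finset.sum_eq_sum_Ico_succ_bot hlt, show n - (k + 1) + 1 = n - k by omega]
    omega

/-! ### Functions computable in polynomial time -/

/-- The program `c` computes `F` into register `r`, using only registers from `r` on. -/
def Computes (F : α → ℕ) (loc : ℕ → ℕ) (r : ℕ) (c : Program) (T : α → ℕ) : Prop :=
  ∀ a m, Rep loc a m → ∃ m', ExecLE c m (T a) m' ∧ m' 1 r = F a ∧ Frame r m m'

/-- Functions computable in polynomial time. -/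
def PT (F : α → ℕ) : Prop :=
  PB (fun a => Nat.size (F a)) ∧
    ∀ (loc : ℕ → ℕ) (r : ℕ), (∀ j < Ctx.depth α, loc j < r) →
      ∃ (c : Program) (T : α → ℕ), PB T ∧ Computes F loc r c T

namespace PT

variable {F G : α → ℕ}

/-- Addresses are paid for, so the cost depends on where the variables are stored. The sum of `loc`
dominates every single position and is a constant once the layout is fixed. -/
theorem of_expr (hB : PB (fun a => Nat.size (F a))) (S : α → ℕ → ℕ)
    (hS : ∀ r, PB (fun a => S a r))
    (h : ∀ loc : ℕ → ℕ, ∃ e : Expr, ∀ a m, Rep loc a m → e.eval m = F a ∧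
      e.cost m ≤ S a (∑ j ∈ Finset.range (Ctx.depth α), loc j)) : PT F := by
  refine ⟨hB, fun loc r hr => ?_⟩
  obtain ⟨e, he⟩ := h loc
  refine ⟨setR r e, fun a => Nat.size r + S a (∑ j ∈ Finset.range (Ctx.depth α), loc j) + 2,
    ((PB.const _).add (hS _)).add (PB.const 2), fun a m hm => ?_⟩
  obtain ⟨h1, h2⟩ := he a m hm
  exact ⟨_, (ExecLE.setR m r e).mono (by dsimp only; omega), by simp [h1], Frame.set m le_rfl _⟩

theorem const (n : ℕ) : PT (fun _ : α => n) :=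
  of_expr (PB.const _) (fun _ _ => Nat.size n + 1) (fun _ => PB.const _) fun _ =>
    ⟨.const n, fun _ _ _ => ⟨rfl, le_rfl⟩⟩

theorem length : PT (fun a : α => (inp a).length) :=
  of_expr PB.length.size (fun a _ => Nat.size (inp a).length + 2)
    (fun _ => PB.length.size.add (PB.const 2)) fun _ =>
    ⟨.read 0 (.const 0), fun a m h => ⟨h.length, by simp [Expr.cost, Expr.eval, h.length]; omega⟩⟩

theorem snd : PT (fun p : α × ℕ => p.2) :=
  of_expr PB.snd.size (fun p r => r + Nat.size p.2 + 2)
    (fun _ => ((PB.const _).add PB.snd.size).add (PB.const 2)) fun loc =>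
    ⟨R (loc (Ctx.depth α)), fun p m h => by
      have h1 := h.var (Ctx.depth α) (Nat.lt_succ_self _)
      simp only [Ctx.reg, if_true] at h1
      refine ⟨h1, ?_⟩
      have h2 : loc (Ctx.depth α) ≤ ∑ j ∈ Finset.range (Ctx.depth (α × ℕ)), loc j :=
        Finset.single_le_sum (f := loc) (fun _ _ => Nat.zero_le _)
          (Finset.mem_range.2 (Nat.lt_succ_self _))
      rw [cost_R, h1]
      have := size_le_self (loc (Ctx.depth α))
      omega⟩

theorem fst (hF : PT F) : PT (fun p : α × ℕ => F p.1) := by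
  refine ⟨hF.1.fst, fun loc r hr => ?_⟩
  obtain ⟨c, T, hT, hc⟩ := hF.2 loc r fun j hj => hr j (Nat.lt_succ_of_lt hj)
  exact ⟨c, fun p => T p.1, hT.fst, fun p m hm => hc p.1 m hm.fst⟩

theorem binary (op : ℕ → ℕ → ℕ) (E : Expr → Expr → Expr)
    (heval : ∀ e₁ e₂ m, (E e₁ e₂).eval m = op (e₁.eval m) (e₂.eval m))
    (hcost : ∀ e₁ e₂ m, (E e₁ e₂).cost m =
      e₁.cost m + e₂.cost m + Nat.size (op (e₁.eval m) (e₂.eval m)) + 1)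
    (hF : PT F) (hG : PT G) (hB : PB (fun a => Nat.size (op (F a) (G a)))) :
    PT (fun a => op (F a) (G a)) := by
  refine ⟨hB, fun loc r hr => ?_⟩
  obtain ⟨c₁, T₁, hT₁, hc₁⟩ := hF.2 loc r hr
  obtain ⟨c₂, T₂, hT₂, hc₂⟩ := hG.2 loc (r + 1) fun j hj => (hr j hj).trans (Nat.lt_succ_self r)
  refine ⟨.seq c₁ (.seq c₂ (setR r (E (R r) (R (r + 1))))),
    fun a => T₁ a + (T₂ a + ((Nat.size r + Nat.size r + Nat.size (r + 1) + 7) +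
      (Nat.size (F a) + Nat.size (G a) + Nat.size (op (F a) (G a))))),
    hT₁.add (hT₂.add ((PB.const _).add ((hF.1.add hG.1).add hB))), fun a m hm => ?_⟩
  obtain ⟨m₁, e₁, v₁, f₁⟩ := hc₁ a m hm
  obtain ⟨m₂, e₂, v₂, f₂⟩ := hc₂ a m₁ (hm.frame hr f₁)
  have v₁' : m₂ 1 r = F a := by rw [f₂.reg (Nat.lt_succ_self r), v₁]
  refine ⟨_, e₁.seq (e₂.seq ((ExecLE.setR m₂ r _).mono ?_)), ?_,
    (f₁.trans (f₂.mono (Nat.le_succ r))).trans (Frame.set m₂ le_rfl _)⟩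
  · rw [hcost, cost_R, cost_R, eval_R, eval_R, v₁', v₂]
    omega
  · rw [set_same, heval, eval_R, eval_R, v₁', v₂]

theorem add (hF : PT F) (hG : PT G) : PT (fun a => F a + G a) :=
  binary (· + ·) .add (fun _ _ _ => rfl) (fun _ _ _ => rfl) hF hG
    (((hF.1.add hG.1).add (PB.const 1)).of_le fun _ => size_add_le _ _)

theorem sub (hF : PT F) (hG : PT G) : PT (fun a => F a - G a) :=
  binary (· - ·) .sub (fun _ _ _ => rfl) (fun _ _ _ => rfl) hF hG
    (hF.1.of_le fun _ => Nat.size_le_size (Nat.sub_le _ _))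

theorem mul (hF : PT F) (hG : PT G) : PT (fun a => F a * G a) :=
  binary (· * ·) .mul (fun _ _ _ => rfl) (fun _ _ _ => rfl) hF hG
    ((hF.1.add hG.1).of_le fun _ => size_mul_le _ _)

theorem div (hF : PT F) (hG : PT G) : PT (fun a => F a / G a) :=
  binary (· / ·) .div (fun _ _ _ => rfl) (fun _ _ _ => rfl) hF hG
    (hF.1.of_le fun _ => Nat.size_le_size (Nat.div_le_self _ _))

theorem of_eq (hF : PT F) (h : ∀ a, F a = G a) : PT G := by
  rwa [show G = F from funext fun a => (h a).symm]

theorem mod (hF : PT F) (hG : PT G) : PT (fun a => F a % G a) :=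
  (hF.sub (hG.mul (hF.div hG))).of_eq fun a => by
    have := Nat.mod_add_div (F a) (G a); omega

theorem min (hF : PT F) (hG : PT G) : PT (fun a => min (F a) (G a)) :=
  (hF.sub (hF.sub hG)).of_eq fun a => by omega

/-- The index has to be compared with the length first, because nothing is known about array `0`
beyond the word. -/
theorem getD (hF : PT F) : PT (fun a => (inp a).getD (F a) 0) := by
  have hB : PB (fun a => Nat.size ((inp a).getD (F a) 0)) :=
    PB.measure.of_le fun _ => (size_getD_le _ _).trans (Nat.le_add_right _ _)
  refine ⟨hB, fun loc r hr => ?_⟩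
  obtain ⟨c, T, hT, hc⟩ := hF.2 loc r hr
  refine ⟨.seq c (.ite (.sub (.read 0 (.const 0)) (R r))
    (setR r (.read 0 (.add (R r) (.const 1)))) (setR r (.const 0))),
    fun a => T a + ((Nat.size r + Nat.size r + Nat.size r + 20) +
      (Nat.size (F a) + Nat.size (F a) + Nat.size (F a) + Nat.size (inp a).length +
        Nat.size (inp a).length + Nat.size ((inp a).getD (F a) 0))),
    hT.add ((PB.const _).add (((((hF.1.add hF.1).add hF.1).add PB.length.size).add
      PB.length.size).add hB)), fun a m hm => ?_⟩
  obtain ⟨m₁, e₁, v₁, f₁⟩ := hc a m hm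
  have hm₁ := hm.frame hr f₁
  have hs : Nat.size ((inp a).length - F a) ≤ Nat.size (inp a).length :=
    Nat.size_le_size (Nat.sub_le _ _)
  have h1 : Nat.size 1 = 1 := by simp
  have hs2 := size_add_le (F a) 1
  by_cases h : F a < (inp a).length
  · refine ⟨_, (e₁.seq (ExecLE.ite (T := Nat.size r + (Expr.read 0 (.add (R r) (.const 1))).cost m₁
      + 2) (m' := m₁.set 1 r ((inp a).getD (F a) 0)) ?_)).mono ?_, set_same _ _ _ _,
      f₁.trans (Frame.set _ le_rfl _)⟩
    · have hne : (Expr.sub (.read 0 (.const 0)) (R r)).eval m₁ ≠ 0 := by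
        simp only [Expr.eval, hm₁.length, v₁]; omega
      rw [if_pos hne]
      have := ExecLE.setR m₁ r (.read 0 (.add (R r) (.const 1)))
      simpa only [Expr.eval, v₁, hm₁.entry _ h] using this
    · simp only [Expr.cost, Expr.eval, hm₁.length, v₁, hm₁.entry _ h]
      simp only [Nat.size_zero, h1]
      omega
  · refine ⟨_, (e₁.seq (ExecLE.ite (T := Nat.size r + (Expr.const 0).cost m₁
      + 2) (m' := m₁.set 1 r ((inp a).getD (F a) 0)) ?_)).mono ?_, set_same _ _ _ _,
      f₁.trans (Frame.set _ le_rfl _)⟩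
    · have hne : ¬ (Expr.sub (.read 0 (.const 0)) (R r)).eval m₁ ≠ 0 := by
        simp only [Expr.eval, hm₁.length, v₁]; omega
      rw [if_neg hne]
      have := ExecLE.setR m₁ r (.const 0)
      rwa [show (Expr.const 0).eval m₁ = (inp a).getD (F a) 0 from
        (List.getD_eq_default _ _ (not_lt.1 h)).symm] at this
    · simp only [Expr.cost, Expr.eval, hm₁.length, v₁]
      simp only [Nat.size_zero]
      omega

end PT

end RAM

/-! ### Loops in polynomial time: sums, products, powers, iteration -/

namespace RAM

variable {α : Type} [Ctx α]

namespace PT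

variable {F G : α → ℕ}

/-- Accumulation of the values `f a i`, `i < b a`, by a binary operation. -/
theorem accum (op : ℕ → ℕ → ℕ) (E : Expr → Expr → Expr)
    (heval : ∀ e₁ e₂ m, (E e₁ e₂).eval m = op (e₁.eval m) (e₂.eval m))
    (hcost : ∀ e₁ e₂ m, (E e₁ e₂).cost m =
      e₁.cost m + e₂.cost m + Nat.size (op (e₁.eval m) (e₂.eval m)) + 1)
    (hop : ∀ x y, Nat.size (op x y) ≤ Nat.size x + Nat.size y + 1)
    {b : α → ℕ} {f g : α → ℕ → ℕ} (c₀ : ℕ) (hg0 : ∀ a, g a 0 = c₀)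
    (hgs : ∀ a i, g a (i + 1) = op (g a i) (f a i)) (hb : PT b) (hbB : PB b)
    (hf : PT (fun p : α × ℕ => f p.1 p.2))
    (hgB : PB (fun p : α × ℕ => Nat.size (g p.1 p.2))) : PT (fun a => g a (b a)) := by
  have hB : PB (fun a => Nat.size (g a (b a))) := hgB.subst (f := fun a i => Nat.size (g a i)) hbB
  refine ⟨hB, fun loc r hr => ?_⟩
  -- Register `r` holds the bound, `r + 1` the accumulator and `r + 2` the counter; `f` is evaluated
  -- into `r + 3`.
  obtain ⟨cb, Tb, hTb, hcb⟩ := hb.2 loc r hr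
  have hr' : ∀ j < Ctx.depth (α × ℕ), Function.update loc (Ctx.depth α) (r + 2) j < r + 3 := by
    intro j hj
    by_cases hj' : j = Ctx.depth α
    · subst hj'; simp
    · rw [Function.update_of_ne hj']
      have := hr j (lt_of_le_of_ne (Nat.lt_succ_iff.1 hj) hj')
      omega
  obtain ⟨cf, Tf, hTf, hcf⟩ := hf.2 _ (r + 3) hr'
  set W := Nat.size r + Nat.size (r + 1) + Nat.size (r + 2) + Nat.size (r + 3) with hW
  let TI : α × ℕ → ℕ := fun p => Tf p + ((4 * W + 40) + 2 * Nat.size (g p.1 p.2) +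
    2 * Nat.size (f p.1 p.2) + 2 * Nat.size p.2)
  have hTI : PB TI := hTf.add ((((PB.const _).add ((PB.const 2).mul hgB)).add
    ((PB.const 2).mul hf.1)).add ((PB.const 2).mul PB.snd.size))
  let S : α → ℕ := fun a => 2 * W + 2 * Nat.size (b a) + Nat.size (b a) + 10
  have hS : PB S := (((PB.const _).add ((PB.const 2).mul hb.1)).add hb.1).add (PB.const _)
  refine ⟨.seq cb (.seq (setR (r + 1) (.const c₀)) (.seq (setR (r + 2) (.const 0))
    (.seq (.while (.sub (R r) (R (r + 2))) (.seq cf (.seq (setR (r + 1) (E (R (r + 1)) (R (r + 3))))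
      (setR (r + 2) (.add (R (r + 2)) (.const 1)))))) (setR r (R (r + 1)))))),
    fun a => Tb a + ((2 * W + Nat.size c₀ + 20) +
      (∑ i ∈ Finset.range (b a), (TI (a, i) + S a + 1) + S a + 1 +
        (2 * W + Nat.size (g a (b a)) + 10))),
    hTb.add ((PB.const _).add (((((hbB.sum ((hTI.add hS.fst).add (PB.const 1))).add hS).add
      (PB.const 1))).add (((PB.const _).add hB).add (PB.const _)))), fun a m hm => ?_⟩
  obtain ⟨m₁, e₁, v₁, f₁⟩ := hcb a m hm
  let Inv : ℕ → Memory → Prop := fun i m' =>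
    Frame r m m' ∧ m' 1 r = b a ∧ m' 1 (r + 1) = g a i ∧ m' 1 (r + 2) = i
  have h1 : Nat.size 1 = 1 := by simp
  have hloop := ExecLE.loop (.sub (R r) (R (r + 2)))
    (.seq cf (.seq (setR (r + 1) (E (R (r + 1)) (R (r + 3))))
      (setR (r + 2) (.add (R (r + 2)) (.const 1))))) Inv (fun i => TI (a, i)) (b a) (S a)
    (by
      rintro i hi m' ⟨_, h2, _, h4⟩
      refine ⟨by simp only [Expr.eval, h2, h4]; omega, ?_⟩
      have e1 := Nat.size_le_size hi
      have e2 := Nat.size_le_size (Nat.sub_le (b a) i)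
      simp only [Expr.cost, Expr.eval, h2, h4]
      simp only [S]
      omega)
    (by
      rintro i hi m' ⟨h1', h2, h3, h4⟩
      obtain ⟨m₂, e₂, v₂, f₂⟩ := hcf (a, i) m' ((hm.frame hr h1').push h4)
      have w1 : m₂ 1 (r + 1) = g a i := by rw [f₂.reg (by omega), h3]
      have w2 : m₂ 1 (r + 2) = i := by rw [f₂.reg (by omega), h4]
      have w0 : m₂ 1 r = b a := by rw [f₂.reg (by omega), h2]
      refine ⟨_, (e₂.seq ((ExecLE.setR m₂ (r + 1) _).seq (ExecLE.setR _ (r + 2) _))).mono ?_, ?_⟩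
      · rw [hcost, cost_R, cost_R, eval_R, eval_R, w1, v₂]
        simp only [Expr.cost, Expr.eval, set_ne _ (show ¬(1 = 1 ∧ r + 2 = r + 1) by omega), w2]
        have e1 := hop (g a i) (f a i)
        have e2 := size_add_le i 1
        simp only [TI]
        omega
      · refine ⟨(((h1'.trans (f₂.mono (by omega))).trans (Frame.set _ (by omega) _)).trans
          (Frame.set _ (by omega) _)), ?_, ?_, ?_⟩
        · simp [set_eq, w0]
        · simp [set_eq, heval, w1, v₂, hgs]
        · simp [set_eq, Expr.eval, w2])
  obtain ⟨m₃, e₃, f₃, v₃, v₄, v₅⟩ := hloop ((m₁.set 1 (r + 1) c₀).set 1 (r + 2) 0)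
    ⟨(f₁.trans (Frame.set _ (by omega) _)).trans (Frame.set _ (by omega) _),
      by simp [set_eq, v₁], by simp [set_eq, hg0], by simp⟩
  refine ⟨_, (e₁.seq ((ExecLE.setR m₁ (r + 1) (.const c₀)).seq ((ExecLE.setR _ (r + 2)
    (.const 0)).seq (e₃.seq (ExecLE.setR _ r _))))).mono ?_, ?_, f₃.trans (Frame.set _ le_rfl _)⟩
  · rw [cost_R, v₄]
    simp only [Expr.cost, Nat.size_zero]
    omega
  · simp [v₄]

theorem sum {b : α → ℕ} {f : α → ℕ → ℕ} (hb : PT b) (hbB : PB b)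
    (hf : PT (fun p : α × ℕ => f p.1 p.2)) :
    PT (fun a => ∑ i ∈ Finset.range (b a), f a i) :=
  accum (· + ·) .add (fun _ _ _ => rfl) (fun _ _ _ => rfl) size_add_le
    (g := fun a n => ∑ i ∈ Finset.range n, f a i) 0 (fun _ => rfl)
    (fun _ _ => Finset.sum_range_succ _ _) hb hbB hf
    ((PB.sum (f := fun (p : α × ℕ) i => Nat.size (f p.1 i) + 1) PB.snd ((hf.1.add (PB.const 1)).skip (f := fun a i => Nat.size (f a i) + 1))).of_le fun _ => size_sum_le _ _)

theorem prod {b : α → ℕ} {f : α → ℕ → ℕ} (hb : PT b) (hbB : PB b)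
    (hf : PT (fun p : α × ℕ => f p.1 p.2)) :
    PT (fun a => ∏ i ∈ Finset.range (b a), f a i) :=
  accum (· * ·) .mul (fun _ _ _ => rfl) (fun _ _ _ => rfl)
    (fun x y => (size_mul_le x y).trans (Nat.le_succ _))
    (g := fun a n => ∏ i ∈ Finset.range n, f a i) 1 (fun _ => rfl)
    (fun _ _ => Finset.prod_range_succ _ _) hb hbB hf
    (((PB.const 1).add (PB.sum (f := fun (p : α × ℕ) i => Nat.size (f p.1 i)) PB.snd (hf.1.skip (f := fun a i => Nat.size (f a i))))).of_le fun _ => size_prod_le _ _)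

/-- The exponent is a number of iterations and needs a polynomially bounded value; of the power
itself, only the number of digits is bounded. -/
theorem pow (hF : PT F) (hG : PT G) (hGB : PB G) : PT (fun a => F a ^ G a) :=
  (prod (f := fun a _ => F a) hG hGB hF.fst).of_eq fun a => by simp

/-- Iteration of a function with polynomially bounded values. -/
theorem iterate {n f₀ : α → ℕ} {step : α → ℕ → ℕ} {cap : α → ℕ} (hn : PT n) (hnB : PB n)
    (h₀ : PT f₀) (hstep : PT (fun p : α × ℕ => step p.1 p.2)) (hcap : PB cap)
    (hle : ∀ a i, (step a)^[i] (f₀ a) ≤ cap a) : PT (fun a => (step a)^[n a] (f₀ a)) := by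
  have hB : PB (fun a => Nat.size ((step a)^[n a] (f₀ a))) :=
    hcap.of_le fun a => (size_le_self _).trans (hle a _)
  refine ⟨hB, fun loc r hr => ?_⟩
  obtain ⟨cn, Tn, hTn, hcn⟩ := hn.2 loc r hr
  obtain ⟨c0, T0, hT0, hc0⟩ := h₀.2 loc (r + 1) fun j hj => (hr j hj).trans (Nat.lt_succ_self r)
  have hr' : ∀ j < Ctx.depth (α × ℕ), Function.update loc (Ctx.depth α) (r + 1) j < r + 3 := by
    intro j hj
    by_cases hj' : j = Ctx.depth α
    · subst hj'; simp
    · rw [Function.update_of_ne hj']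
      have := hr j (lt_of_le_of_ne (Nat.lt_succ_iff.1 hj) hj')
      omega
  obtain ⟨cf, Tf, hTf, hcf⟩ := hstep.2 _ (r + 3) hr'
  set W := Nat.size r + Nat.size (r + 1) + Nat.size (r + 2) + Nat.size (r + 3) with hW
  -- The argument of `step` varies during the iteration. The sum of the running times over all
  -- values up to `cap a` bounds each of them.
  let U : α → ℕ := fun a => ∑ v ∈ Finset.range (cap a + 1), Tf (a, v)
  have hU : PB U := (hcap.add (PB.const 1)).sum hTf
  let TI : α × ℕ → ℕ := fun p => U p.1 + ((4 * W + 40) + 2 * cap p.1 + 2 * Nat.size p.2)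
  have hTI : PB TI := hU.fst.add (((PB.const _).add ((PB.const 2).mul hcap.fst)).add
    ((PB.const 2).mul PB.snd.size))
  let S : α → ℕ := fun a => 2 * W + 2 * Nat.size (n a) + Nat.size (n a) + 10
  have hS : PB S := (((PB.const _).add ((PB.const 2).mul hn.1)).add hn.1).add (PB.const _)
  refine ⟨.seq cn (.seq c0 (.seq (setR (r + 2) (.const 0))
    (.seq (.while (.sub (R r) (R (r + 2))) (.seq cf (.seq (setR (r + 1) (R (r + 3)))
      (setR (r + 2) (.add (R (r + 2)) (.const 1)))))) (setR r (R (r + 1)))))),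
    fun a => Tn a + (T0 a + ((2 * W + 20) +
      (∑ i ∈ Finset.range (n a), (TI (a, i) + S a + 1) + S a + 1 +
        (2 * W + cap a + 10)))),
    hTn.add (hT0.add ((PB.const _).add (((((hnB.sum ((hTI.add hS.fst).add (PB.const 1))).add
      hS).add (PB.const 1))).add (((PB.const _).add hcap).add (PB.const _))))), fun a m hm => ?_⟩
  obtain ⟨m₁, e₁, v₁, f₁⟩ := hcn a m hm
  obtain ⟨m₂, e₂, v₂, f₂⟩ := hc0 a m₁ (hm.frame hr f₁)
  let Inv : ℕ → Memory → Prop := fun i m' =>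
    Frame r m m' ∧ m' 1 r = n a ∧ m' 1 (r + 1) = (step a)^[i] (f₀ a) ∧ m' 1 (r + 2) = i
  have h1 : Nat.size 1 = 1 := by simp
  have hsz : ∀ i, Nat.size ((step a)^[i] (f₀ a)) ≤ cap a := fun i =>
    (size_le_self _).trans (hle a i)
  have hloop := ExecLE.loop (.sub (R r) (R (r + 2)))
    (.seq cf (.seq (setR (r + 1) (R (r + 3)))
      (setR (r + 2) (.add (R (r + 2)) (.const 1))))) Inv (fun i => TI (a, i)) (n a) (S a)
    (by
      rintro i hi m' ⟨_, h2, _, h4⟩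
      refine ⟨by simp only [Expr.eval, h2, h4]; omega, ?_⟩
      have e1 := Nat.size_le_size hi
      have e2 := Nat.size_le_size (Nat.sub_le (n a) i)
      simp only [Expr.cost, Expr.eval, h2, h4]
      simp only [S]
      omega)
    (by
      rintro i hi m' ⟨h1', h2, h3, h4⟩
      obtain ⟨m₃, e₃, v₃, f₃⟩ := hcf (a, _) m' ((hm.frame hr h1').push h3)
      have w2 : m₃ 1 (r + 2) = i := by rw [f₃.reg (by omega), h4]
      have w0 : m₃ 1 r = n a := by rw [f₃.reg (by omega), h2]
      have v₃' : m₃ 1 (r + 3) = (step a)^[i + 1] (f₀ a) := by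
        rw [v₃, Function.iterate_succ_apply']
      refine ⟨_, (e₃.seq ((ExecLE.setR m₃ (r + 1) _).seq (ExecLE.setR _ (r + 2) _))).mono ?_, ?_⟩
      · rw [cost_R, v₃']
        simp only [Expr.cost, Expr.eval, set_ne _ (show ¬(1 = 1 ∧ r + 2 = r + 1) by omega), w2]
        have e2 := size_add_le i 1
        have e3 := hsz (i + 1)
        have e4 : Tf (a, (step a)^[i] (f₀ a)) ≤ U a :=
          Finset.single_le_sum (f := fun v => Tf (a, v)) (fun _ _ => Nat.zero_le _)
            (Finset.mem_range.2 (Nat.lt_succ_of_le (hle a i)))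
        simp only [TI]
        omega
      · refine ⟨(((h1'.trans (f₃.mono (by omega))).trans (Frame.set _ (by omega) _)).trans
          (Frame.set _ (by omega) _)), ?_, ?_, ?_⟩
        · simp [set_eq, w0]
        · simp [set_eq, v₃']
        · simp [set_eq, Expr.eval, w2])
  obtain ⟨m₃, e₃, f₃, v₃, v₄, v₅⟩ := hloop (m₂.set 1 (r + 2) 0)
    ⟨(f₁.trans (f₂.mono (by omega))).trans (Frame.set _ (by omega) _),
      by simp [set_eq, f₂.reg (Nat.lt_succ_self r), v₁], by simp [set_eq, v₂], by simp⟩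
  refine ⟨_, (e₁.seq (e₂.seq ((ExecLE.setR _ (r + 2)
    (.const 0)).seq (e₃.seq (ExecLE.setR _ r _))))).mono ?_, ?_, f₃.trans (Frame.set _ le_rfl _)⟩
  · rw [cost_R, v₄]
    have e3 := hsz (n a)
    simp only [Expr.cost, Nat.size_zero]
    omega
  · simp [v₄]

end PT

/-! ### Predicates decidable in polynomial time -/

open Classical in
/-- The number `1` if `P` holds and `0` otherwise. -/
noncomputable def ind (P : Prop) : ℕ := if P then 1 else 0

theorem ind_true {P : Prop} (h : P) : ind P = 1 := if_pos h

theorem ind_false {P : Prop} (h : ¬P) : ind P = 0 := if_neg h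

theorem ind_congr {P Q : Prop} (h : P ↔ Q) : ind P = ind Q := by rw [propext h]

theorem ind_cases (P : Prop) : P ∧ ind P = 1 ∨ ¬P ∧ ind P = 0 := by
  by_cases h : P
  · exact .inl ⟨h, ind_true h⟩
  · exact .inr ⟨h, ind_false h⟩

/-- Predicates decidable in polynomial time. -/
def PD (P : α → Prop) : Prop := PT (fun a => ind (P a))

namespace PD

variable {P Q : α → Prop} {F G : α → ℕ}

theorem of_iff (hP : PD P) (h : ∀ a, P a ↔ Q a) : PD Q := PT.of_eq hP fun a => ind_congr (h a)

theorem not (hP : PD P) : PD (fun a => ¬P a) :=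
  ((PT.const 1).sub hP).of_eq fun a => by
    rcases ind_cases (P a) with ⟨h, h'⟩ | ⟨h, h'⟩
    · rw [h', ind_false (not_not.2 h)]
    · rw [h', ind_true h]

theorem and (hP : PD P) (hQ : PD Q) : PD (fun a => P a ∧ Q a) :=
  (PT.mul hP hQ).of_eq fun a => by
    rcases ind_cases (P a) with ⟨h, h'⟩ | ⟨h, h'⟩ <;>
    rcases ind_cases (Q a) with ⟨k, k'⟩ | ⟨k, k'⟩ <;> rw [h', k']
    · rw [ind_true ⟨h, k⟩]
    · rw [ind_false fun hh => k hh.2]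
    · rw [ind_false fun hh => h hh.1]
    · rw [ind_false fun hh => h hh.1]

theorem or (hP : PD P) (hQ : PD Q) : PD (fun a => P a ∨ Q a) :=
  (hP.not.and hQ.not).not.of_iff fun a => by tauto

theorem imp (hP : PD P) (hQ : PD Q) : PD (fun a => P a → Q a) :=
  (hP.not.or hQ).of_iff fun a => by tauto

theorem const (p : Prop) : PD (fun _ : α => p) := PT.const (ind p)

theorem le (hF : PT F) (hG : PT G) : PD (fun a => F a ≤ G a) :=
  ((PT.const 1).sub (hF.sub hG)).of_eq fun a => by
    rcases ind_cases (F a ≤ G a) with ⟨h, h'⟩ | ⟨h, h'⟩ <;> rw [h'] <;> omega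

theorem lt (hF : PT F) (hG : PT G) : PD (fun a => F a < G a) :=
  (le hG hF).not.of_iff fun a => by omega

theorem eq (hF : PT F) (hG : PT G) : PD (fun a => F a = G a) :=
  ((le hF hG).and (le hG hF)).of_iff fun a => by omega

theorem fst (hP : PD P) : PD (fun p : α × ℕ => P p.1) := PT.fst hP

/-- The indicators are added up over the whole range, so the range must have polynomial length. -/
theorem exists_lt {b : α → ℕ} {P : α → ℕ → Prop} (hb : PT b) (hbB : PB b)
    (hP : PD (fun p : α × ℕ => P p.1 p.2)) : PD (fun a => ∃ i < b a, P a i) :=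
  (le (PT.const 1) (PT.sum (f := fun a i => ind (P a i)) hb hbB hP)).of_iff fun a => by
    rw [Nat.one_le_iff_ne_zero, Ne, Finset.sum_eq_zero_iff]
    push Not
    refine ⟨fun ⟨i, hi, h⟩ => ⟨i, Finset.mem_range.1 hi, ?_⟩,
      fun ⟨i, hi, h⟩ => ⟨i, Finset.mem_range.2 hi, by rw [ind_true h]; exact one_ne_zero⟩⟩
    by_contra hh
    exact h (ind_false hh)

theorem forall_lt {b : α → ℕ} {P : α → ℕ → Prop} (hb : PT b) (hbB : PB b)
    (hP : PD (fun p : α × ℕ => P p.1 p.2)) : PD (fun a => ∀ i < b a, P a i) :=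
  (exists_lt (P := fun a i => ¬P a i) hb hbB hP.not).not.of_iff fun a => by push Not; exact Iff.rfl

theorem ite [∀ a, Decidable (P a)] (hP : PD P) (hF : PT F) (hG : PT G) :
    PT (fun a => if P a then F a else G a) :=
  ((PT.mul hP hF).add (PT.mul hP.not hG)).of_eq fun a => by
    by_cases h : P a
    · rw [if_pos h, ind_true h, ind_false (not_not.2 h)]; simp
    · rw [if_neg h, ind_false h, ind_true h]; simp

end PD

end RAM

/-! ### Numbers with prescribed digits -/

/-- Tuples of bounded length are stored as single numbers: tuples of interval indices, tuples of
values, and lists of selected edges. -/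
theorem exists_digits (b : ℕ) (f : ℕ → ℕ) (n : ℕ) (hf : ∀ s < n, f s < b) :
    ∃ a < b ^ n, ∀ s < n, a / b ^ s % b = f s := by
  induction n with
  | zero => exact ⟨0, by simp, by simp⟩
  | succ n ih =>
    obtain ⟨a, ha, h⟩ := ih fun s hs => hf s (Nat.lt_succ_of_lt hs)
    have hn := hf n (Nat.lt_succ_self n)
    have hb : 0 < b := by omega
    refine ⟨f n * b ^ n + a, ?_, fun s hs => ?_⟩
    · have : (f n + 1) * b ^ n ≤ b * b ^ n := Nat.mul_le_mul_right _ hn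
      rw [pow_succ']
      linarith
    · rcases Nat.lt_succ_iff_lt_or_eq.1 hs with hs | rfl
      · rw [← h s hs, show f n * b ^ n = b ^ s * (b * (f n * b ^ (n - s - 1))) by
          rw [show n = s + 1 + (n - s - 1) by omega, pow_add, pow_succ]
          rw [show s + 1 + (n - s - 1) - s - 1 = n - s - 1 by omega]; ring]
        rw [Nat.mul_add_div (by positivity), Nat.mul_add_mod]
      · rw [mul_comm, Nat.mul_add_div (by positivity), Nat.div_eq_of_lt ha, add_zero,
          Nat.mod_eq_of_lt hn]

/-! ### Two-sided evaluation of circuits -/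

/-- The local structure of a circuit: `kind v` is `1`, `2`, `3` for not-, and-, or-gates. -/
structure Net where
  n : ℕ
  kind : ℕ → ℕ
  fan : ℕ → ℕ
  arg : ℕ → ℕ → ℕ

namespace Net

variable (N : Net)

/-- Node `v` has depth at most `f` and weft at most `t`. -/
def Shape : ℕ → ℕ → ℕ → Prop
  | 0, _, v => v < N.n
  | f + 1, t, v => v < N.n ∨
      (N.fan v ≤ 2 ∧ ∀ j < N.fan v, Shape f t (N.arg v j)) ∨
      (1 ≤ t ∧ ∀ j < N.fan v, Shape f (t - 1) (N.arg v j))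

/-- The value of a gate which is forced by a single argument. -/
def decisive (v : ℕ) : Bool := decide (N.kind v = 3)

/-- `b` is a possible value of node `v`, given the possible values `lit` of the inputs.  At large
gates only the arguments selected by `W` are required to have the indecisive value. -/
def Bit (lit : Bool → ℕ → Prop) (W : ℕ → ℕ → Prop) : ℕ → Bool → ℕ → Prop
  | 0, b, v => lit b v
  | f + 1, b, v => (v < N.n ∧ lit b v) ∨ (N.n ≤ v ∧
      ((N.kind v = 1 ∧ Bit lit W f (!b) (N.arg v 0)) ∨
      (N.kind v ≠ 1 ∧ b = N.decisive v ∧ ∃ j < N.fan v, Bit lit W f b (N.arg v j)) ∨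
      (N.kind v ≠ 1 ∧ b ≠ N.decisive v ∧ ∀ j < N.fan v,
        (N.fan v ≤ 2 ∨ W v (N.arg v j)) → Bit lit W f b (N.arg v j))))

/-- `val` assigns truth values to the `s` nodes. -/
structure IsVal (s : ℕ) (val : ℕ → Bool) : Prop where
  arg_lt : ∀ v < s, N.n ≤ v → ∀ j < N.fan v, N.arg v j < v
  not_fan : ∀ v < s, N.n ≤ v → N.kind v = 1 → 0 < N.fan v
  not_val : ∀ v < s, N.n ≤ v → N.kind v = 1 → val v = !val (N.arg v 0)
  val_iff : ∀ v < s, N.n ≤ v → N.kind v ≠ 1 →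
    (val v = N.decisive v ↔ ∃ j < N.fan v, val (N.arg v j) = N.decisive v)

variable {N} {s : ℕ} {val : ℕ → Bool} {lit : Bool → ℕ → Prop} {W : ℕ → ℕ → Prop}

theorem Shape.arg {f t v : ℕ} (h : N.Shape (f + 1) t v) (hv : N.n ≤ v) :
    ∀ j < N.fan v, N.Shape f t (N.arg v j) ∨ (N.Shape f (t - 1) (N.arg v j)) := by
  rcases h with h | h | h
  · omega
  · exact fun j hj => .inl (h.2 j hj)
  · exact fun j hj => .inr (h.2 j hj)

/-- The true value is always possible. -/
theorem IsVal.bit (hN : N.IsVal s val) (hlit : ∀ v < N.n, lit (val v) v) (f : ℕ) :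
    ∀ t v, v < s → N.Shape f t v → N.Bit lit W f (val v) v := by
  induction f with
  | zero => exact fun t v _ h => hlit v h
  | succ f ih =>
    intro t v hv h
    by_cases hn : v < N.n
    · exact .inl ⟨hn, hlit v hn⟩
    · rw [not_lt] at hn
      have hargs : ∀ j < N.fan v, N.Bit lit W f (val (N.arg v j)) (N.arg v j) := fun j hj => by
        have h1 := hN.arg_lt v hv hn j hj
        rcases h.arg hn j hj with h' | h'
        · exact ih _ _ (h1.trans hv) h'
        · exact ih _ _ (h1.trans hv) h'
      refine .inr ⟨hn, ?_⟩
      by_cases hk : N.kind v = 1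
      · refine .inl ⟨hk, ?_⟩
        rw [hN.not_val v hv hn hk, Bool.not_not]
        exact hargs 0 (hN.not_fan v hv hn hk)
      · by_cases hd : val v = N.decisive v
        · refine .inr (.inl ⟨hk, hd, ?_⟩)
          obtain ⟨j, hj, hj'⟩ := (hN.val_iff v hv hn hk).1 hd
          exact ⟨j, hj, by rw [hd, ← hj']; exact hargs j hj⟩
        · refine .inr (.inr ⟨hk, hd, fun j hj _ => ?_⟩)
          have : val (N.arg v j) ≠ N.decisive v := fun hh =>
            hd ((hN.val_iff v hv hn hk).2 ⟨j, hj, hh⟩)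
          have : val v = val (N.arg v j) := by
            revert hd this; cases val v <;> cases val (N.arg v j) <;> cases N.decisive v <;> simp
          rw [this]
          exact hargs j hj

theorem Bit.elim {f v : ℕ} {b : Bool} (h : N.Bit lit W (f + 1) b v) (hn : N.n ≤ v) :
    (N.kind v = 1 ∧ N.Bit lit W f (!b) (N.arg v 0)) ∨
      (N.kind v ≠ 1 ∧ b = N.decisive v ∧ ∃ j < N.fan v, N.Bit lit W f b (N.arg v j)) ∨
      (N.kind v ≠ 1 ∧ b ≠ N.decisive v ∧ ∀ j < N.fan v,
        (N.fan v ≤ 2 ∨ W v (N.arg v j)) → N.Bit lit W f b (N.arg v j)) := by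
  rcases h with ⟨h, _⟩ | ⟨_, h⟩
  · omega
  · exact h

/-- The literals occur only positively in the recursion, so additional literals can only make more
values possible. This permits padding later. -/
theorem bit_mono {lit' : Bool → ℕ → Prop} (h : ∀ b v, lit b v → lit' b v) (f : ℕ) :
    ∀ b v, N.Bit lit W f b v → N.Bit lit' W f b v := by
  induction f with
  | zero => exact h
  | succ f ih =>
    rintro b v (⟨h1, h2⟩ | ⟨hn, h1 | ⟨hk, hb, j, hj, hj'⟩ | ⟨hk, hb, hj⟩⟩)
    · exact .inl ⟨h1, h _ _ h2⟩
    · exact .inr ⟨hn, .inl ⟨h1.1, ih _ _ h1.2⟩⟩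
    · exact .inr ⟨hn, .inr (.inl ⟨hk, hb, j, hj, ih _ _ hj'⟩)⟩
    · exact .inr ⟨hn, .inr (.inr ⟨hk, hb, fun j hj1 hj2 => ih _ _ (hj j hj1 hj2)⟩)⟩

/-- Without large gates, only the true value is possible. -/
theorem IsVal.not_bit (hN : N.IsVal s val) (hlit : ∀ v < N.n, ¬lit (!val v) v) (f : ℕ) :
    ∀ v < s, N.Shape f 0 v → ¬N.Bit lit W f (!val v) v := by
  induction f with
  | zero => exact fun v _ h => hlit v h
  | succ f ih =>
    intro v hv h hb
    by_cases hn : v < N.n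
    · rcases hb with ⟨_, hb⟩ | ⟨hn', _⟩
      · exact hlit v hn hb
      · omega
    · rw [not_lt] at hn
      rcases h with h | ⟨hfan, h⟩ | h
      · omega
      · have hargs : ∀ j < N.fan v, ¬N.Bit lit W f (!val (N.arg v j)) (N.arg v j) := fun j hj =>
          ih _ ((hN.arg_lt v hv hn j hj).trans hv) (h j hj)
        rcases hb.elim hn with ⟨hk, hb⟩ | ⟨hk, hd, j, hj, hb⟩ | ⟨hk, hd, hb⟩
        · rw [hN.not_val v hv hn hk, Bool.not_not] at hb
          exact hargs 0 (hN.not_fan v hv hn hk) hb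
        · refine hargs j hj ?_
          have h1 : val v ≠ N.decisive v := by rw [← hd]; cases val v <;> simp
          have h2 : val (N.arg v j) ≠ N.decisive v := fun hh =>
            h1 ((hN.val_iff v hv hn hk).2 ⟨j, hj, hh⟩)
          have : val v = val (N.arg v j) := by
            revert h1 h2; cases val v <;> cases val (N.arg v j) <;> cases N.decisive v <;> simp
          rwa [← this]
        · have h1 : val v = N.decisive v := by
            revert hd; cases val v <;> cases N.decisive v <;> simp
          obtain ⟨j, hj, hj'⟩ := (hN.val_iff v hv hn hk).1 h1
          refine hargs j hj ?_
          rw [hj', ← h1]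
          exact hb j hj (.inl hfan)
      · omega

/-- For weft at most one, few selected arguments suffice to exclude the wrong value. -/
theorem IsVal.exists_certificate (hN : N.IsVal s val) (hlit : ∀ v < N.n, ¬lit (!val v) v)
    (f : ℕ) : ∀ v < s, N.Shape f 1 v → ∃ l : List (ℕ × ℕ), l.length ≤ 2 ^ f ∧
      (∀ e ∈ l, e.1 < s ∧ e.2 < s) ∧
      ∀ W : ℕ → ℕ → Prop, (∀ e ∈ l, W e.1 e.2) → ¬N.Bit lit W f (!val v) v := by
  induction f with
  | zero => exact fun v _ h => ⟨[], by simp, by simp, fun _ _ => hlit v h⟩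
  | succ f ih =>
    intro v hv h
    by_cases hn : v < N.n
    · refine ⟨[], by simp, by simp, fun W _ hb => ?_⟩
      rcases hb with ⟨_, hb⟩ | ⟨hn', _⟩
      · exact hlit v hn hb
      · omega
    rw [not_lt] at hn
    rcases h with h | ⟨hfan, h⟩ | ⟨_, h⟩
    · omega
    · choose! l hl1 hl2 hl3 using fun j (hj : j < N.fan v) =>
        ih _ ((hN.arg_lt v hv hn j hj).trans hv) (h j hj)
      -- The at most two certificates for the arguments are united, which doubles the bound at most.
      refine ⟨(List.range (N.fan v)).flatMap l, ?_, ?_, fun W hW hb => ?_⟩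
      · rw [List.length_flatMap]
        calc ((List.range (N.fan v)).map fun a => (l a).length).sum
            ≤ ((List.range (N.fan v)).map fun _ => 2 ^ f).sum :=
              List.sum_le_sum fun j hj => hl1 j (List.mem_range.1 hj)
          _ ≤ 2 ^ (f + 1) := by
            rw [List.map_const', List.sum_replicate, List.length_range, pow_succ', smul_eq_mul]
            exact Nat.mul_le_mul_right _ hfan
      · intro e he
        obtain ⟨j, hj, he⟩ := List.mem_flatMap.1 he
        exact hl2 j (List.mem_range.1 hj) e he
      · have hargs : ∀ j < N.fan v, ¬N.Bit lit W f (!val (N.arg v j)) (N.arg v j) := fun j hj =>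
          hl3 j hj W fun e he => hW e (List.mem_flatMap.2 ⟨j, List.mem_range.2 hj, he⟩)
        rcases hb.elim hn with ⟨hk, hb⟩ | ⟨hk, hd, j, hj, hb⟩ | ⟨hk, hd, hb⟩
        · rw [hN.not_val v hv hn hk, Bool.not_not] at hb
          exact hargs 0 (hN.not_fan v hv hn hk) hb
        · refine hargs j hj ?_
          have h1 : val v ≠ N.decisive v := by rw [← hd]; cases val v <;> simp
          have h2 : val (N.arg v j) ≠ N.decisive v := fun hh =>
            h1 ((hN.val_iff v hv hn hk).2 ⟨j, hj, hh⟩)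
          have : val v = val (N.arg v j) := by
            revert h1 h2; cases val v <;> cases val (N.arg v j) <;> cases N.decisive v <;> simp
          rwa [← this]
        · have h1 : val v = N.decisive v := by
            revert hd; cases val v <;> cases N.decisive v <;> simp
          obtain ⟨j, hj, hj'⟩ := (hN.val_iff v hv hn hk).1 h1
          refine hargs j hj ?_
          rw [hj', ← h1]
          exact hb j hj (.inl hfan)
    -- This gate uses up the weft, so its arguments have weft zero and exclude their wrong values
    -- under every selection `W`.
    · have hargs : ∀ W j, j < N.fan v → ¬N.Bit lit W f (!val (N.arg v j)) (N.arg v j) :=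
        fun W j hj => hN.not_bit hlit f _ ((hN.arg_lt v hv hn j hj).trans hv) (h j hj)
      by_cases hk : N.kind v = 1
      · refine ⟨[], by simp, by simp, fun W _ hb => ?_⟩
        rcases hb.elim hn with ⟨_, hb⟩ | ⟨hk', _⟩ | ⟨hk', _⟩
        · rw [hN.not_val v hv hn hk, Bool.not_not] at hb
          exact hargs W 0 (hN.not_fan v hv hn hk) hb
        · exact hk' hk
        · exact hk' hk
      by_cases hd : val v = N.decisive v
      -- One argument forces the value. With the edge to it selected, the opposite value would
      -- require this argument to have a wrong value.
      · obtain ⟨j, hj, hj'⟩ := (hN.val_iff v hv hn hk).1 hd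
        refine ⟨[(v, N.arg v j)], by simp [Nat.one_le_two_pow], ?_, fun W hW hb => ?_⟩
        · simpa using ⟨hv, (hN.arg_lt v hv hn j hj).trans hv⟩
        · rcases hb.elim hn with ⟨hk', _⟩ | ⟨_, hd', _⟩ | ⟨_, _, hb⟩
          · exact hk hk'
          · rw [hd] at hd'; revert hd'; cases N.decisive v <;> simp
          · refine hargs W j hj ?_
            rw [hj', ← hd]
            exact hb j hj (.inr (hW _ (List.mem_singleton_self _)))
      -- No argument is decisive, so the wrong value lacks the supporting argument that it needs,
      -- and no edge has to be selected.
      · refine ⟨[], by simp, by simp, fun W _ hb => ?_⟩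
        rcases hb.elim hn with ⟨hk', _⟩ | ⟨_, _, j, hj, hb⟩ | ⟨_, hd', _⟩
        · exact hk hk'
        · have h2 : val (N.arg v j) ≠ N.decisive v := fun hh =>
            hd ((hN.val_iff v hv hn hk).2 ⟨j, hj, hh⟩)
          have : val v = val (N.arg v j) := by
            revert hd h2; cases val v <;> cases val (N.arg v j) <;> cases N.decisive v <;> simp
          exact hargs W j hj (by rwa [← this])
        · revert hd hd'; cases val v <;> cases N.decisive v <;> simp

/-- The possibility of a value depends on few of the literals. -/
theorem bit_local (L : ℕ → Bool → ℕ → Prop) (I : Finset ℕ) (q : ℕ) (hq : 2 ≤ q)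
    (hW : ∀ v, ∃ S : Finset ℕ, S.card ≤ q ∧ ∀ j, W v j → j ∈ S) (f : ℕ) :
    ∀ b v, N.Bit (fun b v => ∃ i ∈ I, L i b v) W f b v →
      ∃ T ⊆ I, T.card ≤ q ^ f ∧ N.Bit (fun b v => ∃ i ∈ T, L i b v) W f b v := by
  induction f with
  | zero =>
    rintro b v ⟨i, hi, h⟩
    exact ⟨{i}, by simpa using hi, by simp, i, by simp, h⟩
  | succ f ih =>
    have hpow : q ^ f ≤ q ^ (f + 1) := Nat.pow_le_pow_right (by omega) (Nat.le_succ f)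
    rintro b v (⟨h1, i, hi, h2⟩ | ⟨hn, ⟨hk, h1⟩ | ⟨hk, hb, j, hj, hj'⟩ | ⟨hk, hb, hj⟩⟩)
    · refine ⟨{i}, by simpa using hi, ?_, .inl ⟨h1, i, by simp, h2⟩⟩
      simpa using Nat.one_le_pow _ _ (by omega)
    · obtain ⟨T, hT, hc, h⟩ := ih _ _ h1
      exact ⟨T, hT, hc.trans hpow, .inr ⟨hn, .inl ⟨hk, h⟩⟩⟩
    · obtain ⟨T, hT, hc, h⟩ := ih _ _ hj'
      exact ⟨T, hT, hc.trans hpow, .inr ⟨hn, .inr (.inl ⟨hk, hb, j, hj, h⟩)⟩⟩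
    -- An indecisive value is supported by all arguments of a small gate, or by the selected
    -- arguments of a large one. In both cases at most `q` nodes `S` matter, each needing at most `q
    -- ^ f` indices.
    · classical
      obtain ⟨S, hS, hS'⟩ : ∃ S : Finset ℕ, S.card ≤ q ∧
          ∀ j < N.fan v, (N.fan v ≤ 2 ∨ W v (N.arg v j)) → N.arg v j ∈ S := by
        by_cases hf : N.fan v ≤ 2
        · refine ⟨(Finset.range (N.fan v)).image (N.arg v), ?_, fun j hj _ =>
            Finset.mem_image_of_mem _ (Finset.mem_range.2 hj)⟩
          exact Finset.card_image_le.trans (by simpa using hf.trans hq)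
        · obtain ⟨S, hS, hS'⟩ := hW v
          exact ⟨S, hS, fun j _ h => hS' _ (h.resolve_left hf)⟩
      have hT : ∀ u, ∃ T ⊆ I, T.card ≤ q ^ f ∧
          (N.Bit (fun b v => ∃ i ∈ I, L i b v) W f b u →
            N.Bit (fun b v => ∃ i ∈ T, L i b v) W f b u) := fun u => by
        by_cases hu : N.Bit (fun b v => ∃ i ∈ I, L i b v) W f b u
        · obtain ⟨T, hT, hc, h⟩ := ih _ _ hu
          exact ⟨T, hT, hc, fun _ => h⟩
        · exact ⟨∅, by simp, by simp, fun h => absurd h hu⟩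
      choose T hT1 hT2 hT3 using hT
      refine ⟨S.biUnion T, Finset.biUnion_subset.2 fun u _ => hT1 u, ?_,
        .inr ⟨hn, .inr (.inr ⟨hk, hb, fun j hj1 hj2 => ?_⟩)⟩⟩
      · refine (Finset.card_biUnion_le_card_mul S T _ fun u _ => hT2 u).trans ?_
        rw [pow_succ']
        exact Nat.mul_le_mul_right _ hS
      · refine bit_mono ?_ f _ _ (hT3 _ (hj j hj1 hj2))
        rintro b' v' ⟨i, hi, h⟩
        exact ⟨i, Finset.mem_biUnion.2 ⟨_, hS' j hj1 hj2, hi⟩, h⟩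

end Net

/-! ### Sets of inputs as sequences of intervals -/

/-- What the interval from `c / X` to `c % X` tells about input `v`: it is true if the interval
starts at `v + 1`, and false if `v + 1` is an inner point. -/
def Lit (X c : ℕ) (b : Bool) (v : ℕ) : Prop :=
  if b then c / X = v + 1 else c / X < v + 1 ∧ v + 1 < c % X

/-- The intervals `c 0, …, c k` form a chain from `0` to `n + 1`. -/
structure IntervalChain (X n k : ℕ) (c : ℕ → ℕ) : Prop where
  lt : ∀ i ≤ k, c i / X < c i % X
  first : c 0 / X = 0
  last : c k % X = n + 1
  link : ∀ i < k, c i % X = c (i + 1) / X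

theorem IntervalChain.strictMono {X n k : ℕ} {c : ℕ → ℕ} (h : IntervalChain X n k c) {i j : ℕ} (hij : i < j)
    (hj : j ≤ k) : c i % X ≤ c j / X := by
  induction j, hij using Nat.le_induction with
  | base => exact (h.link i hj).le
  | succ j hij ih =>
    have h1 := ih (by omega)
    have h2 := h.lt j (by omega)
    have h3 := h.link j hj
    omega

/-- The ones are the left ends of all intervals but the first. These strictly increase, so there are
exactly `k` of them. Any other input is an inner point of the last interval that starts before it.
-/
theorem IntervalChain.exists_assignment {X n k : ℕ} {c : ℕ → ℕ} (h : IntervalChain X n k c) :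
    ∃ x : Fin n → Bool, (Finset.univ.filter fun i => x i = true).card = k ∧
      ∀ (v : ℕ) (hv : v < n) (b : Bool), (∃ i ≤ k, Lit X (c i) b v) ↔ x ⟨v, hv⟩ = b := by
  classical
  have hub : ∀ i ≤ k, c i % X ≤ n + 1 := fun i hi => by
    rcases hi.lt_or_eq with hi | rfl
    · have h1 := h.strictMono hi le_rfl
      have h2 := h.lt k le_rfl
      have h3 := h.last
      omega
    · exact h.last.le
  let x : Fin n → Bool := fun v => decide (∃ i ≤ k, c i / X = v + 1)
  refine ⟨x, ?_, fun v hv b => ?_⟩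
  · symm
    rw [← Fintype.card_fin k, ← Finset.card_univ (α := Fin k)]
    have hpos : ∀ i : Fin k, 0 < c (i + 1) / X := fun i => by
      rw [← h.link i i.2]
      exact (Nat.zero_le _).trans_lt (h.lt i i.2.le)
    have hlt : ∀ i : Fin k, c (i + 1) / X - 1 < n := fun i => by
      have h1 := h.lt (i + 1) i.2
      have h2 := hub (i + 1) i.2
      have := hpos i
      omega
    refine Finset.card_bij (fun i _ => ⟨c (i + 1) / X - 1, hlt i⟩) ?_ ?_ ?_
    · intro i _
      have := hpos i
      simp only [x, Finset.mem_filter, Finset.mem_univ, true_and, decide_eq_true_eq]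
      exact ⟨i + 1, i.2, by omega⟩
    · intro i _ j _ hij
      have hij' : c (i + 1) / X - 1 = c (j + 1) / X - 1 := congrArg Fin.val hij
      have hi := hpos i
      have hj := hpos j
      rcases lt_trichotomy (i : ℕ) j with hh | hh | hh
      · have h1 := h.strictMono (Nat.succ_lt_succ hh) j.2
        have h2 := h.lt (i + 1) i.2
        simp only [Nat.succ_eq_add_one] at h1
        omega
      · exact Fin.ext hh
      · have h1 := h.strictMono (Nat.succ_lt_succ hh) i.2
        have h2 := h.lt (j + 1) j.2
        simp only [Nat.succ_eq_add_one] at h1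
        omega
    · intro v hv
      simp only [x, Finset.mem_filter, Finset.mem_univ, true_and, decide_eq_true_eq] at hv
      obtain ⟨i, hi, hv⟩ := hv
      have hi0 : i ≠ 0 := by
        rintro rfl
        have := h.first
        omega
      refine ⟨⟨i - 1, by omega⟩, Finset.mem_univ _, Fin.ext ?_⟩
      simp only [Nat.sub_add_cancel (Nat.pos_of_ne_zero hi0), hv]
      omega
  · cases b with
    | true => simp [x, Lit]
    | false =>
      simp only [x, Lit, Bool.false_eq_true, if_false, decide_eq_false_iff_not]
      constructor
      · rintro ⟨i, hi, h1, h2⟩ ⟨j, hj, h3⟩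
        rcases lt_trichotomy i j with hh | rfl | hh
        · have := h.strictMono hh hj
          omega
        · omega
        · have := h.strictMono hh hi
          have := h.lt j hj
          omega
      · intro hx
        have hex : ∃ i ≤ k, c i / X ≤ v + 1 := ⟨0, Nat.zero_le _, by rw [h.first]; omega⟩
        let P : ℕ → Prop := fun i => c i / X ≤ v + 1
        obtain ⟨i, hi, hPi, hmax⟩ : ∃ i ≤ k, P i ∧ ∀ j ≤ k, P j → j ≤ i :=
          ⟨Nat.findGreatest P k, Nat.findGreatest_le k,
            Nat.findGreatest_spec (P := P) (Nat.zero_le k) (by simp only [P, h.first]; omega),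
            fun j hj hPj => Nat.le_findGreatest hj hPj⟩
        refine ⟨i, hi, lt_of_le_of_ne hPi fun hh => hx ⟨i, hi, hh⟩, ?_⟩
        rcases hi.lt_or_eq with hi' | rfl
        · rw [h.link i hi']
          by_contra hh
          have := hmax (i + 1) hi' (by simp only [P]; omega)
          omega
        · rw [h.last]; omega

theorem exists_chain {X n : ℕ} (hX : n + 1 < X) (x : Fin n → Bool) :
    ∃ c : ℕ → ℕ, (∀ i ≤ (Finset.univ.filter fun i => x i = true).card, c i < X * X) ∧
      IntervalChain X n (Finset.univ.filter fun i => x i = true).card c ∧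
      ∀ (v : ℕ) (hv : v < n) (b : Bool),
        (∃ i ≤ (Finset.univ.filter fun i => x i = true).card, Lit X (c i) b v) ↔
          x ⟨v, hv⟩ = b := by
  classical
  set k := (Finset.univ.filter fun i => x i = true).card with hk
  -- The sentinel `0`, the shifted positions of the ones, and everything beyond `n`. The last part
  -- makes the set infinite, so that `Nat.nth` is strictly increasing, and puts the sentinel `n + 1`
  -- directly after the ones.
  let p : ℕ → Prop := fun u => u = 0 ∨ n < u ∨ ∃ h : u - 1 < n, x ⟨u - 1, h⟩ = true
  have hinf : {u | p u}.Infinite :=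
    (Set.Ioi_infinite n).mono fun u hu => .inr (.inl hu)
  have hmono := Nat.nth_strictMono hinf
  have hcount : Nat.count p (n + 1) = k + 1 := by
    rw [Nat.count_eq_card_filter_range, Finset.range_eq_Ico,
      ← Finset.insert_Ico_add_one_left_eq_Ico (Nat.succ_pos n), Finset.filter_insert,
      if_pos (show p 0 from .inl rfl), Finset.card_insert_of_notMem (by simp), hk]
    congr 1
    symm
    refine Finset.card_bij (fun i _ => (i : ℕ) + 1) ?_ ?_ ?_
    · intro i hi
      rw [Finset.mem_filter] at hi ⊢
      exact ⟨by simp, .inr (.inr ⟨by simp, by simpa using hi.2⟩)⟩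
    · intro i _ j _ hij
      exact Fin.ext (by simpa using hij)
    · intro u hu
      rw [Finset.mem_filter, Finset.mem_Ico] at hu
      obtain ⟨⟨h1, h2⟩, h3 | h3 | ⟨h3, h4⟩⟩ := hu
      · omega
      · omega
      · exact ⟨⟨u - 1, h3⟩, by simpa using h4, by simp only; omega⟩
  have h0 : Nat.nth p 0 = 0 := by
    rw [Nat.nth_zero]
    exact Nat.sInf_eq_zero.2 (.inl (.inl rfl))
  have hlast : Nat.nth p (k + 1) = n + 1 := by
    rw [← hcount]
    exact Nat.nth_count (show p (n + 1) from .inr (.inl (Nat.lt_succ_self n)))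
  have hle : ∀ i ≤ k + 1, Nat.nth p i ≤ n + 1 := fun i hi => hlast ▸ hmono.monotone hi
  let c : ℕ → ℕ := fun i => Nat.nth p i * X + Nat.nth p (i + 1)
  have hdiv : ∀ i ≤ k, c i / X = Nat.nth p i := fun i hi => by
    have := hle (i + 1) (by omega)
    simp only [c]
    rw [mul_comm, Nat.mul_add_div (by omega), Nat.div_eq_of_lt (by omega), add_zero]
  have hmod : ∀ i ≤ k, c i % X = Nat.nth p (i + 1) := fun i hi => by
    have := hle (i + 1) (by omega)
    simp only [c]
    rw [mul_comm, Nat.mul_add_mod, Nat.mod_eq_of_lt (by omega)]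
  have hchain : IntervalChain X n k c :=
    ⟨fun i hi => by rw [hdiv i hi, hmod i hi]; exact hmono (Nat.lt_succ_self i),
      by rw [hdiv 0 (Nat.zero_le _), h0], by rw [hmod k le_rfl, hlast],
      fun i hi => by rw [hmod i hi.le, hdiv (i + 1) hi]⟩
  refine ⟨c, fun i hi => ?_, hchain, ?_⟩
  · have h1 := hle (i + 1) (by omega)
    have h2 := hle i (by omega)
    have : (Nat.nth p i + 1) * X ≤ X * X := Nat.mul_le_mul_right _ (by omega)
    simp only [c]
    linarith
  -- The chain determines an assignment, which has the same ones as `x`; the claim about negative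
  -- literals then comes for free.
  · obtain ⟨x', hx', h'⟩ := hchain.exists_assignment
    have : x' = x := by
      funext v
      have h1 : x' v = true ↔ x v = true := by
        rw [← h' v v.2 true]
        simp only [Lit, if_true]
        constructor
        · rintro ⟨i, hi, h⟩
          rw [hdiv i hi] at h
          have hp : p (Nat.nth p i) := Nat.nth_mem_of_infinite hinf i
          rw [h] at hp
          rcases hp with hp | hp | ⟨h3, h4⟩
          · omega
          · omega
          · simpa using h4
        · intro hx
          have hp : p ((v : ℕ) + 1) := .inr (.inr ⟨by simp, by simpa using hx⟩)
          have h2 := Nat.nth_count hp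
          refine ⟨Nat.count p (v + 1), ?_, ?_⟩
          · by_contra hh
            have := hmono.monotone (show k + 1 ≤ Nat.count p (v + 1) by omega)
            rw [h2, hlast] at this
            omega
          · rw [hdiv _ ?_, h2]
            by_contra hh
            have := hmono.monotone (show k + 1 ≤ Nat.count p (v + 1) by omega)
            rw [h2, hlast] at this
            omega
      cases h3 : x' v <;> cases h4 : x v <;> simp_all
    rwa [this] at h'

namespace Parameterized

/-! ### Labelled circuits -/

theorem length_foldl_labels {α : Type} (step : Gate → List α → α) (gs : List Gate) (l : List α) :
    (gs.foldl (fun ls g => ls ++ [step g ls]) l).length = l.length + gs.length := by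
  induction gs generalizing l with
  | nil => simp
  | cons g gs ih => simp [ih]; omega

/-- Labels are only appended, so each node keeps the label that it received first. -/
theorem prefix_foldl_labels {α : Type} (step : Gate → List α → α) (gs : List Gate) (l : List α) :
    l <+: gs.foldl (fun ls g => ls ++ [step g ls]) l := by
  induction gs generalizing l with
  | nil => exact List.prefix_refl _
  | cons g gs ih => exact (List.prefix_append _ _).trans (ih _)

theorem getD_of_prefix {α : Type} {l l' : List α} (h : l <+: l') {i : ℕ} (hi : i < l.length)
    (d : α) : l'.getD i d = l.getD i d := by
  obtain ⟨t, rfl⟩ := h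
  exact List.getD_append _ _ _ _ hi

namespace Circuit

variable (C : Circuit) {α : Type} (inp : List α) (step : Gate → List α → α) (d : α)

theorem labels_getD_input {i : ℕ} (hi : i < inp.length) :
    (C.labels inp step).getD i d = inp.getD i d :=
  getD_of_prefix (prefix_foldl_labels step C.gates inp) hi d

/-- The label of a gate is computed from the labels of earlier nodes. -/
theorem labels_getD_gate {i : ℕ} (hi : i < C.gates.length) :
    ∃ ls : List α, (C.labels inp step).getD (inp.length + i) d = step C.gates[i] ls ∧
      ∀ j < inp.length + i, ls.getD j d = (C.labels inp step).getD j d := by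
  refine ⟨(C.gates.take i).foldl (fun ls g => ls ++ [step g ls]) inp, ?_, fun j hj => ?_⟩
  · set ls := (C.gates.take i).foldl (fun ls g => ls ++ [step g ls]) inp with hls
    have hlen : ls.length = inp.length + i := by
      rw [hls, length_foldl_labels, List.length_take, min_eq_left hi.le]
    have hpre : ls ++ [step C.gates[i] ls] <+: C.labels inp step := by
      have h1 : C.labels inp step = (C.gates.drop (i + 1)).foldl
          (fun ls g => ls ++ [step g ls]) (ls ++ [step C.gates[i] ls]) := by
        unfold labels
        conv_lhs => rw [← List.take_append_drop i C.gates]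
        rw [List.foldl_append, List.drop_eq_getElem_cons hi, List.foldl_cons]
      rw [h1]
      exact prefix_foldl_labels _ _ _
    rw [getD_of_prefix hpre (by simp [hlen])]
    rw [List.getD_append_right _ _ _ _ hlen.le, hlen]
    simp
  · symm
    have hpre : (C.gates.take i).foldl (fun ls g => ls ++ [step g ls]) inp <+:
        C.labels inp step := by
      unfold labels
      conv_rhs => rw [← List.take_append_drop i C.gates]
      rw [List.foldl_append]
      exact prefix_foldl_labels _ _ _
    refine getD_of_prefix hpre ?_ d
    rwa [length_foldl_labels, List.length_take, min_eq_left hi.le]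

/-- The truth value of a node. -/
def value (x : Fin C.numInputs → Bool) (v : ℕ) : Bool :=
  (C.labels (List.ofFn x) fun g ls => g.eval fun j => ls.getD j false).getD v false

/-- The largest number of gates satisfying `count` on a path to node `v`. -/
def pathTo (count : Gate → Bool) (v : ℕ) : ℕ :=
  (C.labels (List.replicate C.numInputs 0) fun g ls =>
    (count g).toNat + (g.args.map fun j => ls.getD j 0).foldr max 0).getD v 0

variable {C}

theorem value_input (x : Fin C.numInputs → Bool) (v : Fin C.numInputs) : C.value x v = x v := by
  unfold value
  rw [labels_getD_input _ _ _ _ (by simp)]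
  simp

theorem eval_congr (g : Gate) {v w : ℕ → Bool} (h : ∀ j ∈ g.args, v j = w j) :
    g.eval v = g.eval w := by
  cases g with
  | not j => simp [Gate.eval, h j (by simp [Gate.args])]
  | and js =>
    rw [Bool.eq_iff_iff]
    simp only [Gate.eval, List.all_eq_true]
    exact forall₂_congr fun j hj => by rw [h j hj]
  | or js =>
    rw [Bool.eq_iff_iff]
    simp only [Gate.eval, List.any_eq_true]
    exact exists_congr fun j => and_congr_right fun hj => by rw [h j hj]

theorem value_gate (x : Fin C.numInputs → Bool) {i : ℕ} (hi : i < C.gates.length) :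
    C.value x (C.numInputs + i) = C.gates[i].eval (C.value x) := by
  obtain ⟨ls, h1, h2⟩ := C.labels_getD_gate (List.ofFn x)
    (fun g ls => g.eval fun j => ls.getD j false) false hi
  rw [List.length_ofFn] at h1 h2
  unfold value
  rw [h1]
  exact eval_congr _ fun j hj => h2 j (C.args_lt i hi j hj)

theorem pathTo_input (count : Gate → Bool) {v : ℕ} (hv : v < C.numInputs) :
    C.pathTo count v = 0 := by
  unfold pathTo
  rw [labels_getD_input _ _ _ _ (by simpa using hv)]
  simp [hv]

theorem foldr_max_le (l : List ℕ) (b : ℕ) : l.foldr max 0 ≤ b ↔ ∀ a ∈ l, a ≤ b := by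
  induction l with
  | nil => simp
  | cons a l ih => simp [ih]

/-- A bound on a maximum is a conjunction, as needed for the comparison with `Net.Shape`. The first
conjunct matters for gates without arguments. -/
theorem pathTo_gate_le (count : Gate → Bool) {i : ℕ} (hi : i < C.gates.length) (b : ℕ) :
    C.pathTo count (C.numInputs + i) ≤ b ↔ (count C.gates[i]).toNat ≤ b ∧
      ∀ j ∈ C.gates[i].args, C.pathTo count j + (count C.gates[i]).toNat ≤ b := by
  obtain ⟨ls, h1, h2⟩ := C.labels_getD_gate (List.replicate C.numInputs 0)
    (fun g ls => (count g).toNat + (g.args.map fun j => ls.getD j 0).foldr max 0) 0 hi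
  rw [List.length_replicate] at h1 h2
  have h3 : C.pathTo count (C.numInputs + i) = (count C.gates[i]).toNat +
      (C.gates[i].args.map fun j => C.pathTo count j).foldr max 0 := by
    conv_lhs => unfold pathTo
    rw [h1]
    congr 2
    exact List.map_congr_left fun j hj => h2 j (C.args_lt i hi j hj)
  rw [h3]
  constructor
  · intro h
    refine ⟨by omega, fun j hj => ?_⟩
    have := (foldr_max_le _ _).1 (le_refl ((C.gates[i].args.map fun j =>
      C.pathTo count j).foldr max 0)) _ (List.mem_map_of_mem hj)
    omega
  · rintro ⟨h, h'⟩
    have : (C.gates[i].args.map fun j => C.pathTo count j).foldr max 0 ≤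
        b - (count C.gates[i]).toNat := by
      rw [foldr_max_le]
      intro a ha
      obtain ⟨j, hj, rfl⟩ := List.mem_map.1 ha
      have := h' j hj
      omega
    omega

end Circuit

/-- The type of a gate. -/
def Gate.tag : Gate → ℕ
  | .not _ => 1
  | .and _ => 2
  | .or _ => 3

theorem Gate.encode_eq (g : Gate) : g.encode = g.tag :: g.args.length :: g.args := by
  cases g <;> rfl

/-- The net describes the circuit. -/
structure Matches (N : Net) (C : Circuit) : Prop where
  n : N.n = C.numInputs
  kind : ∀ (i : ℕ) (hi : i < C.gates.length), N.kind (C.numInputs + i) = C.gates[i].tag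
  fan : ∀ (i : ℕ) (hi : i < C.gates.length), N.fan (C.numInputs + i) = C.gates[i].args.length
  arg : ∀ (i : ℕ) (hi : i < C.gates.length) (j : ℕ) (hj : j < C.gates[i].args.length),
    N.arg (C.numInputs + i) j = C.gates[i].args[j]

namespace Matches

variable {N : Net} {C : Circuit}

theorem forall_arg (h : Matches N C) {i : ℕ} (hi : i < C.gates.length) (P : ℕ → Prop) :
    (∀ j < N.fan (C.numInputs + i), P (N.arg (C.numInputs + i) j)) ↔
      ∀ a ∈ C.gates[i].args, P a := by
  rw [h.fan i hi, List.forall_mem_iff_forall_getElem]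
  exact forall₂_congr fun j hj => by rw [h.arg i hi j hj]

theorem exists_arg (h : Matches N C) {i : ℕ} (hi : i < C.gates.length) (P : ℕ → Prop) :
    (∃ j < N.fan (C.numInputs + i), P (N.arg (C.numInputs + i) j)) ↔
      ∃ a ∈ C.gates[i].args, P a := by
  have := not_congr (h.forall_arg hi fun a => ¬P a)
  push Not at this
  exact this

theorem isVal (h : Matches N C) (x : Fin C.numInputs → Bool) :
    N.IsVal (C.numInputs + C.gates.length) (C.value x) := by
  have hv : ∀ v < C.numInputs + C.gates.length, N.n ≤ v →
      ∃ i, i < C.gates.length ∧ v = C.numInputs + i := fun v h1 h2 => by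
    rw [h.n] at h2
    exact ⟨v - C.numInputs, by omega, by omega⟩
  refine ⟨fun v h1 h2 => ?_, fun v h1 h2 => ?_, fun v h1 h2 => ?_, fun v h1 h2 => ?_⟩ <;>
    obtain ⟨i, hi, rfl⟩ := hv v h1 h2
  · exact (h.forall_arg hi (· < C.numInputs + i)).2 (C.args_lt i hi)
  · intro hk
    rw [h.kind i hi] at hk
    rw [h.fan i hi]
    revert hk
    cases C.gates[i] <;> simp [Gate.tag, Gate.args]
  · intro hk
    rw [h.kind i hi] at hk
    rw [C.value_gate x hi]
    have harg := h.arg i hi 0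
    revert hk harg
    cases C.gates[i] <;> simp [Gate.tag, Gate.args, Gate.eval]
    intro hh
    rw [hh]
  · intro hk
    rw [h.exists_arg hi fun a => C.value x a = N.decisive (C.numInputs + i), C.value_gate x hi]
    unfold Net.decisive
    rw [h.kind i hi] at hk ⊢
    revert hk
    cases C.gates[i] <;> simp [Gate.tag, Gate.args, Gate.eval]

/-- A large gate can only use the clause of `Net.Shape` that lowers `t`. A small gate that uses it
satisfies the weaker requirement of the other clause as well. -/
theorem shape_iff (h : Matches N C) (f : ℕ) : ∀ t v, v < C.numInputs + C.gates.length →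
    (N.Shape f t v ↔ C.pathTo (fun _ => true) v ≤ f ∧
      C.pathTo (fun g => decide (2 < g.args.length)) v ≤ t) := by
  have hin : ∀ v < C.numInputs, ∀ count, C.pathTo count v = 0 := fun v hv count =>
    C.pathTo_input count hv
  induction f with
  | zero =>
    intro t v hv
    by_cases hn : v < C.numInputs
    · simp [Net.Shape, h.n, hn, hin v hn]
    · obtain ⟨i, rfl⟩ := Nat.exists_eq_add_of_le (not_lt.1 hn)
      have hi : i < C.gates.length := by omega
      simp [Net.Shape, h.n, C.pathTo_gate_le _ hi]
  | succ f ih =>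
    intro t v hv
    by_cases hn : v < C.numInputs
    · simp [Net.Shape, h.n, hn, hin v hn]
    · obtain ⟨i, rfl⟩ := Nat.exists_eq_add_of_le (not_lt.1 hn)
      have hi : i < C.gates.length := by omega
      have hargs := C.args_lt i hi
      rw [C.pathTo_gate_le _ hi, C.pathTo_gate_le _ hi]
      simp only [Net.Shape]
      rw [h.forall_arg hi fun a => N.Shape f t a, h.forall_arg hi fun a => N.Shape f (t - 1) a,
        h.n, h.fan i hi]
      have e : ∀ t, (∀ a ∈ C.gates[i].args, N.Shape f t a) ↔
          ∀ a ∈ C.gates[i].args, C.pathTo (fun _ => true) a ≤ f ∧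
            C.pathTo (fun g => decide (2 < g.args.length)) a ≤ t := fun t =>
        forall₂_congr fun a ha => ih t a (by have := hargs a ha; omega)
      rw [e, e]
      by_cases h2 : 2 < C.gates[i].args.length
      · simp only [h2, decide_true, Bool.toNat_true, not_le.2 h2, false_and, false_or]
        constructor
        · rintro (h3 | ⟨h3, h4⟩)
          · omega
          · exact ⟨⟨by omega, fun a ha => by have := (h4 a ha).1; omega⟩, h3,
              fun a ha => by have := (h4 a ha).2; omega⟩
        · rintro ⟨⟨_, h3⟩, h4, h5⟩
          exact .inr ⟨h4, fun a ha => ⟨by have := h3 a ha; omega, by have := h5 a ha; omega⟩⟩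
      · simp only [h2, decide_false, Bool.toNat_false, not_lt.1 h2, true_and]
        constructor
        · rintro (h3 | h3 | ⟨h3, h4⟩)
          · omega
          · exact ⟨⟨by simp, fun a ha => by have := (h3 a ha).1; simp; omega⟩, by simp,
              fun a ha => (h3 a ha).2⟩
          · exact ⟨⟨by simp, fun a ha => by have := (h4 a ha).1; simp; omega⟩, by simp,
              fun a ha => by have := (h4 a ha).2; omega⟩
        · rintro ⟨⟨_, h3⟩, _, h4⟩
          exact .inr (.inl fun a ha => ⟨by have := h3 a ha; simp at this; omega, h4 a ha⟩)

end Matches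

end Parameterized

/-! ### Words that encode circuits -/

namespace Word

open Parameterized

variable (y : List ℕ)

/-- The entry `i` of the word. -/
abbrev get (i : ℕ) : ℕ := y.getD i 0

/-- The number of inputs of the circuit. -/
def numIn : ℕ := min (get y 1) y.length

/-- The number of gates of the circuit. -/
def numGates : ℕ := min (get y 3) y.length

/-- The position after the gate at position `p`. -/
def next (p : ℕ) : ℕ := min (p + 2 + get y (p + 1)) (y.length + 1)

/-- The position of gate `i`. -/
def pos (i : ℕ) : ℕ := (next y)^[i] (min (4 + numIn y) (y.length + 1))

/-- The position of the gate with node number `v`. -/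
def gatePos (v : ℕ) : ℕ := pos y (min (v - numIn y) y.length)

/-- The local structure of the encoded circuit. -/
def net : Net where
  n := numIn y
  kind v := get y (gatePos y v)
  fan v := min (get y (gatePos y v + 1)) y.length
  arg v j := get y (gatePos y v + 2 + j)

/-- The word consists of a parameter and the encoding of a circuit. -/
structure WellFormed : Prop where
  length : 4 ≤ y.length
  numIn_le : get y 1 ≤ y.length
  numGates_le : get y 3 ≤ y.length
  inputs : ∀ j < numIn y, get y (4 + j) = 0
  pos_last : pos y (numGates y) = y.length
  kind : ∀ i < numGates y, 1 ≤ (net y).kind (numIn y + i) ∧ (net y).kind (numIn y + i) ≤ 3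
  not_fan : ∀ i < numGates y, (net y).kind (numIn y + i) = 1 → (net y).fan (numIn y + i) = 1
  arg_lt : ∀ i < numGates y, ∀ j < (net y).fan (numIn y + i),
    (net y).arg (numIn y + i) j < numIn y + i
  output_lt : get y 2 < numIn y + numGates y

/-- The cut-offs at `y.length` in these definitions keep all quantities polynomially bounded on
words that encode nothing. For actual gates, the one in `gatePos` has no effect. -/
theorem gatePos_add {i : ℕ} (hi : i < numGates y) : gatePos y (numIn y + i) = pos y i := by
  have : numGates y ≤ y.length := min_le_right _ _
  rw [gatePos, Nat.add_sub_cancel_left, min_eq_left (by omega)]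

theorem pos_succ (i : ℕ) : pos y (i + 1) = next y (pos y i) := Function.iterate_succ_apply' _ _ _

/-- A gate that runs over the end of the word moves the position to `y.length + 1`, where it stays
forever; the condition `pos_last` detects this. -/
theorem pos_le (i : ℕ) : pos y i ≤ y.length + 1 := by
  cases i with
  | zero => exact min_le_right _ _
  | succ i => rw [pos_succ]; exact min_le_right _ _

theorem pos_mono : Monotone (pos y) := monotone_nat_of_le_succ fun i => by
  rw [pos_succ]
  have := pos_le y i
  simp only [next]
  omega

/-- The factor of the word of length `c` that starts at position `a`. -/
def slice (a c : ℕ) : List ℕ := (List.range c).map fun j => get y (a + j)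

theorem slice_add (a c d : ℕ) : slice y a (c + d) = slice y a c ++ slice y (a + c) d := by
  simp [slice, List.range_add, Nat.add_assoc, Function.comp_def]

theorem slice_all : slice y 0 y.length = y := by
  apply List.ext_getElem
  · simp [slice]
  · intro i h1 h2
    simp [slice, h2]

theorem slice_two (a : ℕ) : slice y a 2 = [get y a, get y (a + 1)] := by
  simp [slice, List.range_succ]

variable {y}

/-- A gate of given type. -/
def mkGate (k : ℕ) (l : List ℕ) : Gate :=
  if k = 1 then .not (l.headD 0) else if k = 2 then .and l else .or l

theorem encode_mkGate {k : ℕ} {l : List ℕ} (h1 : 1 ≤ k) (h3 : k ≤ 3) (hl : k = 1 → l.length = 1) :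
    (mkGate k l).encode = k :: l.length :: l ∧ (mkGate k l).args = l := by
  obtain rfl | rfl | rfl : k = 1 ∨ k = 2 ∨ k = 3 := by omega
  · obtain ⟨a, rfl⟩ := List.length_eq_one_iff.1 (hl rfl)
    simp [mkGate, Gate.encode, Gate.args]
  · simp [mkGate, Gate.encode, Gate.args]
  · simp [mkGate, Gate.encode, Gate.args]

/-- Since the last position is the end of the word, no earlier step was cut off. The header, the
zeros of the inputs and the consecutive gates are then adjacent slices that make up the whole word.
-/
theorem WellFormed.exists_circuit (h : WellFormed y) :
    ∃ C : Circuit, y = get y 0 :: C.encode := by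
  let args : ℕ → List ℕ := fun i =>
    slice y (pos y i + 2) ((net y).fan (numIn y + i))
  let gs : List Gate := (List.range (numGates y)).map fun i =>
    mkGate ((net y).kind (numIn y + i)) (args i)
  have hargs : ∀ i, (args i).length = (net y).fan (numIn y + i) := fun i => by simp [args, slice]
  have hgate : ∀ i < numGates y, (mkGate ((net y).kind (numIn y + i)) (args i)).encode =
      (net y).kind (numIn y + i) :: (args i).length :: args i ∧
      (mkGate ((net y).kind (numIn y + i)) (args i)).args = args i := fun i hi =>
    encode_mkGate (h.kind i hi).1 (h.kind i hi).2 fun hk => by rw [hargs, h.not_fan i hi hk]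
  have hpos : ∀ i ≤ numGates y, pos y i ≤ y.length := fun i hi => by
    rw [← h.pos_last]; exact pos_mono y hi
  have hstep : ∀ i < numGates y, pos y (i + 1) = pos y i + (2 + (args i).length) ∧
      (args i).length = get y (pos y i + 1) := fun i hi => by
    have h1 := hpos (i + 1) hi
    rw [hargs]
    rw [pos_succ] at h1 ⊢
    simp only [next, net, gatePos_add y hi] at h1 ⊢
    omega
  have hpos0 : pos y 0 = 4 + numIn y := by
    have := hpos 0 (Nat.zero_le _)
    simp only [pos, Function.iterate_zero, id] at this ⊢
    omega
  have hflat : ∀ i ≤ numGates y, ((List.range i).map fun i =>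
      mkGate ((net y).kind (numIn y + i)) (args i)).flatMap Gate.encode =
        slice y (4 + numIn y) (pos y i - (4 + numIn y)) := by
    intro i
    induction i with
    | zero => intro _; simp [hpos0, slice]
    | succ i ih =>
      intro hi
      have hge : 4 + numIn y ≤ pos y i := hpos0 ▸ pos_mono y (Nat.zero_le i)
      rw [List.range_succ, List.map_append, List.flatMap_append, ih (by omega), (hstep i hi).1,
        show pos y i + (2 + (args i).length) - (4 + numIn y) =
          (pos y i - (4 + numIn y)) + (2 + (args i).length) by omega, slice_add,
        show 4 + numIn y + (pos y i - (4 + numIn y)) = pos y i by omega, slice_add, slice_two]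
      simp only [List.map_cons, List.map_nil, List.flatMap_cons, List.flatMap_nil,
        (hgate i hi).1, List.append_nil]
      have h1 : (net y).kind (numIn y + i) = get y (pos y i) := by simp [net, gatePos_add y hi]
      rw [h1, ← (hstep i hi).2, hargs]
      rfl
  have hlen : gs.length = numGates y := by simp [gs]
  refine ⟨⟨numIn y, gs, get y 2, fun i hi j hj => ?_, by rw [hlen]; exact h.output_lt⟩, ?_⟩
  · have hi' : i < numGates y := by rwa [hlen] at hi
    have : gs[i] = mkGate ((net y).kind (numIn y + i)) (args i) := by simp [gs]
    rw [this, (hgate i hi').2] at hj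
    obtain ⟨q, hq, rfl⟩ := List.mem_map.1 hj
    have := h.arg_lt i hi' q (List.mem_range.1 hq)
    simpa [net, gatePos_add y hi'] using this
  · have hlast : 4 + numIn y ≤ y.length := hpos0 ▸ hpos 0 (Nat.zero_le _)
    have hn : get y 1 = numIn y := (min_eq_left h.numIn_le).symm
    have hg : get y 3 = numGates y := (min_eq_left h.numGates_le).symm
    simp only [Circuit.encode, gs]
    rw [List.length_map, List.length_range, hflat _ le_rfl, h.pos_last]
    conv_lhs => rw [← slice_all y, show y.length = 2 + (2 + (numIn y +
      (y.length - (4 + numIn y)))) by omega, slice_add, slice_add, slice_add, slice_two, slice_two]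
    have hz : slice y (0 + 2 + 2) (numIn y) = List.replicate (numIn y) 0 := by
      rw [List.eq_replicate_iff]
      refine ⟨by simp [slice], fun b hb => ?_⟩
      obtain ⟨q, hq, rfl⟩ := List.mem_map.1 hb
      exact h.inputs q (List.mem_range.1 hq)
    rw [hz]
    simp only [Nat.zero_add, hn, hg, List.cons_append, List.nil_append]

/-- The word of a circuit. -/
theorem wellFormed_encode (k : ℕ) (C : Circuit) (hy : y = k :: C.encode) :
    WellFormed y ∧ Matches (net y) C ∧ get y 0 = k ∧ get y 2 = C.output ∧
      numIn y = C.numInputs ∧ numGates y = C.gates.length := by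
  set Ls := C.gates.flatMap Gate.encode with hLs
  have hy' : y = k :: C.numInputs :: C.output :: C.gates.length ::
    (List.replicate C.numInputs 0 ++ Ls) := hy
  have hlenLs : ∀ gs : List Gate, gs.length ≤ (gs.flatMap Gate.encode).length := by
    intro gs
    induction gs with
    | nil => simp
    | cons g gs ih => simp [Gate.encode_eq]; omega
  have hlen : y.length = 4 + C.numInputs + Ls.length := by rw [hy']; simp; omega
  have h0 : get y 0 = k := by rw [hy']; rfl
  have h1 : get y 1 = C.numInputs := by rw [hy']; rfl
  have h2 : get y 2 = C.output := by rw [hy']; rfl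
  have h3 : get y 3 = C.gates.length := by rw [hy']; rfl
  have hn : numIn y = C.numInputs := by unfold numIn; rw [h1]; omega
  have hg : numGates y = C.gates.length := by
    have := hlenLs C.gates
    rw [← hLs] at this
    unfold numGates; rw [h3]; omega
  have hin : ∀ j < C.numInputs, get y (4 + j) = 0 := fun j hj => by
    rw [hy', Nat.add_comm 4 j]
    simp only [get, List.getD_cons_succ]
    rw [List.getD_append _ _ _ _ (by simpa using hj)]
    simp [hj]
  have hLs' : ∀ p, get y (4 + C.numInputs + p) = Ls.getD p 0 := fun p => by
    rw [hy', show 4 + C.numInputs + p = C.numInputs + p + 4 by omega]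
    simp only [get, List.getD_cons_succ]
    rw [List.getD_append_right _ _ _ _ (by simp)]
    simp
  let off : ℕ → ℕ := fun i => ((C.gates.take i).flatMap Gate.encode).length
  have hsplit : ∀ (i : ℕ) (hi : i < C.gates.length), Ls = (C.gates.take i).flatMap Gate.encode ++
      (C.gates[i].encode ++ (C.gates.drop (i + 1)).flatMap Gate.encode) := fun i hi => by
    rw [hLs]
    conv_lhs => rw [← List.take_append_drop i C.gates, List.drop_eq_getElem_cons hi]
    rw [List.flatMap_append, List.flatMap_cons]
  have hread : ∀ (i : ℕ) (hi : i < C.gates.length) (q : ℕ), q < C.gates[i].args.length + 2 →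
      get y (4 + C.numInputs + off i + q) = C.gates[i].encode.getD q 0 := fun i hi q hq => by
    rw [Nat.add_assoc, hLs', hsplit i hi, List.getD_append_right _ _ _ _ (Nat.le_add_right _ _)]
    simp only [Nat.add_sub_cancel_left]
    rw [List.getD_append _ _ _ _ (by rw [Gate.encode_eq]; simp; omega)]
  have hoff : ∀ (i : ℕ) (hi : i < C.gates.length),
      off (i + 1) = off i + (C.gates[i].args.length + 2) := fun i hi => by
    simp only [off]
    rw [← List.take_append_getElem hi, List.flatMap_append, List.length_append]
    simp [Gate.encode_eq]
  have hoffle : ∀ i ≤ C.gates.length, off i ≤ Ls.length := fun i hi => by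
    simp only [off, hLs]
    conv_rhs => rw [← List.take_append_drop i C.gates, List.flatMap_append, List.length_append]
    omega
  have hpos : ∀ i ≤ C.gates.length, pos y i = 4 + C.numInputs + off i := by
    intro i
    induction i with
    | zero =>
      intro _
      simp [pos, off, hn, hlen]
      omega
    | succ i ih =>
      intro hi
      have e1 := hoff i hi
      have e2 := hoffle (i + 1) hi
      have e3 := hread i hi 1 (by omega)
      rw [Gate.encode_eq] at e3
      simp only [List.getD_cons_succ, List.getD_cons_zero] at e3
      rw [pos_succ, ih (by omega)]
      simp only [next, e3, hlen]
      omega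
  have hgp : ∀ i < C.gates.length, gatePos y (C.numInputs + i) = 4 + C.numInputs + off i :=
    fun i hi => by rw [← hn, gatePos_add y (hg ▸ hi), hpos i hi.le, hn]
  have hm : Matches (net y) C := by
    refine ⟨hn, fun i hi => ?_, fun i hi => ?_, fun i hi j hj => ?_⟩
    · simp only [net, hgp i hi]
      have := hread i hi 0 (by omega)
      rwa [Gate.encode_eq] at this
    · simp only [net, hgp i hi]
      have := hread i hi 1 (by omega)
      rw [Gate.encode_eq] at this
      simp only [List.getD_cons_succ, List.getD_cons_zero] at this
      rw [this]
      have e1 := hoff i hi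
      have e2 := hoffle (i + 1) hi
      omega
    · simp only [net, hgp i hi]
      have := hread i hi (j + 2) (by omega)
      rw [Gate.encode_eq] at this
      simp only [List.getD_cons_succ] at this
      rw [show 4 + C.numInputs + off i + 2 + j = 4 + C.numInputs + off i + (j + 2) by omega, this]
      simp [hj]
  refine ⟨⟨by omega, by omega, by rw [h3]; have := hlenLs C.gates; rw [← hLs] at this; omega,
    fun j hj => hin j (hn ▸ hj), ?_, fun i hi => ?_, fun i hi => ?_, fun i hi => ?_, ?_⟩,
    hm, h0, h2, hn, hg⟩
  · rw [hg, hpos _ le_rfl, hlen]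
    simp only [off, hLs, List.take_length]
  · rw [hn, hm.kind i (hg ▸ hi)]
    cases C.gates[i]'(hg ▸ hi) <;> simp [Gate.tag]
  · rw [hn, hm.kind i (hg ▸ hi), hm.fan i (hg ▸ hi)]
    cases C.gates[i]'(hg ▸ hi) <;> simp [Gate.tag, Gate.args]
  · rw [hn]
    exact (hm.forall_arg (hg ▸ hi) (· < C.numInputs + i)).2 (C.args_lt i (hg ▸ hi))
  · rw [h2, hn, hg]
    exact C.output_lt

end Word

/-! ### Weft-one satisfiability as a constraint satisfaction problem -/

namespace Word

open Parameterized

variable (y : List ℕ) (h : ℕ)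

/-- A number larger than all node numbers. -/
def base : ℕ := y.length + 2

/-- The number of intervals of inputs. -/
def numVars : ℕ := min (get y 0) y.length + 1

/-- The number of intervals that are looked at simultaneously. -/
def arity : ℕ := (2 ^ h + 2) ^ (h + 1)

/-- A bound for the values of all variables. -/
def domain : ℕ := base y ^ (2 * 2 ^ h)

/-- The interval at place `d` of the tuple `t`. -/
def place (t d : ℕ) : ℕ := t / numVars y ^ d % numVars y

/-- The edges selected by the number `w`. -/
def Edge (w v j : ℕ) : Prop :=
  ∃ s < 2 ^ h, w / (base y ^ 2) ^ s % base y ^ 2 = v * base y + j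

/-- The intervals `e 0, e 1, …` at the places of `t` fit together, and do not exclude, together
with the edges selected by `e (arity h)`, that the output is true. -/
def Admissible (t : ℕ) (e : ℕ → ℕ) : Prop :=
  (∀ d < arity h, e d / base y < e d % base y ∧ (place y t d = 0 → e d / base y = 0) ∧
    (place y t d + 1 = numVars y → e d % base y = numIn y + 1)) ∧
  (∀ d < arity h, ∀ d' < arity h, place y t d' = place y t d + 1 →
    e d % base y = e d' / base y) ∧
  ¬(net y).Bit (fun b v => ∃ d < arity h, Lit (base y) (e d) b v) (Edge y h (e (arity h))) h
    false (get y 2)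

/-- The variable at place `d` of the tuple `t`; the last place holds the selected edges. -/
def var (t d : ℕ) : ℕ := if d < arity h then place y t d else numVars y

variable {y h}

/-- Two places are needed to compare consecutive intervals. -/
theorem two_le_arity : 2 ≤ arity h := by
  have : 1 ≤ (2 ^ h + 2) ^ h := Nat.one_le_pow _ _ (by positivity)
  unfold arity
  rw [pow_succ]
  nlinarith [Nat.one_le_two_pow (n := h)]

theorem exists_tuple (f : ℕ → ℕ) (hf : ∀ d < arity h, f d < numVars y) :
    ∃ t < numVars y ^ arity h, ∀ d < arity h, place y t d = f d :=
  exists_digits _ f _ hf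

theorem place_lt (t d : ℕ) : place y t d < numVars y := Nat.mod_lt _ (Nat.succ_pos _)

/-- Every node occupies at least one letter. So node numbers are digits in base `base y`, and the
number of ones of an assignment is below the length of the word. -/
theorem numNodes_lt_length {k : ℕ} {C : Circuit} (hy : y = k :: C.encode) :
    C.numInputs + C.gates.length < y.length := by
  have hlenLs : ∀ gs : List Gate, gs.length ≤ (gs.flatMap Gate.encode).length := by
    intro gs
    induction gs with
    | nil => simp
    | cons g gs ih => simp [Gate.encode_eq]; omega
  have := hlenLs C.gates
  rw [hy]
  simp only [Circuit.encode, List.length_cons, List.length_append, List.length_replicate]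
  omega

/-- Weighted satisfiability of circuits of weft one, as a constraint satisfaction problem with
constraints of bounded arity. -/
theorem exists_accepting_iff {k : ℕ} {C : Circuit} (hy : y = k :: C.encode) (hk : k ≤ y.length)
    (hw : C.weft ≤ 1) (hd : C.depth ≤ h) :
    (∃ x : Fin C.numInputs → Bool,
      (Finset.univ.filter fun i => x i = true).card = k ∧ C.Accepts x) ↔
    ∃ E : ℕ → ℕ, (∀ i ≤ numVars y, E i < domain y h) ∧
      ∀ t < numVars y ^ arity h, Admissible y h t fun d => E (var y h t d) := by
  obtain ⟨_, hm, h0, h2, hn, _⟩ := wellFormed_encode k C hy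
  have hM : numVars y = k + 1 := by unfold numVars; rw [h0, min_eq_left hk]
  have hnodes := numNodes_lt_length hy
  have hnet : (net y).n = C.numInputs := hn
  have hshape : (net y).Shape h 1 C.output := (hm.shape_iff h 1 _ C.output_lt).2 ⟨hd, hw⟩
  have hX : C.numInputs + 1 < base y := by unfold base; omega
  have hvar : ∀ t d, d < arity h → var y h t d = place y t d := fun t d hd => if_pos hd
  have hvar' : ∀ t, var y h t (arity h) = numVars y := fun t => if_neg (lt_irrefl _)
  constructor
  · rintro ⟨x, hx, hacc⟩
    obtain ⟨c, hc, hchain, hlit⟩ := exists_chain hX x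
    rw [hx] at hc hchain hlit
    have hval : C.value x C.output = true := hacc
    have hex : ∀ v < (net y).n, ¬(∃ i ≤ k, Lit (base y) (c i) (!C.value x v) v) := fun v hv => by
      rw [hnet] at hv
      rw [hlit v hv, ← C.value_input x ⟨v, hv⟩]
      cases C.value x v <;> simp
    obtain ⟨l, hl1, hl2, hl3⟩ := (hm.isVal x).exists_certificate
      (lit := fun b v => ∃ i ≤ k, Lit (base y) (c i) b v) hex h _ C.output_lt hshape
    -- The certificate as one number. Unused digits are zero and may select the pair `(0, 0)` in
    -- addition, which is harmless because `hl3` admits every larger selection.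
    obtain ⟨w, hw1, hw2⟩ := exists_digits (base y ^ 2)
      (fun s => if hs : s < l.length then l[s].1 * base y + l[s].2 else 0) (2 ^ h) (by
        intro s _
        split_ifs with hs
        · have h1 := hl2 _ (List.getElem_mem hs)
          have h3 : (l[s].1 + 1) * base y ≤ base y * base y :=
            Nat.mul_le_mul_right _ (by unfold base; omega)
          have h4 : l[s].2 < base y := by unfold base; omega
          rw [pow_two]
          linarith
        · unfold base; positivity)
    have hE : ∀ w, ∀ e ∈ l, (∀ s < 2 ^ h, w / (base y ^ 2) ^ s % base y ^ 2 =
        (if hs : s < l.length then l[s].1 * base y + l[s].2 else 0)) → Edge y h w e.1 e.2 := by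
      intro w e he hw2
      obtain ⟨s, hs, rfl⟩ := List.getElem_of_mem he
      exact ⟨s, hs.trans_le hl1, by rw [hw2 s (hs.trans_le hl1), dif_pos hs]⟩
    -- The variables up to `k` are the intervals, and variable `numVars y = k + 1` holds the
    -- selected edges.
    refine ⟨fun i => if i ≤ k then c i else w, fun i _ => ?_, fun t _ => ?_⟩
    · have hp : base y * base y ≤ domain y h := by
        rw [← pow_two]
        exact Nat.pow_le_pow_right (by unfold base; omega)
          (Nat.le_mul_of_pos_right 2 (by positivity))
      dsimp only
      split_ifs with hi
      · exact (hc i hi).trans_le hp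
      · unfold domain; rwa [pow_mul]
    · have hp : ∀ d < arity h, place y t d ≤ k ∧
          (if var y h t d ≤ k then c (var y h t d) else w) = c (place y t d) := fun d hd => by
        have := place_lt (y := y) t d
        rw [hvar t d hd, if_pos (by omega)]
        exact ⟨by omega, rfl⟩
      refine ⟨fun d hd => ?_, fun d hd d' hd' hdd => ?_, ?_⟩
      · dsimp only
        rw [(hp d hd).2]
        refine ⟨hchain.lt _ (hp d hd).1, fun h => ?_, fun h => ?_⟩
        · rw [h, hchain.first]
        · rw [hn, show place y t d = k by omega, hchain.last]
      · dsimp only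
        rw [(hp d hd).2, (hp d' hd').2, hdd]
        exact hchain.link _ (by have := (hp d' hd').1; omega)
      · dsimp only
        rw [hvar', if_neg (by omega), h2]
        intro hb
        refine hl3 _ (fun e he => hE w e he hw2) ?_
        rw [hval]
        refine Net.bit_mono ?_ _ _ _ hb
        rintro b v ⟨d, hd, hd'⟩
        rw [(hp d hd).2] at hd'
        exact ⟨_, (hp d hd).1, hd'⟩
  · rintro ⟨E, _, hE⟩
    have hchain : IntervalChain (base y) C.numInputs k E := by
      have hconst : ∀ i ≤ k, E i / base y < E i % base y ∧ (i = 0 → E i / base y = 0) ∧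
          (i + 1 = numVars y → E i % base y = numIn y + 1) := fun i hi => by
        -- The constant tuple yields the conditions on a single interval.
        obtain ⟨t, ht, ht'⟩ := exists_tuple (y := y) (h := h) (fun _ => i) fun _ _ => by omega
        have h0 : 0 < arity h := by have := two_le_arity (h := h); omega
        have := (hE t ht).1 0 h0
        simp only [hvar t 0 h0, ht' 0 h0] at this
        exact this
      refine ⟨fun i hi => (hconst i hi).1, (hconst 0 (Nat.zero_le _)).2.1 rfl, ?_, fun i hi => ?_⟩
      · rw [(hconst k le_rfl).2.2 hM.symm, hn]
      -- The tuple `i, i + 1, i + 1, …` yields the condition on neighbouring intervals.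
      · obtain ⟨t, ht, ht'⟩ := exists_tuple (y := y) (h := h) (fun d => if d = 0 then i else i + 1)
          fun d _ => by split_ifs <;> omega
        have h0 : 0 < arity h := by have := two_le_arity (h := h); omega
        have h1 : 1 < arity h := two_le_arity
        have := (hE t ht).2.1 0 h0 1 h1 (by rw [ht' 0 h0, ht' 1 h1]; simp)
        simp only [hvar t 0 h0, hvar t 1 h1, ht' 0 h0, ht' 1 h1] at this
        simpa using this
    obtain ⟨x, hx, hlit⟩ := hchain.exists_assignment
    refine ⟨x, hx, ?_⟩
    change C.value x C.output = true
    -- If the circuit rejected, all literals together would support the output false, hence the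
    -- literals of few intervals `T` would do so; the constraint for a tuple that lists `T` forbids
    -- this.
    by_contra hval
    rw [Bool.not_eq_true] at hval
    have hfull : ∀ v < (net y).n,
        ∃ i ∈ Finset.range (k + 1), Lit (base y) (E i) (C.value x v) v := fun v hv => by
      rw [hnet] at hv
      obtain ⟨i, hi, hi'⟩ := (hlit v hv (C.value x v)).2 (C.value_input x ⟨v, hv⟩).symm
      exact ⟨i, Finset.mem_range.2 (by omega), hi'⟩
    have hbit := (hm.isVal x).bit (W := Edge y h (E (numVars y)))
      (lit := fun b v => ∃ i ∈ Finset.range (k + 1), Lit (base y) (E i) b v) hfull h 1 _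
      C.output_lt hshape
    rw [hval] at hbit
    -- The number `2 ^ h + 2` bounds the fan-in of small gates as well as the number of edges
    -- selected at one gate. The selected arguments of `v` are recovered from the digits by
    -- subtracting `v * base y`.
    obtain ⟨T, hT, hcard, hbitT⟩ := Net.bit_local (fun i b v => Lit (base y) (E i) b v) _
      (2 ^ h + 2) (Nat.le_add_left _ _) (fun v => ⟨(Finset.range (2 ^ h)).image fun s =>
        E (numVars y) / (base y ^ 2) ^ s % base y ^ 2 - v * base y,
        Finset.card_image_le.trans (by simp), fun j hj => by
          obtain ⟨s, hs, hs'⟩ := hj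
          exact Finset.mem_image.2 ⟨s, Finset.mem_range.2 hs, by rw [hs']; simp⟩⟩) h _ _ hbit
    -- Places beyond the list of `T` are filled with interval `0`, whose literals do no harm by
    -- `Net.bit_mono`.
    obtain ⟨t, ht, ht'⟩ := exists_tuple (y := y) (h := h) (fun d => T.toList.getD d 0)
      fun d _ => by
        by_cases hd : d < T.toList.length
        · rw [List.getD_eq_getElem _ _ hd]
          have := hT (Finset.mem_toList.1 (List.getElem_mem hd))
          rw [Finset.mem_range] at this
          omega
        · rw [List.getD_eq_default _ _ (not_lt.1 hd)]
          omega
    refine (hE t ht).2.2 ?_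
    dsimp only
    rw [hvar', h2]
    refine Net.bit_mono ?_ _ _ _ hbitT
    rintro b v ⟨i, hi, hi'⟩
    obtain ⟨d, hd, rfl⟩ := List.getElem_of_mem (Finset.mem_toList.2 hi)
    have hd2 : d < arity h := by
      rw [Finset.length_toList] at hd
      exact hd.trans_le (hcard.trans (Nat.pow_le_pow_right (by positivity) (Nat.le_succ h)))
    refine ⟨d, hd2, ?_⟩
    rwa [hvar t d hd2, ht' d hd2, List.getD_eq_getElem _ _ hd]

end Word

/-! ### Sums of numbers without carries -/

theorem sum_digits_lt {B n : ℕ} {u : ℕ → ℕ} (hu : ∀ c < n, u c < B) :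
    ∑ c ∈ Finset.range n, u c * B ^ c < B ^ n := by
  induction n with
  | zero => simp
  | succ n ih =>
    rw [Finset.sum_range_succ, pow_succ']
    have h1 := ih fun c hc => hu c (Nat.lt_succ_of_lt hc)
    have h2 : (u n + 1) * B ^ n ≤ B * B ^ n := Nat.mul_le_mul_right _ (hu n (Nat.lt_succ_self n))
    linarith

theorem digits_unique {B n : ℕ} {u v : ℕ → ℕ} (hu : ∀ c < n, u c < B) (hv : ∀ c < n, v c < B)
    (h : ∑ c ∈ Finset.range n, u c * B ^ c = ∑ c ∈ Finset.range n, v c * B ^ c) :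
    ∀ c < n, u c = v c := by
  induction n with
  | zero => simp
  | succ n ih =>
    rw [Finset.sum_range_succ, Finset.sum_range_succ] at h
    have hu' := fun c hc => hu c (Nat.lt_succ_of_lt hc)
    have hv' := fun c hc => hv c (Nat.lt_succ_of_lt hc)
    have h1 := sum_digits_lt hu'
    have h2 := sum_digits_lt hv'
    have hB : 0 < B ^ n := by omega
    have h3 : u n = v n := by
      have := congrArg (· / B ^ n) h
      simp only [Nat.add_mul_div_right _ _ hB, Nat.div_eq_of_lt h1, Nat.div_eq_of_lt h2] at this
      omega
    rw [h3] at h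
    intro c hc
    rcases Nat.lt_succ_iff_lt_or_eq.1 hc with hc | rfl
    · exact ih hu' hv' (by omega) c hc
    · exact h3

/-- The number with digits `u c` in base `B`, and a digit `1` above them. -/
def bigWeight (B n : ℕ) (u : ℕ → ℕ) : ℕ := ∑ c ∈ Finset.range n, u c * B ^ c + B ^ n

/-- The number with digits `u c` in base `B`, and the digit `K` above them. -/
def bigTarget (B n K : ℕ) (u : ℕ → ℕ) : ℕ := ∑ c ∈ Finset.range n, u c * B ^ c + K * B ^ n

section Carries

variable {ι : Type*} {B n K m : ℕ} {u : ι → ℕ → ℕ} {v : ℕ → ℕ} {I : Finset ι}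

theorem sum_bigWeight (B n : ℕ) (u : ι → ℕ → ℕ) (I : Finset ι) : ∑ i ∈ I, bigWeight B n (u i) =
    ∑ c ∈ Finset.range n, (∑ i ∈ I, u i c) * B ^ c + I.card * B ^ n := by
  unfold bigWeight
  rw [Finset.sum_add_distrib, Finset.sum_const, smul_eq_mul, Finset.sum_comm]
  simp only [Finset.sum_mul]

/-- The leading digit of every weight is one, and `K + 1` leading digits alone exceed the target,
whatever the lower digits are. -/
theorem card_le_of_sum_le (hv : ∀ c < n, v c < B)
    (h : ∑ i ∈ I, bigWeight B n (u i) ≤ bigTarget B n K v) : I.card ≤ K := by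
  rw [sum_bigWeight] at h
  unfold bigTarget at h
  have h1 := sum_digits_lt hv
  by_contra hK
  have h2 : (K + 1) * B ^ n ≤ I.card * B ^ n := Nat.mul_le_mul_right _ (by omega)
  rw [Nat.add_mul, one_mul] at h2
  omega

/-- At most `K` summands with digits at most `m` cause no carries in a base above `K * m`, so the
numbers can be compared digit by digit. -/
theorem digit_sums_eq (hB : K * m < B) (hu : ∀ i ∈ I, ∀ c < n, u i c ≤ m)
    (hv : ∀ c < n, v c < B) (h : ∑ i ∈ I, bigWeight B n (u i) = bigTarget B n K v) :
    I.card = K ∧ ∀ c < n, ∑ i ∈ I, u i c = v c := by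
  have hcard := card_le_of_sum_le hv h.le
  rw [sum_bigWeight] at h
  unfold bigTarget at h
  have hs : ∀ c < n, ∑ i ∈ I, u i c < B := fun c hc => by
    calc ∑ i ∈ I, u i c ≤ I.card • m := Finset.sum_le_card_nsmul _ _ _ fun i hi => hu i hi c hc
      _ ≤ K * m := Nat.mul_le_mul_right _ hcard
      _ < B := hB
  have h1 := sum_digits_lt hs
  have h2 := sum_digits_lt hv
  have hpos : 0 < B ^ n := by omega
  have h3 : I.card = K := by
    have := congrArg (· / B ^ n) h
    simp only [Nat.add_mul_div_right _ _ hpos, Nat.div_eq_of_lt h1, Nat.div_eq_of_lt h2] at this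
    omega
  rw [h3] at h
  exact ⟨h3, digits_unique hs hv (by omega)⟩

theorem bigWeight_lt (hu : ∀ c < n, v c < B) : bigWeight B n v < 2 * B ^ n := by
  have := sum_digits_lt hu
  unfold bigWeight
  omega

end Carries

/-! ### Constraint satisfaction as an exact knapsack problem -/

namespace Word

open Parameterized

variable (y : List ℕ) (h : ℕ)

theorem admissible_congr {y : List ℕ} {h t : ℕ} {e e' : ℕ → ℕ} (he : ∀ d ≤ arity h, e d = e' d)
    (ht : Admissible y h t e) : Admissible y h t e' := by
  obtain ⟨h1, h2, h3⟩ := ht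
  refine ⟨fun d hd => ?_, fun d hd d' hd' => ?_, ?_⟩
  · rw [← he d hd.le]; exact h1 d hd
  · rw [← he d hd.le, ← he d' hd'.le]; exact h2 d hd d' hd'
  · rw [← he _ le_rfl]
    refine fun hb => h3 (Net.bit_mono ?_ _ _ _ hb)
    rintro b v ⟨d, hd, hd'⟩
    exact ⟨d, hd, by rwa [he d hd.le]⟩

/-- The number of tuples of intervals. -/
def numTuples : ℕ := numVars y ^ arity h

/-- The number of items of a solution: one for each variable and one for each tuple. -/
def numSlots : ℕ := numVars y + 1 + numTuples y h

/-- The number of items in each slot. -/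
def slotSize : ℕ := domain y h ^ (arity h + 1)

/-- The number of items. -/
def numItems : ℕ := numSlots y h * slotSize y h

/-- The number of digits. -/
def numDigits : ℕ := numSlots y h + numTuples y h * (arity h + 1)

/-- The base of the number system. -/
def radix : ℕ := numSlots y h * domain y h + 1

/-- Digit `d` of the value of an item. -/
def entry (a d : ℕ) : ℕ := a / domain y h ^ d % domain y h

/-- Digit `c` of the size of the item `a` in slot `s`. -/
def digit (s a c : ℕ) : ℕ :=
  if c < numSlots y h then if c = s then 1 else 0
  else if s ≤ numVars y then
    if var y h ((c - numSlots y h) / (arity h + 1)) ((c - numSlots y h) % (arity h + 1)) = s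
      then a else 0
  else if (c - numSlots y h) / (arity h + 1) + (numVars y + 1) = s
    then domain y h - 1 - entry y h a ((c - numSlots y h) % (arity h + 1)) else 0

/-- Digit `c` of the capacity. -/
def targetDigit (c : ℕ) : ℕ := if c < numSlots y h then 1 else domain y h - 1

/-- The capacity. -/
def capacity : ℕ := bigTarget (radix y h) (numDigits y h) (numSlots y h) (targetDigit y h)

/-- The items that may be used. -/
def Good (s a : ℕ) : Prop :=
  (s ≤ numVars y → a < domain y h) ∧
    (¬s ≤ numVars y → Admissible y h (s - (numVars y + 1)) (entry y h a))

/-- The size of a good item. -/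
def goodSize (i : ℕ) : ℕ :=
  bigWeight (radix y h) (numDigits y h) (digit y h (i / slotSize y h) (i % slotSize y h))

/-- Item `i` may be used. -/
def GoodItem (i : ℕ) : Prop := Good y h (i / slotSize y h) (i % slotSize y h)

open Classical in
/-- The size of item `i`. -/
noncomputable def itemSize (i : ℕ) : ℕ :=
  if GoodItem y h i then goodSize y h i else capacity y h + 1

variable {y h}

theorem domain_pos : 0 < domain y h := by unfold domain base; positivity

theorem one_lt_domain : 1 < domain y h := by
  unfold domain
  exact Nat.one_lt_pow (by positivity) (by unfold base; omega)

theorem slotSize_pos : 0 < slotSize y h := Nat.pow_pos domain_pos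

theorem entry_lt (a d : ℕ) : entry y h a d < domain y h := Nat.mod_lt _ domain_pos

theorem targetDigit_lt (c : ℕ) : targetDigit y h c < radix y h := by
  have h1 := one_lt_domain (y := y) (h := h)
  have h2 : 1 * domain y h ≤ numSlots y h * domain y h :=
    Nat.mul_le_mul_right _ (by unfold numSlots; omega)
  unfold targetDigit radix
  split_ifs <;> omega

theorem digit_le {s a : ℕ} (hg : Good y h s a) (c : ℕ) : digit y h s a c ≤ domain y h := by
  have h1 := one_lt_domain (y := y) (h := h)
  unfold digit
  split_ifs with h1 h2 h3
  · omega
  · omega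
  · exact (hg.1 h3).le
  · omega
  · omega
  · omega

theorem digit_lt {s a : ℕ} (hg : Good y h s a) (c : ℕ) : digit y h s a c < radix y h := by
  have h1 := digit_le hg c
  have h2 : 1 * domain y h ≤ numSlots y h * domain y h :=
    Nat.mul_le_mul_right _ (by unfold numSlots; omega)
  unfold radix
  omega

/-- An item that may not be used is larger than the capacity on its own. -/
theorem goodItem_of_sum_le {I : Finset ℕ} (hI : ∑ i ∈ I, itemSize y h i ≤ capacity y h) :
    ∀ i ∈ I, GoodItem y h i := fun i hi => by
  by_contra hg
  have h1 := Finset.single_le_sum (f := itemSize y h) (fun _ _ => Nat.zero_le _) hi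
  rw [itemSize, if_neg hg] at h1
  omega

theorem sum_itemSize {I : Finset ℕ} (hI : ∀ i ∈ I, GoodItem y h i) :
    ∑ i ∈ I, itemSize y h i = ∑ i ∈ I, goodSize y h i :=
  Finset.sum_congr rfl fun i hi => if_pos (hI i hi)

theorem card_le_of_feasible {I : Finset ℕ} (hI : ∑ i ∈ I, itemSize y h i ≤ capacity y h) :
    I.card ≤ numSlots y h := by
  have hg := goodItem_of_sum_le hI
  rw [sum_itemSize hg] at hI
  exact card_le_of_sum_le (u := fun i => digit y h (i / slotSize y h) (i % slotSize y h))
    (fun c _ => targetDigit_lt c) hI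

theorem digit_sums {I : Finset ℕ} (hI : ∑ i ∈ I, itemSize y h i = capacity y h) :
    I.card = numSlots y h ∧ ∀ c < numDigits y h,
      ∑ i ∈ I, digit y h (i / slotSize y h) (i % slotSize y h) c = targetDigit y h c := by
  have hg := goodItem_of_sum_le hI.le
  rw [sum_itemSize hg] at hI
  exact digit_sums_eq (u := fun i => digit y h (i / slotSize y h) (i % slotSize y h))
    (Nat.lt_succ_self _) (fun i hi c _ => digit_le (hg i hi) c) (fun c _ => targetDigit_lt c) hI

theorem slot_div {s a : ℕ} (ha : a < slotSize y h) :
    (s * slotSize y h + a) / slotSize y h = s ∧ (s * slotSize y h + a) % slotSize y h = a := by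
  constructor
  · rw [mul_comm, Nat.mul_add_div slotSize_pos, Nat.div_eq_of_lt ha, add_zero]
  · rw [mul_comm, Nat.mul_add_mod, Nat.mod_eq_of_lt ha]

/-- This digit ties the item of constraint `t` to the variable at its place `d`. Variable slots have
numbers up to `numVars y` and constraint slots have larger ones, so at most one summand is present.
-/
theorem digit_tuple {s a t d : ℕ} (hd : d ≤ arity h) :
    digit y h s a (numSlots y h + (t * (arity h + 1) + d)) =
      (if s = var y h t d then a else 0) +
        if s = t + (numVars y + 1) then domain y h - 1 - entry y h a d else 0 := by
  have hv : var y h t d ≤ numVars y := by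
    unfold var
    split_ifs
    · exact (place_lt t d).le
    · exact le_rfl
  have h1 : (t * (arity h + 1) + d) / (arity h + 1) = t := by
    rw [mul_comm, Nat.mul_add_div (Nat.succ_pos _), Nat.div_eq_of_lt (by omega), add_zero]
  have h2 : (t * (arity h + 1) + d) % (arity h + 1) = d := by
    rw [mul_comm, Nat.mul_add_mod, Nat.mod_eq_of_lt (by omega)]
  unfold digit
  rw [if_neg (by omega), Nat.add_sub_cancel_left, h1, h2]
  by_cases hs : s ≤ numVars y
  · rw [if_pos hs, if_neg (show ¬s = t + (numVars y + 1) by omega), add_zero]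
    simp only [eq_comm]
  · rw [if_neg hs, if_neg (show ¬s = var y h t d by omega), zero_add]
    simp only [eq_comm]

theorem tuple_digit_lt {t d : ℕ} (ht : t < numTuples y h) (hd : d ≤ arity h) :
    numSlots y h + (t * (arity h + 1) + d) < numDigits y h := by
  have : (t + 1) * (arity h + 1) ≤ numTuples y h * (arity h + 1) := Nat.mul_le_mul_right _ ht
  unfold numDigits
  rw [Nat.add_mul] at this
  omega

/-- The constraint satisfaction problem as an exact knapsack problem. -/
theorem exists_assignment_iff :
    (∃ E : ℕ → ℕ, (∀ i ≤ numVars y, E i < domain y h) ∧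
      ∀ t < numVars y ^ arity h, Admissible y h t fun d => E (var y h t d)) ↔
    ∃ I ⊆ Finset.range (numItems y h), ∑ i ∈ I, itemSize y h i = capacity y h := by
  constructor
  · rintro ⟨E, hE, hadm⟩
    -- In the slot of constraint `t`, the item `a t` is taken, which lists the values of `E` at the
    -- places of `t`.
    choose a ha1 ha2 using fun t => exists_digits (domain y h)
      (fun d => if d ≤ arity h ∧ t < numTuples y h then E (var y h t d) else 0) (arity h + 1)
      (fun d _ => by
        split_ifs with hd
        · refine hE _ ?_
          unfold var
          split_ifs
          · exact (place_lt t d).le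
          · exact le_rfl
        · exact domain_pos)
    let ch : ℕ → ℕ := fun s => if s ≤ numVars y then E s else a (s - (numVars y + 1))
    have hch : ∀ s, ch s < slotSize y h := fun s => by
      simp only [ch]
      split_ifs with hs
      · exact (hE s hs).trans_le (Nat.le_self_pow (Nat.succ_ne_zero _) _)
      · exact ha1 _
    have hentry : ∀ t < numTuples y h, ∀ d ≤ arity h,
        entry y h (a t) d = E (var y h t d) := fun t ht d hd => by
      have := ha2 t d (Nat.lt_succ_of_le hd)
      rwa [if_pos ⟨hd, ht⟩] at this
    have hgood : ∀ s < numSlots y h, Good y h s (ch s) := fun s hs => by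
      refine ⟨fun hs' => ?_, fun hs' => ?_⟩
      · simp only [ch, if_pos hs']
        exact hE s hs'
      · simp only [ch, if_neg hs']
        have ht : s - (numVars y + 1) < numTuples y h := by unfold numSlots at hs; omega
        exact admissible_congr (fun d hd => (hentry _ ht d hd).symm) (hadm _ ht)
    have hinj : Set.InjOn (fun s => s * slotSize y h + ch s)
        (Finset.range (numSlots y h) : Finset ℕ) := by
      intro s _ s' _ hss
      have := congrArg (· / slotSize y h) hss
      simpa only [(slot_div (hch _)).1] using this
    refine ⟨(Finset.range (numSlots y h)).image fun s => s * slotSize y h + ch s, ?_, ?_⟩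
    · intro i hi
      obtain ⟨s, hs, rfl⟩ := Finset.mem_image.1 hi
      rw [Finset.mem_range] at hs ⊢
      have h1 : (s + 1) * slotSize y h ≤ numSlots y h * slotSize y h :=
        Nat.mul_le_mul_right _ hs
      have := hch s
      unfold numItems
      linarith
    · rw [Finset.sum_image hinj]
      have h1 : ∀ s ∈ Finset.range (numSlots y h), itemSize y h (s * slotSize y h + ch s) =
          bigWeight (radix y h) (numDigits y h) (digit y h s (ch s)) := fun s hs => by
        have hg : GoodItem y h (s * slotSize y h + ch s) := by
          unfold GoodItem
          rw [(slot_div (hch s)).1, (slot_div (hch s)).2]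
          exact hgood s (Finset.mem_range.1 hs)
        rw [itemSize, if_pos hg, goodSize, (slot_div (hch s)).1, (slot_div (hch s)).2]
      rw [Finset.sum_congr rfl h1, sum_bigWeight _ _ (fun s => digit y h s (ch s)),
        Finset.card_range]
      unfold capacity bigTarget
      congr 1
      refine Finset.sum_congr rfl fun c hc => ?_
      congr 1
      rw [Finset.mem_range] at hc
      by_cases hcK : c < numSlots y h
      · simp only [digit, if_pos hcK, targetDigit]
        rw [Finset.sum_ite_eq, if_pos (Finset.mem_range.2 hcK)]
      · obtain ⟨t, d, ht, hd, rfl⟩ : ∃ t d, t < numTuples y h ∧ d ≤ arity h ∧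
            c = numSlots y h + (t * (arity h + 1) + d) := by
          refine ⟨(c - numSlots y h) / (arity h + 1), (c - numSlots y h) % (arity h + 1), ?_,
            Nat.lt_succ_iff.1 (Nat.mod_lt _ (Nat.succ_pos _)), ?_⟩
          · rw [Nat.div_lt_iff_lt_mul (Nat.succ_pos _)]
            unfold numDigits at hc
            rw [Nat.succ_eq_add_one]
            omega
          · rw [Nat.div_add_mod']
            omega
        have hv : var y h t d ≤ numVars y := by
          unfold var
          split_ifs
          · exact (place_lt t d).le
          · exact le_rfl
        rw [Finset.sum_congr rfl fun s _ => digit_tuple (a := ch s) hd, Finset.sum_add_distrib,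
          Finset.sum_ite_eq', Finset.sum_ite_eq', if_pos, if_pos, targetDigit, if_neg hcK]
        -- The value of the variable and its complement add up to the target digit.
        · simp only [ch, if_pos hv]
          rw [if_neg (by omega), Nat.add_sub_cancel, hentry t ht d hd]
          have := hE _ hv
          omega
        · rw [Finset.mem_range]; unfold numSlots; omega
        · rw [Finset.mem_range]; unfold numSlots; omega
  · rintro ⟨I, _, hI⟩
    have hg := goodItem_of_sum_le hI.le
    obtain ⟨_, hsum⟩ := digit_sums hI
    -- Digit `s` counts the chosen items in slot `s`.
    have huniq : ∀ s < numSlots y h, ∃ i, I.filter (fun i => i / slotSize y h = s) = {i} :=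
      fun s hs => by
        have := hsum s (by unfold numDigits; omega)
        simp only [digit, if_pos hs, targetDigit] at this
        rw [← Finset.card_eq_one, Finset.card_filter]
        simpa only [eq_comm] using this
    choose! item hitem using huniq
    have hmem : ∀ s < numSlots y h, item s ∈ I ∧ item s / slotSize y h = s := fun s hs => by
      have : item s ∈ I.filter (fun i => i / slotSize y h = s) := by rw [hitem s hs]; simp
      simpa using this
    have hpick : ∀ s < numSlots y h, ∀ f : ℕ → ℕ,
        ∑ i ∈ I, (if i / slotSize y h = s then f i else 0) = f (item s) := fun s hs f => by
      rw [← Finset.sum_filter, hitem s hs, Finset.sum_singleton]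
    have hE : ∀ i ≤ numVars y, item i % slotSize y h < domain y h := fun i hi => by
      have hi' : i < numSlots y h := by unfold numSlots; omega
      have := hg _ (hmem i hi').1
      unfold GoodItem at this
      rw [(hmem i hi').2] at this
      exact this.1 hi
    refine ⟨fun s => item s % slotSize y h, hE, fun t ht => ?_⟩
    have hs : t + (numVars y + 1) < numSlots y h := by
      have : t < numTuples y h := ht
      unfold numSlots; omega
    have h1 := hg _ (hmem _ hs).1
    unfold GoodItem at h1
    rw [(hmem _ hs).2] at h1
    have h2 := h1.2 (by omega)
    rw [Nat.add_sub_cancel] at h2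
    refine admissible_congr (fun d hd => ?_) h2
    have hv : var y h t d ≤ numVars y := by
      unfold var
      split_ifs
      · exact (place_lt t d).le
      · exact le_rfl
    -- A value plus the complement of an entry equals `domain y h - 1` only if the value and the
    -- entry agree.
    have h3 := hsum _ (tuple_digit_lt ht hd)
    rw [Finset.sum_congr rfl fun i _ => digit_tuple hd, Finset.sum_add_distrib,
      hpick _ (show var y h t d < numSlots y h by unfold numSlots; omega)
        fun i => i % slotSize y h,
      hpick _ hs fun i => domain y h - 1 - entry y h (i % slotSize y h) d,
      targetDigit, if_neg (by omega)] at h3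
    have h4 := hE _ hv
    have h5 := entry_lt (y := y) (h := h) (item (t + (numVars y + 1)) % slotSize y h) d
    dsimp only
    omega

end Word

namespace Word

open RAM Parameterized

variable {α : Type} [Ctx α] {F G a v t d w s i c : α → ℕ} {h : ℕ}

/-! ### Polynomial bounds -/

theorem pb_numIn : PB (fun z : α => numIn (inp z)) := PB.length.of_le fun _ => min_le_right _ _

theorem pb_numGates : PB (fun z : α => numGates (inp z)) :=
  PB.length.of_le fun _ => min_le_right _ _

theorem pb_base : PB (fun z : α => base (inp z)) := PB.length.add (PB.const 2)

theorem pb_numVars : PB (fun z : α => numVars (inp z)) :=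
  (PB.length.add (PB.const 1)).of_le fun _ => Nat.add_le_add_right (min_le_right _ _) 1

/-- The exponent is a constant, since `h` is fixed. The same holds for the powers in `numTuples` and
`slotSize`. -/
theorem pb_domain : PB (fun z : α => domain (inp z) h) := pb_base.pow _

theorem pb_numTuples : PB (fun z : α => numTuples (inp z) h) := pb_numVars.pow _

theorem pb_numSlots : PB (fun z : α => numSlots (inp z) h) :=
  (pb_numVars.add (PB.const 1)).add pb_numTuples

theorem pb_slotSize : PB (fun z : α => slotSize (inp z) h) := pb_domain.pow _

theorem pb_numItems : PB (fun z : α => numItems (inp z) h) := pb_numSlots.mul pb_slotSize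

theorem pb_numDigits : PB (fun z : α => numDigits (inp z) h) :=
  pb_numSlots.add (pb_numTuples.mul (PB.const _))

/-! ### Polynomial time -/

theorem pt_get (hi : PT i) : PT (fun z => get (inp z) (i z)) := hi.getD

theorem pt_numIn : PT (fun z : α => numIn (inp z)) := (pt_get (PT.const 1)).min PT.length

theorem pt_numGates : PT (fun z : α => numGates (inp z)) := (pt_get (PT.const 3)).min PT.length

theorem pt_pos (hi : PT i) (hiB : PB i) : PT (fun z => pos (inp z) (i z)) := by
  have hlen : PT (fun z : α => (inp z).length + 1) := PT.length.add (PT.const 1)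
  refine PT.iterate (cap := fun z => (inp z).length + 1) hi hiB
    (((PT.const 4).add pt_numIn).min hlen) ?_ (PB.length.add (PB.const 1))
    (fun z j => pos_le (inp z) j)
  exact ((PT.snd.add (PT.const 2)).add (PT.getD (PT.snd.add (PT.const 1)))).min hlen.fst

theorem pt_gatePos (hv : PT v) : PT (fun z => gatePos (inp z) (v z)) :=
  pt_pos ((hv.sub pt_numIn).min PT.length) (PB.length.of_le fun _ => min_le_right _ _)

theorem pt_kind (hv : PT v) : PT (fun z => (net (inp z)).kind (v z)) := pt_get (pt_gatePos hv)

theorem pt_fan (hv : PT v) : PT (fun z => (net (inp z)).fan (v z)) :=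
  (pt_get ((pt_gatePos hv).add (PT.const 1))).min PT.length

theorem pb_fan : PB (fun z => (net (inp z)).fan (v z)) :=
  PB.length.of_le fun _ => min_le_right _ _

theorem pt_arg (hv : PT v) (hi : PT i) : PT (fun z => (net (inp z)).arg (v z) (i z)) :=
  pt_get (((pt_gatePos hv).add (PT.const 2)).add hi)

theorem pt_base : PT (fun z : α => base (inp z)) := PT.length.add (PT.const 2)

theorem pt_numVars : PT (fun z : α => numVars (inp z)) :=
  ((pt_get (PT.const 0)).min PT.length).add (PT.const 1)

theorem pt_domain : PT (fun z : α => domain (inp z) h) := pt_base.pow (PT.const _) (PB.const _)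

theorem pt_numTuples : PT (fun z : α => numTuples (inp z) h) :=
  pt_numVars.pow (PT.const _) (PB.const _)

theorem pt_numSlots : PT (fun z : α => numSlots (inp z) h) :=
  (pt_numVars.add (PT.const 1)).add pt_numTuples

theorem pt_slotSize : PT (fun z : α => slotSize (inp z) h) :=
  pt_domain.pow (PT.const _) (PB.const _)

theorem pt_numItems : PT (fun z : α => numItems (inp z) h) := pt_numSlots.mul pt_slotSize

theorem pt_numDigits : PT (fun z : α => numDigits (inp z) h) :=
  pt_numSlots.add (pt_numTuples.mul (PT.const _))

theorem pt_radix : PT (fun z : α => radix (inp z) h) :=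
  (pt_numSlots.mul pt_domain).add (PT.const 1)

theorem pt_place (ht : PT t) (hd : PT d) (hdB : PB d) :
    PT (fun z => place (inp z) (t z) (d z)) :=
  (ht.div (pt_numVars.pow hd hdB)).mod pt_numVars

theorem pt_entry (ha : PT a) (hd : PT d) (hdB : PB d) :
    PT (fun z => entry (inp z) h (a z) (d z)) :=
  (ha.div (pt_domain.pow hd hdB)).mod pt_domain

theorem pt_var (ht : PT t) (hd : PT d) (hdB : PB d) :
    PT (fun z => var (inp z) h (t z) (d z)) :=
  PD.ite (PD.lt hd (PT.const _)) (pt_place ht hd hdB) pt_numVars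

theorem pd_edge (hw : PT w) (hv : PT v) (hi : PT i) :
    PD (fun z => Edge (inp z) h (w z) (v z) (i z)) := by
  have hX : PT (fun p : α × ℕ => base (inp p.1) ^ 2) :=
    (pt_base.pow (PT.const _) (PB.const _)).fst
  exact PD.exists_lt (PT.const _) (PB.const _) (PD.eq
    ((hw.fst.div (hX.pow PT.snd PB.snd)).mod hX) ((hv.mul pt_base).add hi).fst)

theorem pd_lit (b : Bool) (hc : PT c) (hv : PT v) :
    PD (fun z => Lit (base (inp z)) (c z) b (v z)) := by
  have hv1 : PT (fun z => v z + 1) := hv.add (PT.const 1)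
  cases b with
  | true => exact (PD.eq (hc.div pt_base) hv1).of_iff fun z => by simp [Lit]
  | false =>
    exact ((PD.lt (hc.div pt_base) hv1).and (PD.lt hv1 (hc.mod pt_base))).of_iff
      fun z => by simp [Lit]

/-- What the digits of `a` tell about the inputs. -/
def TupleLit (y : List ℕ) (h a : ℕ) (b : Bool) (v : ℕ) : Prop :=
  ∃ d < arity h, Lit (base y) (entry y h a d) b v

theorem pd_tupleLit (b : Bool) (ha : PT a) (hv : PT v) :
    PD (fun z => TupleLit (inp z) h (a z) b (v z)) :=
  PD.exists_lt (PT.const _) (PB.const _) (pd_lit b (pt_entry ha.fst PT.snd PB.snd) hv.fst)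

theorem pd_decisive (b : Bool) (hv : PT v) : PD (fun z => b = (net (inp z)).decisive (v z)) := by
  have : PD (fun z => (net (inp z)).kind (v z) = 3) := PD.eq (pt_kind hv) (PT.const 3)
  cases b with
  | true => exact this.of_iff fun z => by simp [Net.decisive]
  | false => exact this.not.of_iff fun z => by simp [Net.decisive]

/-- The depth `f` is a constant, so the program is built by recursion on `f`. The context type must
be general, because every quantifier over arguments adds a variable. -/
theorem pd_bit (h f : ℕ) : ∀ (b : Bool) {α : Type} [Ctx α] {a v : α → ℕ}, PT a → PT v →
    PD (fun z => (net (inp z)).Bit (TupleLit (inp z) h (a z))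
      (Edge (inp z) h (entry (inp z) h (a z) (arity h))) f b (v z)) := by
  induction f with
  | zero => exact fun b _ _ _ _ ha hv => pd_tupleLit b ha hv
  | succ f ih =>
    intro b α _ a v ha hv
    have hk : PD (fun z => (net (inp z)).kind (v z) = 1) := PD.eq (pt_kind hv) (PT.const 1)
    have hd := pd_decisive b hv
    have harg : PT (fun p : α × ℕ => (net (inp p)).arg (v p.1) p.2) := pt_arg hv.fst PT.snd
    refine ((PD.lt hv pt_numIn).and (pd_tupleLit b ha hv)).or ((PD.le pt_numIn hv).and
      ((hk.and (ih (!b) ha (pt_arg hv (PT.const 0)))).or ((hk.not.and (hd.and ?_)).or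
        (hk.not.and (hd.not.and ?_)))))
    · exact PD.exists_lt (pt_fan hv) pb_fan (ih b ha.fst harg)
    · exact PD.forall_lt (pt_fan hv) pb_fan (PD.imp ((PD.le (pt_fan hv) (PT.const 2)).fst.or
        (pd_edge (pt_entry ha (PT.const _) (PB.const _)).fst hv.fst harg)) (ih b ha.fst harg))

theorem pd_shape (f : ℕ) : ∀ (t : ℕ) {α : Type} [Ctx α] {v : α → ℕ}, PT v →
    PD (fun z => (net (inp z)).Shape f t (v z)) := by
  induction f with
  | zero => exact fun t _ _ _ hv => PD.lt hv pt_numIn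
  | succ f ih =>
    intro t α _ v hv
    have harg : PT (fun p : α × ℕ => (net (inp p)).arg (v p.1) p.2) := pt_arg hv.fst PT.snd
    exact (PD.lt hv pt_numIn).or (((PD.le (pt_fan hv) (PT.const 2)).and
      (PD.forall_lt (pt_fan hv) pb_fan (ih t harg))).or
      ((PD.const (1 ≤ t)).and (PD.forall_lt (pt_fan hv) pb_fan (ih (t - 1) harg))))

theorem pd_admissible (ht : PT t) (ha : PT a) :
    PD (fun z => Admissible (inp z) h (t z) (entry (inp z) h (a z))) := by
  have hD : PT (fun _ : α => arity h) := PT.const _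
  have hDB : PB (fun _ : α => arity h) := PB.const _
  have he : PT (fun p : α × ℕ => entry (inp p) h (a p.1) p.2) := pt_entry ha.fst PT.snd PB.snd
  have he1 : PT (fun p : (α × ℕ) × ℕ => entry (inp p) h (a p.1.1) p.1.2) :=
    (pt_entry ha.fst PT.snd PB.snd).fst
  have he2 : PT (fun p : (α × ℕ) × ℕ => entry (inp p) h (a p.1.1) p.2) :=
    pt_entry ha.fst.fst PT.snd PB.snd
  have hp : PT (fun p : α × ℕ => place (inp p) (t p.1) p.2) := pt_place ht.fst PT.snd PB.snd
  have hp1 : PT (fun p : (α × ℕ) × ℕ => place (inp p) (t p.1.1) p.1.2) :=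
    (pt_place ht.fst PT.snd PB.snd).fst
  have hp2 : PT (fun p : (α × ℕ) × ℕ => place (inp p) (t p.1.1) p.2) :=
    pt_place ht.fst.fst PT.snd PB.snd
  refine (PD.forall_lt hD hDB ?_).and ((PD.forall_lt hD hDB
    (PD.forall_lt (b := fun _ => arity h) (P := fun (p : α × ℕ) d' =>
      place (inp p) (t p.1) d' = place (inp p) (t p.1) p.2 + 1 →
        entry (inp p) h (a p.1) p.2 % base (inp p) = entry (inp p) h (a p.1) d' / base (inp p))
      (PT.const _) (PB.const _) ?_)).and (pd_bit h h false ha (pt_get (PT.const 2))).not)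
  · exact (PD.lt (he.div pt_base) (he.mod pt_base)).and
      ((PD.imp (PD.eq hp (PT.const 0)) (PD.eq (he.div pt_base) (PT.const 0))).and
      (PD.imp (PD.eq (hp.add (PT.const 1)) pt_numVars)
        (PD.eq (he.mod pt_base) (pt_numIn.add (PT.const 1)))))
  · exact PD.imp (PD.eq hp2 (hp1.add (PT.const 1))) (PD.eq (he1.mod pt_base) (he2.div pt_base))

theorem pt_digit (hs : PT s) (ha : PT a) (hc : PT c) :
    PT (fun z => digit (inp z) h (s z) (a z) (c z)) := by
  have hc' : PT (fun z => c z - numSlots (inp z) h) := hc.sub pt_numSlots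
  have ht : PT (fun z => (c z - numSlots (inp z) h) / (arity h + 1)) := hc'.div (PT.const _)
  have hd : PT (fun z => (c z - numSlots (inp z) h) % (arity h + 1)) := hc'.mod (PT.const _)
  have hdB : PB (fun z => (c z - numSlots (inp z) h) % (arity h + 1)) :=
    (PB.const (arity h + 1)).of_le fun _ => (Nat.mod_lt _ (Nat.succ_pos _)).le
  exact PD.ite (PD.lt hc pt_numSlots) (PD.ite (PD.eq hc hs) (PT.const 1) (PT.const 0))
    (PD.ite (PD.le hs pt_numVars) (PD.ite (PD.eq (pt_var ht hd hdB) hs) ha (PT.const 0))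
      (PD.ite (PD.eq (ht.add (pt_numVars.add (PT.const 1))) hs)
        ((pt_domain.sub (PT.const 1)).sub (pt_entry ha hd hdB)) (PT.const 0)))

theorem pt_targetDigit (hc : PT c) : PT (fun z => targetDigit (inp z) h (c z)) :=
  PD.ite (PD.lt hc pt_numSlots) (PT.const 1) (pt_domain.sub (PT.const 1))

theorem pt_top : PT (fun z : α => radix (inp z) h ^ numDigits (inp z) h) :=
  pt_radix.pow pt_numDigits pb_numDigits

theorem pt_capacity : PT (fun z : α => capacity (inp z) h) :=
  (PT.sum pt_numDigits pb_numDigits ((pt_targetDigit PT.snd).mul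
    (pt_radix.fst.pow PT.snd PB.snd))).add (pt_numSlots.mul pt_top)

theorem pt_goodSize (hi : PT i) : PT (fun z => goodSize (inp z) h (i z)) :=
  (PT.sum pt_numDigits pb_numDigits ((pt_digit (hi.div pt_slotSize).fst
    (hi.mod pt_slotSize).fst PT.snd).mul (pt_radix.fst.pow PT.snd PB.snd))).add pt_top

theorem pd_goodItem (hi : PT i) : PD (fun z => GoodItem (inp z) h (i z)) := by
  have hs : PT (fun z => i z / slotSize (inp z) h) := hi.div pt_slotSize
  have ha : PT (fun z => i z % slotSize (inp z) h) := hi.mod pt_slotSize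
  have hle : PD (fun z => i z / slotSize (inp z) h ≤ numVars (inp z)) := PD.le hs pt_numVars
  exact (PD.imp hle (PD.lt ha pt_domain)).and
    (PD.imp hle.not (pd_admissible (hs.sub (pt_numVars.add (PT.const 1))) ha))

theorem pt_itemSize (hi : PT i) : PT (fun z => itemSize (inp z) h (i z)) :=
  by classical exact PD.ite (pd_goodItem hi) (pt_goodSize hi) (pt_capacity.add (PT.const 1))

open Classical in
/-- The exponent of item `i`. -/
noncomputable def itemExp (y : List ℕ) (h γ i : ℕ) : ℕ :=
  if GoodItem y h i then γ * (2 * radix y h ^ numDigits y h - goodSize y h i) else 0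

theorem pt_itemExp (γ : ℕ) (hi : PT i) : PT (fun z => itemExp (inp z) h γ (i z)) := by
  classical
  exact PD.ite (pd_goodItem hi)
    ((PT.const γ).mul (((PT.const 2).mul pt_top).sub (pt_goodSize hi))) (PT.const 0)

/-- The word consists of a parameter `k` and the encoding of a circuit of weft at most one and
depth at most `h`, and `k` is at most its length. -/
def IsInstance (y : List ℕ) (h : ℕ) : Prop :=
  WellFormed y ∧ get y 0 ≤ y.length ∧ (net y).Shape h 1 (get y 2)

theorem pd_isInstance : PD (fun z : α => IsInstance (inp z) h) := by
  have hv : PT (fun p : α × ℕ => numIn (inp p) + p.2) := pt_numIn.add PT.snd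
  have hv' : PT (fun p : (α × ℕ) × ℕ => numIn (inp p) + p.1.2) := hv.fst
  have hlt : ∀ {i : α → ℕ}, PT i → PD (fun z => i z ≤ (inp z).length) := fun hi =>
    PD.le hi PT.length
  have h1 : PD (fun z : α => 4 ≤ (inp z).length) := PD.le (PT.const 4) PT.length
  have h4 : PD (fun z : α => ∀ j < numIn (inp z), get (inp z) (4 + j) = 0) :=
    PD.forall_lt pt_numIn pb_numIn (PD.eq (pt_get ((PT.const 4).add PT.snd)) (PT.const 0))
  have h5 : PD (fun z : α => pos (inp z) (numGates (inp z)) = (inp z).length) :=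
    PD.eq (pt_pos pt_numGates pb_numGates) PT.length
  have h6 : PD (fun z : α => ∀ i < numGates (inp z),
      1 ≤ (net (inp z)).kind (numIn (inp z) + i) ∧ (net (inp z)).kind (numIn (inp z) + i) ≤ 3) :=
    PD.forall_lt pt_numGates pb_numGates ((PD.le (PT.const 1) (pt_kind hv)).and
      (PD.le (pt_kind hv) (PT.const 3)))
  have h7 : PD (fun z : α => ∀ i < numGates (inp z),
      (net (inp z)).kind (numIn (inp z) + i) = 1 → (net (inp z)).fan (numIn (inp z) + i) = 1) :=
    PD.forall_lt pt_numGates pb_numGates (PD.imp (PD.eq (pt_kind hv) (PT.const 1))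
      (PD.eq (pt_fan hv) (PT.const 1)))
  have h8 : PD (fun z : α => ∀ i < numGates (inp z), ∀ j < (net (inp z)).fan (numIn (inp z) + i),
      (net (inp z)).arg (numIn (inp z) + i) j < numIn (inp z) + i) :=
    PD.forall_lt pt_numGates pb_numGates (PD.forall_lt
      (b := fun p : α × ℕ => (net (inp p)).fan (numIn (inp p) + p.2))
      (P := fun (p : α × ℕ) j => (net (inp p)).arg (numIn (inp p) + p.2) j <
        numIn (inp p) + p.2) (pt_fan hv) pb_fan (PD.lt (pt_arg hv' PT.snd) hv'))
  have h9 : PD (fun z : α => get (inp z) 2 < numIn (inp z) + numGates (inp z)) :=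
    PD.lt (pt_get (PT.const 2)) (pt_numIn.add pt_numGates)
  have hW : PD (fun z : α => WellFormed (inp z)) := by
    refine (h1.and ((hlt (pt_get (PT.const 1))).and ((hlt (pt_get (PT.const 3))).and
      (h4.and (h5.and (h6.and (h7.and (h8.and h9)))))))).of_iff fun z => ?_
    exact ⟨fun ⟨h1, h2, h3, h4, h5, h6, h7, h8, h9⟩ => ⟨h1, h2, h3, h4, h5, h6, h7, h8, h9⟩,
      fun ⟨h1, h2, h3, h4, h5, h6, h7, h8, h9⟩ => ⟨h1, h2, h3, h4, h5, h6, h7, h8, h9⟩⟩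
  exact hW.and ((hlt (pt_get (PT.const 0))).and (pd_shape h 1 (pt_get (PT.const 2))))

/-- The reduction from weighted satisfiability of circuits of weft one to exact knapsack. -/
theorem mem_weightedCircuitSat_iff (x : List ℕ) (k h : ℕ) :
    (x, k) ∈ WeightedCircuitSat 1 h ↔ IsInstance (k :: x) h ∧
      ∃ I ⊆ Finset.range (numItems (k :: x) h),
        ∑ i ∈ I, itemSize (k :: x) h i = capacity (k :: x) h := by
  constructor
  · rintro ⟨C, hw, hd, hx, a, ha, hacc⟩
    have hy : k :: x = k :: C.encode := congrArg (k :: ·) hx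
    obtain ⟨h1, h2, h3, h4, h5, h6⟩ := wellFormed_encode k C hy
    -- There are at least `k` inputs, each of which occupies a letter.
    have hk : k ≤ (k :: x).length := by
      have e1 := numNodes_lt_length hy
      have e2 := Finset.card_filter_le Finset.univ fun i => a i = true
      rw [Finset.card_univ, Fintype.card_fin] at e2
      simp only at ha
      omega
    refine ⟨⟨h1, by rw [h3]; exact hk, ?_⟩, ?_⟩
    · rw [h4]
      exact (h2.shape_iff h 1 _ C.output_lt).2 ⟨hd, hw⟩
    · rw [← exists_assignment_iff, ← exists_accepting_iff hy hk hw hd]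
      exact ⟨a, ha, hacc⟩
  · rintro ⟨⟨h1, h2, h3⟩, hI⟩
    obtain ⟨C, hC⟩ := h1.exists_circuit
    have hy : k :: x = k :: C.encode := hC
    obtain ⟨_, e2, e3, e4, e5, e6⟩ := wellFormed_encode k C hy
    rw [e3] at h2
    rw [e4] at h3
    obtain ⟨hd, hw⟩ := (e2.shape_iff h 1 _ C.output_lt).1 h3
    rw [← exists_assignment_iff, ← exists_accepting_iff hy h2 hw hd] at hI
    obtain ⟨a, ha, hacc⟩ := hI
    exact ⟨C, hw, hd, (List.cons.inj hy).2, a, ha, hacc⟩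

end Word

/-! ### From exact knapsack to a gap for Knapsack with Uncertainty -/

namespace KnapsackUncertainty

namespace Instance

variable {K : Instance} {I : Finset (Fin K.n)}

theorem ae_le_one (K : Instance) : ∀ᵐ P ∂K.law, ∀ i, P i ≤ 1 := by
  rw [ae_all_iff]
  intro i
  have h : ∀ᵐ a ∂(bernoulliMeasure 1 0 (K.item i).prob : Measure ℕ), a ≤ 1 := by
    rw [ae_iff]
    exact bernoulliMeasure_apply_of_notMem_of_notMem _ (by measurability) (by simp) (by simp)
  exact (Measure.tendsto_eval_ae_ae (μ := fun i => bernoulliMeasure 1 0 (K.item i).prob)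
    (i := i)).eventually h

/-- If the threshold is the number of chosen items, then all profits have to be one. -/
theorem objective_eq_prod {m : ℕ} (hr : K.r + 1 = 2 * m) (hI : I.card = m) :
    K.objective I = ∏ i ∈ I, ((K.item i).prob : ℝ) := by
  -- Almost surely no profit exceeds one, so the threshold forces all chosen profits to be one. Up
  -- to a null set, the event is a box.
  have h1 : {P : Fin K.n → ℕ | (K.r : ℤ) + 1 - (I.card : ℤ) ≤ ∑ i ∈ I, (P i : ℤ)} =ᵐ[K.law]
      Set.pi Set.univ fun i => if i ∈ I then {1} else Set.univ := by
    filter_upwards [K.ae_le_one] with P hP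
    rw [eq_iff_iff]
    change (K.r : ℤ) + 1 - (I.card : ℤ) ≤ ∑ i ∈ I, (P i : ℤ) ↔
      ∀ i ∈ Set.univ, P i ∈ (if i ∈ I then ({1} : Set ℕ) else Set.univ)
    have h2 : (K.r : ℤ) + 1 - (I.card : ℤ) ≤ ∑ i ∈ I, (P i : ℤ) ↔
        ∑ i ∈ I, 1 ≤ ∑ i ∈ I, P i := by
      rw [Finset.sum_const, smul_eq_mul, mul_one, ← Nat.cast_sum]
      omega
    rw [h2]
    constructor
    · intro h i _
      split_ifs with hi
      · have h3 : ∑ i ∈ I, P i = ∑ i ∈ I, 1 :=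
          le_antisymm (Finset.sum_le_sum fun i _ => hP i) h
        exact (Finset.sum_eq_sum_iff_of_le fun i _ => hP i).1 h3 i hi
      · trivial
    · intro h
      refine Finset.sum_le_sum fun i hi => ?_
      have := h i (Set.mem_univ i)
      rw [if_pos hi] at this
      exact (Set.mem_singleton_iff.1 this).ge
  unfold objective
  rw [measureReal_congr h1, measureReal_def]
  unfold law
  rw [Measure.pi_pi, ENNReal.toReal_prod]
  have h3 : ∀ i, ((bernoulliMeasure 1 0 (K.item i).prob : Measure ℕ)
      (if i ∈ I then {1} else Set.univ)).toReal =
        if i ∈ I then ((K.item i).prob : ℝ) else 1 := fun i => by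
    split_ifs
    · exact bernoulliMeasure_real_apply_of_mem_of_notMem _ (by measurability) (by simp) (by simp)
    · simp
  rw [Finset.prod_congr rfl fun i _ => h3 i, Finset.prod_ite_mem, Finset.univ_inter]

/-- With fewer items, the threshold is never reached. -/
theorem objective_eq_zero {m : ℕ} (hr : K.r + 1 = 2 * m) (hI : I.card < m) :
    K.objective I = 0 := by
  unfold objective
  rw [measureReal_def, measure_eq_zero_iff_ae_notMem.2, ENNReal.toReal_zero]
  filter_upwards [K.ae_le_one] with P hP
  simp only [not_le]
  have h1 : ∑ i ∈ I, P i ≤ ∑ i ∈ I, 1 := Finset.sum_le_sum fun i _ => hP i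
  rw [Finset.sum_const, smul_eq_mul, mul_one] at h1
  rw [← Nat.cast_sum]
  omega

end Instance

/-- The item of given size whose profit is one with probability `2 ^ (-e)`. -/
def powerItem (s e : ℕ) : Item := ⟨s, 1, 1, e, one_pos, by simpa using Nat.one_le_two_pow⟩

theorem powerItem_prob (s e : ℕ) : ((powerItem s e).prob : ℝ) = ((2 : ℝ) ^ e)⁻¹ := by
  simp [Item.prob, powerItem]

open Word

/-- The knapsack instance obtained from a word. -/
noncomputable def ofWord (y : List ℕ) (h γ : ℕ) : Instance where
  r := 2 * numSlots y h - 1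
  r_pos := by unfold numSlots; omega
  Q := capacity y h
  n := numItems y h
  item i := powerItem (itemSize y h i) (itemExp y h γ i)

variable {y : List ℕ} {h γ : ℕ}

theorem feasible_ofWord_iff {J : Finset (Fin (numItems y h))} :
    (ofWord y h γ).Feasible J ↔ ∑ i ∈ J.map Fin.valEmbedding, itemSize y h i ≤ capacity y h := by
  rw [Finset.sum_map]
  rfl

/-- Each exponent is `γ` times the distance of the size from the common upper bound `2 * radix y h ^
numDigits y h`. For a given number of items, the total exponent falls by `γ` for every unit of total
size. -/
theorem sum_itemExp {I : Finset ℕ} (hg : ∀ i ∈ I, GoodItem y h i) :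
    ∑ i ∈ I, itemExp y h γ i + γ * ∑ i ∈ I, itemSize y h i =
      γ * (2 * radix y h ^ numDigits y h) * I.card := by
  rw [sum_itemSize hg, Finset.mul_sum, ← Finset.sum_add_distrib, mul_comm _ I.card,
    ← smul_eq_mul, ← Finset.sum_const]
  refine Finset.sum_congr rfl fun i hi => ?_
  have h1 : goodSize y h i < 2 * radix y h ^ numDigits y h :=
    bigWeight_lt fun c _ => digit_lt (hg i hi) c
  rw [itemExp, if_pos (hg i hi), ← Nat.mul_add, Nat.sub_add_cancel h1.le]

theorem objective_ofWord {J : Finset (Fin (numItems y h))}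
    (hJ : (J.map Fin.valEmbedding).card = numSlots y h) : (ofWord y h γ).objective J =
      ((2 : ℝ) ^ ∑ i ∈ J.map Fin.valEmbedding, itemExp y h γ i)⁻¹ := by
  have hr : (ofWord y h γ).r + 1 = 2 * numSlots y h := by
    simp only [ofWord]
    unfold numSlots
    omega
  rw [Finset.card_map] at hJ
  rw [Instance.objective_eq_prod hr hJ, Finset.sum_map, ← Finset.prod_pow_eq_pow_sum,
    ← Finset.prod_inv_distrib]
  exact Finset.prod_congr rfl fun i _ => powerItem_prob _ _

/-- An approximate solution reveals whether the capacity can be attained exactly. -/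
theorem exists_exact_iff {α : ℝ} (hα : α < 2 ^ γ) {J : Finset (Fin (numItems y h))}
    (hJ : (ofWord y h γ).Feasible J) (happ : ∀ I : Finset (Fin (numItems y h)),
      (ofWord y h γ).Feasible I → (ofWord y h γ).objective I ≤ α * (ofWord y h γ).objective J) :
    (∃ I ⊆ Finset.range (numItems y h), ∑ i ∈ I, itemSize y h i = capacity y h) ↔
      ∑ i ∈ J, itemSize y h i = capacity y h := by
  constructor
  · rintro ⟨I, hI, hsum⟩
    obtain ⟨I, rfl⟩ : ∃ I' : Finset (Fin (numItems y h)), I = I'.map Fin.valEmbedding := by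
      refine ⟨I.attachFin fun i hi => Finset.mem_range.1 (hI hi), ?_⟩
      rw [Finset.map_valEmbedding_attachFin]
    have hIc := (digit_sums hsum).1
    have hIf : (ofWord y h γ).Feasible I := feasible_ofWord_iff.2 hsum.le
    have hle := happ I hIf
    rw [objective_ofWord hIc] at hle
    rw [feasible_ofWord_iff] at hJ
    have hr : (ofWord y h γ).r + 1 = 2 * numSlots y h := by
      simp only [ofWord]
      unfold numSlots
      omega
    -- With fewer items the objective of `J` would be zero, whereas that of `I` is positive.
    have hJc : (J.map Fin.valEmbedding).card = numSlots y h := by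
      refine le_antisymm (card_le_of_feasible hJ) (not_lt.1 fun hlt => ?_)
      rw [Finset.card_map] at hlt
      rw [Instance.objective_eq_zero hr hlt, mul_zero] at hle
      exact absurd hle (not_le.2 (by positivity))
    rw [objective_ofWord hJc] at hle
    have e1 := sum_itemExp (γ := γ) (goodItem_of_sum_le hsum.le)
    have e2 := sum_itemExp (γ := γ) (goodItem_of_sum_le hJ)
    rw [hIc, hsum] at e1
    rw [hJc] at e2
    change ∑ i ∈ J, itemSize y h (Fin.valEmbedding i) = _
    rw [← Finset.sum_map J Fin.valEmbedding (itemSize y h)]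
    -- A total size that misses the capacity by one or more costs a factor of at least `2 ^ γ`, more
    -- than the ratio `α` allows.
    by_contra hne
    have hlt := lt_of_le_of_ne hJ hne
    have h3 : γ * (∑ i ∈ J.map Fin.valEmbedding, itemSize y h i + 1) ≤ γ * capacity y h :=
      Nat.mul_le_mul_left _ hlt
    rw [Nat.mul_add, mul_one] at h3
    have h4 : (∑ i ∈ I.map Fin.valEmbedding, itemExp y h γ i) + γ ≤
        ∑ i ∈ J.map Fin.valEmbedding, itemExp y h γ i := by omega
    have h5 : (2 : ℝ) ^ (∑ i ∈ I.map Fin.valEmbedding, itemExp y h γ i) * 2 ^ γ ≤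
        2 ^ ∑ i ∈ J.map Fin.valEmbedding, itemExp y h γ i := by
      rw [← pow_add]
      exact pow_le_pow_right₀ one_le_two h4
    set A := (2 : ℝ) ^ (∑ i ∈ I.map Fin.valEmbedding, itemExp y h γ i) with hA
    set B := (2 : ℝ) ^ (∑ i ∈ J.map Fin.valEmbedding, itemExp y h γ i) with hB
    have hA0 : 0 < A := by positivity
    have hB0 : 0 < B := by positivity
    rw [← div_eq_mul_inv, inv_eq_one_div, div_le_div_iff₀ hA0 hB0, one_mul] at hle
    have := mul_lt_mul_of_pos_right hα hA0
    linarith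
  · intro hsum
    refine ⟨J.map Fin.valEmbedding, fun i hi => ?_, by rw [Finset.sum_map]; exact hsum⟩
    obtain ⟨j, _, rfl⟩ := Finset.mem_map.1 hi
    exact Finset.mem_range.2 j.2

end KnapsackUncertainty

namespace RAM

/-! ### Renaming the arrays of a program -/

/-- The expression with renamed arrays. -/
def Expr.rename (ρ : ℕ → ℕ) : Expr → Expr
  | .const n => .const n
  | .read a i => .read (ρ a) (i.rename ρ)
  | .add e₁ e₂ => .add (e₁.rename ρ) (e₂.rename ρ)
  | .sub e₁ e₂ => .sub (e₁.rename ρ) (e₂.rename ρ)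
  | .mul e₁ e₂ => .mul (e₁.rename ρ) (e₂.rename ρ)
  | .div e₁ e₂ => .div (e₁.rename ρ) (e₂.rename ρ)

/-- The program with renamed arrays. -/
def Program.rename (ρ : ℕ → ℕ) : Program → Program
  | .skip => .skip
  | .write a i e => .write (ρ a) (i.rename ρ) (e.rename ρ)
  | .seq c₁ c₂ => .seq (c₁.rename ρ) (c₂.rename ρ)
  | .ite e c₁ c₂ => .ite (e.rename ρ) (c₁.rename ρ) (c₂.rename ρ)
  | .while e c => .while (e.rename ρ) (c.rename ρ)

theorem Expr.eval_rename (ρ : ℕ → ℕ) (m : Memory) (e : Expr) :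
    (e.rename ρ).eval m = e.eval fun a => m (ρ a) := by
  induction e <;> simp_all [Expr.rename, Expr.eval]

theorem Expr.cost_rename (ρ : ℕ → ℕ) (m : Memory) (e : Expr) :
    (e.rename ρ).cost m = e.cost fun a => m (ρ a) := by
  induction e <;> simp_all [Expr.rename, Expr.cost, Expr.eval_rename]

/-- The renamed program acts on the renamed arrays, and leaves all other arrays unchanged. -/
theorem Exec.rename {ρ : ℕ → ℕ} (hρ : Function.Injective ρ) {c : Program} {m₀ m₁ : Memory}
    {t : ℕ} (h : Exec c m₀ t m₁) : ∀ m : Memory, (∀ a, m (ρ a) = m₀ a) →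
      ∃ m', Exec (c.rename ρ) m t m' ∧ (∀ a, m' (ρ a) = m₁ a) ∧
        ∀ a, (∀ b, a ≠ ρ b) → m' a = m a := by
  induction h with
  | skip m₀ => exact fun m hm => ⟨m, .skip m, hm, fun _ _ => rfl⟩
  | write m₀ a i e =>
    intro m hm
    have hm' : (fun a => m (ρ a)) = m₀ := funext hm
    refine ⟨m.set (ρ a) ((i.rename ρ).eval m) ((e.rename ρ).eval m), ?_, fun b => ?_,
      fun b hb => ?_⟩
    · have := Exec.write m (ρ a) (i.rename ρ) (e.rename ρ)
      rw [Expr.cost_rename, Expr.cost_rename, hm'] at this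
      exact this
    · funext j
      rw [Expr.eval_rename, Expr.eval_rename, hm']
      simp only [Memory.set, hρ.eq_iff, hm]
    · funext j
      simp [Memory.set, hb a]
  | seq _ _ ih₁ ih₂ =>
    intro m hm
    obtain ⟨m', e', h', k'⟩ := ih₁ m hm
    obtain ⟨m'', e'', h'', k''⟩ := ih₂ m' h'
    exact ⟨m'', e'.seq e'', h'', fun a ha => (k'' a ha).trans (k' a ha)⟩
  | @ite_true e c₁ c₂ m₀ m₁ t he _ ih =>
    intro m hm
    obtain ⟨m', e', h', k'⟩ := ih m hm
    have hm' : (fun a => m (ρ a)) = m₀ := funext hm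
    refine ⟨m', ?_, h', k'⟩
    have := Exec.ite_true (c₂ := c₂.rename ρ) (by rwa [Expr.eval_rename, hm']) e'
    rwa [Expr.cost_rename, hm'] at this
  | @ite_false e c₁ c₂ m₀ m₁ t he _ ih =>
    intro m hm
    obtain ⟨m', e', h', k'⟩ := ih m hm
    have hm' : (fun a => m (ρ a)) = m₀ := funext hm
    refine ⟨m', ?_, h', k'⟩
    have := Exec.ite_false (c₁ := c₁.rename ρ) (by rwa [Expr.eval_rename, hm']) e'
    rwa [Expr.cost_rename, hm'] at this
  | @while_true e c m₀ m₁ m₂ t₁ t₂ he _ _ ih₁ ih₂ =>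
    intro m hm
    obtain ⟨m', e', h', k'⟩ := ih₁ m hm
    obtain ⟨m'', e'', h'', k''⟩ := ih₂ m' h'
    have hm' : (fun a => m (ρ a)) = m₀ := funext hm
    refine ⟨m'', ?_, h'', fun a ha => (k'' a ha).trans (k' a ha)⟩
    have := Exec.while_true (by rwa [Expr.eval_rename, hm']) e' e''
    rwa [Expr.cost_rename, hm'] at this
  | @while_false e c m₀ he =>
    intro m hm
    have hm' : (fun a => m (ρ a)) = m₀ := funext hm
    refine ⟨m, ?_, hm, fun _ _ => rfl⟩
    have := Exec.while_false (c := c.rename ρ) (m := m) (by rwa [Expr.eval_rename, hm'])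
    rwa [Expr.cost_rename, hm'] at this

/-! ### Writing a word to an array -/

theorem Rep.congr {loc loc' : ℕ → ℕ} {y : List ℕ} {m m' : Memory} (h : Rep loc y m)
    (hm : m' 0 = m 0) : Rep loc' y m' where
  length := by rw [hm, h.length]
  entry i hi := by rw [hm, h.entry i hi]
  var _ hj := absurd hj (Nat.not_lt_zero _)

theorem Frame.array {r a : ℕ} {m m' : Memory} (h : Frame r m m') (ha : a ≠ 1) : m' a = m a :=
  funext fun i => h a i fun hh => ha hh.1

theorem set_array {m : Memory} {a i v b : ℕ} (h : b ≠ a) : m.set a i v b = m b :=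
  funext fun _ => set_ne m fun hh => h hh.1

/-- A word given by a function computable in polynomial time can be written in polynomial time. -/
theorem exists_emit {len : List ℕ → ℕ} {w : List ℕ → ℕ → ℕ} (hlen : PT len) (hlenB : PB len)
    (hw : PT (fun p : List ℕ × ℕ => w p.1 p.2)) :
    ∃ (c : Program) (T : List ℕ → ℕ), PB T ∧ ∀ y m, Rep id y m → (∀ i, m 2 i = 0) →
      ∃ m', ExecLE c m (T y) m' ∧ m' 2 = load ((List.range (len y)).map (w y)) 0 ∧
        ∀ a, a ≠ 1 → a ≠ 2 → m' a = m a := by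
  obtain ⟨cl, Tl, hTl, hcl⟩ := hlen.2 id 0 fun j hj => absurd hj (Nat.not_lt_zero j)
  obtain ⟨cw, Tw, hTw, hcw⟩ := hw.2 (Function.update id 0 1) 2 fun j hj => by
    obtain rfl : j = 0 := Nat.lt_one_iff.1 hj
    simp
  let TI : List ℕ × ℕ → ℕ := fun p => Tw p + (40 + Nat.size (w p.1 p.2) + 6 * Nat.size p.2)
  have hTI : PB TI := hTw.add (((PB.const _).add hw.1).add ((PB.const 6).mul PB.snd.size))
  let S : List ℕ → ℕ := fun y => 3 * Nat.size (len y) + 20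
  have hS : PB S := ((PB.const 3).mul hlen.1).add (PB.const _)
  refine ⟨.seq cl (.seq (.write 2 (.const 0) (R 0)) (.seq (setR 1 (.const 0))
    (.while (.sub (R 0) (R 1)) (.seq cw (.seq (.write 2 (.add (R 1) (.const 1)) (R 2))
      (setR 1 (.add (R 1) (.const 1)))))))),
    fun y => Tl y + ((Nat.size (len y) + 20) +
      (∑ i ∈ Finset.range (len y), (TI (y, i) + S y + 1) + S y + 1)),
    hTl.add ((hlen.1.add (PB.const _)).add (((hlenB.sum ((hTI.add hS.fst).add
      (PB.const 1))).add hS).add (PB.const 1))), fun y m hm hm2 => ?_⟩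
  obtain ⟨m₁, e₁, v₁, f₁⟩ := hcl y m hm
  let Inv : ℕ → Memory → Prop := fun i m' => (∀ a, a ≠ 1 → a ≠ 2 → m' a = m a) ∧
    m' 1 0 = len y ∧ m' 1 1 = i ∧
    ∀ j, m' 2 j = if j = 0 then len y else if j ≤ i then w y (j - 1) else 0
  have h1 : Nat.size 1 = 1 := by simp
  have h2 : Nat.size 2 ≤ 2 := size_le_self 2
  have hloop := ExecLE.loop (.sub (R 0) (R 1)) (.seq cw (.seq
    (.write 2 (.add (R 1) (.const 1)) (R 2)) (setR 1 (.add (R 1) (.const 1))))) Inv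
    (fun i => TI (y, i)) (len y) (S y)
    (by
      rintro i hi m' ⟨_, h2, h3, _⟩
      refine ⟨by simp only [Expr.eval, h2, h3]; omega, ?_⟩
      have e1 := Nat.size_le_size hi
      have e2 := Nat.size_le_size (Nat.sub_le (len y) i)
      simp only [Expr.cost, Expr.eval, h2, h3, Nat.size_zero, h1]
      simp only [S]
      omega)
    (by
      rintro i hi m' ⟨k1, k2, k3, k4⟩
      obtain ⟨m₂, e₂, v₂, f₂⟩ := hcw (y, i) m'
        ((hm.congr (loc' := id) (k1 0 (by omega) (by omega))).push (r := 1) k3)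
      have w0 : m₂ 1 0 = len y := by rw [f₂.reg (by omega), k2]
      have w1 : m₂ 1 1 = i := by rw [f₂.reg (by omega), k3]
      refine ⟨_, (e₂.seq ((ExecLE.write m₂ 2 _ _).seq (ExecLE.setR _ 1 _))).mono ?_, ?_⟩
      · simp only [Expr.cost, Expr.eval, w1, v₂, h1, set_array (show (1 : ℕ) ≠ 2 by omega)]
        have e2 := size_add_le i 1
        simp only [TI]
        omega
      · refine ⟨fun a ha ha' => ?_, ?_, ?_, fun j => ?_⟩
        · rw [set_array ha, set_array ha', f₂.array ha, k1 a ha ha']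
        · simp [set_eq, w0]
        · simp [set_eq, Expr.eval, w1]
        · rw [set_ne _ (by omega), set_eq, f₂.array (show 2 ≠ 1 by omega), k4]
          simp only [Expr.eval, w1, v₂, true_and]
          by_cases hj : j = i + 1
          · subst hj
            simp
          · rw [if_neg hj]
            split_ifs <;> first | rfl | omega)
  obtain ⟨m₃, e₃, k1, k2, k3, k4⟩ := hloop ((m₁.set 2 0 (len y)).set 1 1 0) ⟨fun a ha ha' => by
      rw [set_array ha, set_array ha', f₁.array ha], by simp [set_eq, v₁], by simp, fun j => by
      rw [set_ne _ (by omega), set_eq, f₁.array (show 2 ≠ 1 by omega), hm2]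
      simp only [true_and]
      split_ifs <;> first | rfl | omega⟩
  have ew := ExecLE.write m₁ 2 (.const 0) (R 0)
  rw [eval_R, v₁] at ew
  refine ⟨m₃, (e₁.seq (ew.seq ((ExecLE.setR _ 1 (.const 0)).seq e₃))).mono ?_, ?_, k1⟩
  · simp only [Expr.cost, Expr.eval, v₁, Nat.size_zero, h1]
    omega
  · funext j
    rw [k4]
    simp only [load, if_true, List.length_map, List.length_range]
    cases j with
    | zero => simp
    | succ j =>
      rw [List.getD_cons_succ, if_neg (Nat.succ_ne_zero j)]
      by_cases hj : j < len y
      · rw [if_pos (by omega)]; simp [hj]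
      · rw [if_neg (by omega)]; simp [hj]

/-- A function computable in polynomial time can be summed over a short list in array `2`. -/
theorem exists_sumList {w : List ℕ → ℕ → ℕ} {bound total : List ℕ → ℕ} (hbound : PB bound)
    (htotal : PB (fun y => Nat.size (total y)))
    (hw : PT (fun p : List ℕ × ℕ => w p.1 p.2)) :
    ∃ (c : Program) (T : List ℕ → ℕ), PB T ∧ ∀ y m (l : List ℕ), Rep id y m → m 2 0 = l.length →
      (∀ i < l.length, m 2 (i + 1) = l.getD i 0) → l.length ≤ bound y → (∀ i ∈ l, i < bound y) →
      (l.map (w y)).sum ≤ total y →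
      ∃ m', ExecLE c m (T y) m' ∧ m' 1 0 = (l.map (w y)).sum ∧ ∀ a, a ≠ 1 → m' a = m a := by
  obtain ⟨cw, Tw, hTw, hcw⟩ := hw.2 (Function.update id 0 2) 3 fun j hj => by
    obtain rfl : j = 0 := Nat.lt_one_iff.1 hj
    simp
  -- The list is arbitrary, but its entries are below `bound y`, so this sum bounds the time for
  -- each entry.
  let U : List ℕ → ℕ := fun y => ∑ v ∈ Finset.range (bound y), Tw (y, v)
  have hU : PB U := hbound.sum hTw
  let TI : List ℕ → ℕ := fun y => U y + (60 + 8 * Nat.size (bound y) + 4 * Nat.size (total y))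
  have hTI : PB TI := hU.add (((PB.const _).add ((PB.const 8).mul hbound.size)).add
    ((PB.const 4).mul htotal))
  let S : List ℕ → ℕ := fun y => 3 * Nat.size (bound y) + 20
  have hS : PB S := ((PB.const 3).mul hbound.size).add (PB.const _)
  refine ⟨.seq (setR 0 (.const 0)) (.seq (setR 1 (.const 0))
    (.while (.sub (.read 2 (.const 0)) (R 1)) (.seq (setR 2 (.read 2 (.add (R 1) (.const 1))))
      (.seq cw (.seq (setR 0 (.add (R 0) (R 3))) (setR 1 (.add (R 1) (.const 1)))))))),
    fun y => 20 + (∑ i ∈ Finset.range (bound y), (TI y + S y + 1) + S y + 1),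
    (PB.const _).add (((hbound.sum ((hTI.fst.add hS.fst).add
      (PB.const 1))).add hS).add (PB.const 1)), fun y m l hm hl hl' hlb hlb' htot => ?_⟩
  let Inv : ℕ → Memory → Prop := fun i m' => (∀ a, a ≠ 1 → m' a = m a) ∧
    m' 1 0 = ((l.take i).map (w y)).sum ∧ m' 1 1 = i
  have h1 : Nat.size 1 = 1 := by simp
  have h2 : Nat.size 2 ≤ 2 := size_le_self 2
  have h3 : Nat.size 3 ≤ 3 := size_le_self 3
  have hpart : ∀ i, ((l.take i).map (w y)).sum ≤ total y := fun i => by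
    refine le_trans ?_ htot
    conv_rhs => rw [← List.take_append_drop i l, List.map_append, List.sum_append]
    exact Nat.le_add_right _ _
  have hloop := ExecLE.loop (.sub (.read 2 (.const 0)) (R 1))
    (.seq (setR 2 (.read 2 (.add (R 1) (.const 1))))
      (.seq cw (.seq (setR 0 (.add (R 0) (R 3))) (setR 1 (.add (R 1) (.const 1)))))) Inv
    (fun i => TI y) l.length (S y)
    (by
      rintro i hi m' ⟨k1, k2, k3⟩
      have k4 : m' 2 0 = l.length := by rw [k1 2 (by omega), hl]
      refine ⟨by simp only [Expr.eval, k3, k4]; omega, ?_⟩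
      have e1 := Nat.size_le_size (hi.trans hlb)
      have e2 := Nat.size_le_size ((Nat.sub_le l.length i).trans hlb)
      have e3 := Nat.size_le_size hlb
      simp only [Expr.cost, Expr.eval, k3, k4, Nat.size_zero, h1]
      simp only [S]
      omega)
    (by
      rintro i hi m' ⟨k1, k2, k3⟩
      have k4 : m' 2 (i + 1) = l[i] := by
        rw [k1 2 (by omega), hl' i hi, List.getD_eq_getElem _ _ hi]
      have e0 := ExecLE.setR m' 2 (.read 2 (.add (R 1) (.const 1)))
      simp only [Expr.eval, k3, k4] at e0
      obtain ⟨m₂, e₂, v₂, f₂⟩ := hcw (y, l[i]) (m'.set 1 2 l[i])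
        (((hm.congr (loc' := id) (k1 0 (by omega))).congr (loc' := id)
          (set_array (by omega))).push (r := 2) (set_same _ _ _ _))
      have w0 : m₂ 1 0 = ((l.take i).map (w y)).sum := by
        rw [f₂.reg (by omega), set_ne _ (by omega), k2]
      have w1 : m₂ 1 1 = i := by rw [f₂.reg (by omega), set_ne _ (by omega), k3]
      have hs : ((l.take i).map (w y)).sum + w y l[i] = ((l.take (i + 1)).map (w y)).sum := by
        rw [← List.take_append_getElem hi, List.map_append, List.sum_append]
        simp
      refine ⟨_, (e0.seq (e₂.seq ((ExecLE.setR m₂ 0 _).seq (ExecLE.setR _ 1 _)))).mono ?_, ?_⟩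
      · simp only [Expr.cost, Expr.eval, k3, k4, w0, w1, v₂, h1, Nat.size_zero, hs,
          set_ne m₂ (show ¬(1 = 1 ∧ 1 = 0) by omega)]
        have e2 := size_add_le i 1
        have e3 := Nat.size_le_size (hi.le.trans hlb)
        have e4 := Nat.size_le_size (hpart (i + 1))
        have e5 := Nat.size_le_size (hpart i)
        have e6 := Nat.size_le_size ((Nat.le_add_left (w y l[i]) _).trans
          (hs.le.trans (hpart (i + 1))))
        have hlt := hlb' _ (List.getElem_mem hi)
        have e7 := Nat.size_le_size hlt.le
        have e8 : Tw (y, l[i]) ≤ U y :=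
          Finset.single_le_sum (f := fun v => Tw (y, v)) (fun _ _ => Nat.zero_le _)
            (Finset.mem_range.2 hlt)
        simp only [TI]
        omega
      · refine ⟨fun a ha => ?_, ?_, ?_⟩
        · rw [set_array ha, set_array ha, f₂.array ha, set_array ha, k1 a ha]
        · simp [set_eq, Expr.eval, w0, v₂, -List.map_take, ← hs]
        · simp [set_eq, Expr.eval, w1])
  obtain ⟨m₃, e₃, k1, k2, k3⟩ := hloop ((m.set 1 0 0).set 1 1 0)
    ⟨fun a ha => by rw [set_array ha, set_array ha], by simp [set_eq], by simp⟩
  refine ⟨m₃, ((ExecLE.setR _ 0 (.const 0)).seq ((ExecLE.setR _ 1 (.const 0)).seq e₃)).mono ?_,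
    by rw [k2, List.take_length], k1⟩
  have := Finset.sum_le_sum_of_subset (f := fun _ => TI y + S y + 1)
    (Finset.range_mono hlb)
  simp only [Expr.cost, Nat.size_zero, h1]
  omega

end RAM

theorem RAM.size_map_range (f : ℕ → ℕ) (n : ℕ) :
    RAM.size ((List.range n).map f) = ∑ i ∈ Finset.range n, (Nat.size (f i) + 1) := by
  induction n with
  | zero => rfl
  | succ n ih =>
    rw [Finset.sum_range_succ, ← ih, List.range_succ]
    simp [RAM.size]

theorem RAM.unload_eq {m : RAM.Memory} {l : List ℕ} (h : RAM.unload m = l) :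
    m 0 0 = l.length ∧ ∀ i < l.length, m 0 (i + 1) = l.getD i 0 := by
  subst h
  refine ⟨by simp [RAM.unload], fun i hi => ?_⟩
  rw [List.getD_eq_getElem _ _ hi]
  simp [RAM.unload]

/-! ### Deciding weft-one satisfiability with an approximation algorithm -/

namespace KnapsackUncertainty

open RAM Word Parameterized

/-- Entry `i` of the word of the knapsack instance obtained from a word. -/
noncomputable def encodeEntry (y : List ℕ) (h γ i : ℕ) : ℕ :=
  if i = 0 then 2 * numSlots y h - 1 else if i = 1 then capacity y h
  else if i = 2 then numItems y h
  else if (i - 3) % 4 = 0 then itemSize y h ((i - 3) / 4)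
  else if (i - 3) % 4 = 3 then itemExp y h γ ((i - 3) / 4) else 1

theorem encode_ofWord (y : List ℕ) (h γ : ℕ) : (ofWord y h γ).encode =
    (List.range (3 + 4 * numItems y h)).map (encodeEntry y h γ) := by
  have h1 : ∀ n, (List.range (4 * n)).map (fun j => encodeEntry y h γ (3 + j)) =
      (List.range n).flatMap fun i => [itemSize y h i, 1, 1, itemExp y h γ i] := by
    intro n
    induction n with
    | zero => rfl
    | succ n ih =>
      rw [Nat.mul_succ, List.range_add, List.map_append, ih, List.range_succ (n := n),
        List.flatMap_append]
      congr 1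
      have e0 : encodeEntry y h γ (3 + 4 * n) = itemSize y h n := by
        unfold encodeEntry
        rw [if_neg (by omega), if_neg (by omega), if_neg (by omega), if_pos (by omega)]
        congr 1; omega
      have e1 : encodeEntry y h γ (3 + (4 * n + 1)) = 1 := by
        unfold encodeEntry
        rw [if_neg (by omega), if_neg (by omega), if_neg (by omega), if_neg (by omega),
          if_neg (by omega)]
      have e2 : encodeEntry y h γ (3 + (4 * n + 2)) = 1 := by
        unfold encodeEntry
        rw [if_neg (by omega), if_neg (by omega), if_neg (by omega), if_neg (by omega),
          if_neg (by omega)]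
      have e3 : encodeEntry y h γ (3 + (4 * n + 3)) = itemExp y h γ n := by
        unfold encodeEntry
        rw [if_neg (by omega), if_neg (by omega), if_neg (by omega), if_neg (by omega),
          if_pos (by omega)]
        congr 1; omega
      simp [List.range_succ, e0, e1, e2, e3]
  rw [List.range_add, List.map_append, List.map_map]
  change _ = _ ++ (List.range (4 * numItems y h)).map (fun j => encodeEntry y h γ (3 + j))
  rw [h1]
  have h2 : (List.ofFn (ofWord y h γ).item).flatMap Item.encode =
      (List.range (numItems y h)).flatMap
        fun i => [itemSize y h i, 1, 1, itemExp y h γ i] := by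
    have : List.ofFn (ofWord y h γ).item =
        (List.range (numItems y h)).map fun i => powerItem (itemSize y h i) (itemExp y h γ i) := by
      change List.ofFn (fun i : Fin (numItems y h) => _) = _
      apply List.ext_getElem
      · simp
      · intro i _ _; simp [ofWord]
    rw [this, List.flatMap_map]
    rfl
  unfold Instance.encode
  rw [h2]
  simp [List.range_succ, encodeEntry, ofWord]

theorem pt_encodeEntry (h γ : ℕ) :
    PT (fun p : List ℕ × ℕ => encodeEntry p.1 h γ p.2) := by
  have hi : PT (fun p : List ℕ × ℕ => p.2) := PT.snd
  have hi3 : PT (fun p : List ℕ × ℕ => p.2 - 3) := hi.sub (PT.const 3)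
  have hj : PT (fun p : List ℕ × ℕ => (p.2 - 3) / 4) := hi3.div (PT.const 4)
  have hq : PT (fun p : List ℕ × ℕ => (p.2 - 3) % 4) := hi3.mod (PT.const 4)
  exact PD.ite (PD.eq hi (PT.const 0)) (((PT.const 2).mul pt_numSlots).sub (PT.const 1))
    (PD.ite (PD.eq hi (PT.const 1)) pt_capacity (PD.ite (PD.eq hi (PT.const 2)) pt_numItems
      (PD.ite (PD.eq hq (PT.const 0)) (pt_itemSize hj) (PD.ite (PD.eq hq (PT.const 3))
        (pt_itemExp γ hj) (PT.const 1)))))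

/-- The parameter of the knapsack instance, as a function of the parameter of the word. -/
def parameter (h k : ℕ) : ℕ := 2 * (k + 1 + 1 + (k + 1) ^ arity h) - 1

/-- An approximation algorithm for knapsack decides weighted satisfiability of circuits of weft at
most one and bounded depth. -/
theorem exists_decider (h : ℕ) {α : ℝ} {cA : Program} (hA : IsFPTApprox α cA) :
    ∃ (c : Program) (f : ℕ → ℕ) (e : ℕ), Computable f ∧ ∀ (k : ℕ) (x : List ℕ) (m : Memory),
      Rep id (k :: x) m → (∀ a i, m (3 * a + 2) i = 0) → ∃ (b : ℕ) (m' : Memory),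
        ExecLE c m ((f (parameter h k) + 1) * RAM.measure (k :: x) ^ e) m' ∧ m' 0 0 = 1 ∧
          m' 0 1 = b ∧ b ≤ 1 ∧ (b = 1 ↔ (x, k) ∈ WeightedCircuitSat 1 h) := by
  obtain ⟨f, d, hf, hA⟩ := hA
  obtain ⟨γ, hγ⟩ := pow_unbounded_of_one_lt α one_lt_two
  have hloc : ∀ r, ∀ j < Ctx.depth (List ℕ), id j < r := fun r j hj =>
    absurd hj (Nat.not_lt_zero j)
  obtain ⟨cv, Tv, hTv, hcv⟩ := (pd_isInstance (α := List ℕ) (h := h)).2 id 0 (hloc 0)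
  have hlen : PT (fun y : List ℕ => 3 + 4 * numItems y h) :=
    (PT.const 3).add ((PT.const 4).mul (pt_numItems (α := List ℕ)))
  have hlenB : PB (fun y : List ℕ => 3 + 4 * numItems y h) :=
    (PB.const 3).add ((PB.const 4).mul (pb_numItems (α := List ℕ)))
  obtain ⟨ce, Te, hTe, hce⟩ := exists_emit (w := fun y i => encodeEntry y h γ i) hlen hlenB
    (pt_encodeEntry h γ)
  obtain ⟨cs, Ts, hTs, hcs⟩ := exists_sumList (w := fun y i => itemSize y h i)
    (bound := fun y => numItems y h) (total := fun y => capacity y h)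
    (pb_numItems (α := List ℕ)) (pt_capacity (α := List ℕ)).1
    (pt_itemSize (α := List ℕ × ℕ) PT.snd)
  obtain ⟨cc, Tc, hTc, hcc⟩ := (pt_capacity (α := List ℕ) (h := h)).2 id 1 (hloc 1)
  -- The length of the knapsack instance that is passed to `cA`.
  let Z : List ℕ → ℕ := fun y => ∑ i ∈ Finset.range (3 + 4 * numItems y h),
    (Nat.size (encodeEntry y h γ i) + 1)
  have hZ : PB Z := hlenB.sum ((pt_encodeEntry h γ).1.add (PB.const 1))
  let T : List ℕ → ℕ := fun y => Tv y + (Te y + (Ts y + (Tc y +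
    (Z y ^ d + (8 * Nat.size (capacity y h) + 100)))))
  have hT : PB T := hTv.add (hTe.add (hTs.add (hTc.add ((hZ.pow d).add
    (((PB.const 8).mul (pt_capacity (α := List ℕ)).1).add (PB.const _))))))
  obtain ⟨e, he⟩ := hT 0
  have h1 : Nat.size 1 = 1 := by simp
  -- Only if the word is a valid instance, the knapsack instance is written to array `2`, `cA` runs
  -- on the arrays `3 * a + 2`, and the total size of its answer is compared with the capacity.
  -- Since subtraction is truncated, the last expression is one exactly if the two agree.
  refine ⟨.seq cv (.seq (.ite (R 0) (.seq ce (.seq (cA.rename fun a => 3 * a + 2) (.seq cs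
    (.seq cc (setR 0 (.sub (.const 1) (.add (.sub (R 0) (R 1)) (.sub (R 1) (R 0))))))))) .skip)
    (.seq (.write 0 (.const 0) (.const 1)) (.write 0 (.const 1) (R 0)))), f, e, hf,
    fun k x m hm hm2 => ?_⟩
  set y := k :: x with hy
  have heT : T y ≤ RAM.measure y ^ e := he y fun j hj => absurd hj (Nat.not_lt_zero j)
  obtain ⟨m₁, e₁, v₁, f₁⟩ := hcv y m hm
  suffices H : ∃ (b : ℕ) (m' : Memory), ExecLE (.ite (R 0) (.seq ce
      (.seq (cA.rename fun a => 3 * a + 2) (.seq cs (.seq cc (setR 0 (.sub (.const 1)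
        (.add (.sub (R 0) (R 1)) (.sub (R 1) (R 0))))))))) .skip) m₁
      (Te y + (Ts y + (Tc y + (f (parameter h k) * Z y ^ d + (8 * Nat.size (capacity y h) + 50)))))
      m' ∧ m' 1 0 = b ∧ b ≤ 1 ∧ (b = 1 ↔ (x, k) ∈ WeightedCircuitSat 1 h) by
    obtain ⟨b, m', e₂, hb, hb1, hbw⟩ := H
    refine ⟨b, _, (e₁.seq (e₂.seq ((ExecLE.write m' 0 (.const 0) (.const 1)).seq
      (ExecLE.write _ 0 (.const 1) (R 0))))).mono ?_, ?_, ?_, hb1, hbw⟩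
    · have hsb := Nat.size_le_size hb1
      simp only [Expr.cost, Expr.eval, Nat.size_zero, h1, set_array (show (1 : ℕ) ≠ 0 by omega),
        hb] at hsb ⊢
      have h2 := Nat.mul_le_mul_left (f (parameter h k) + 1) heT
      have h3 : f (parameter h k) * Z y ^ d + T y ≤ (f (parameter h k) + 1) * T y := by
        rw [Nat.add_mul, one_mul]
        refine Nat.add_le_add_right (Nat.mul_le_mul_left _ ?_) _
        simp only [T]; omega
      refine le_trans ?_ (h3.trans h2)
      simp only [T]
      omega
    · simp [set_eq, Expr.eval]
    · simp [set_eq, Expr.eval, hb]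
  have hm₁ := hm.frame (hloc 0) f₁
  have hm₁2 : ∀ a i, m₁ (3 * a + 2) i = 0 := fun a i => by
    rw [f₁.array (by omega), hm2]
  by_cases hinst : IsInstance y h
  · have hv : m₁ 1 0 = 1 := by rw [v₁]; exact ind_true hinst
    -- On valid words the cut-off in `numVars` is inactive, so `r` is a function of `k` and `h`
    -- alone.
    have hsl : parameter h k = (ofWord y h γ).r := by
      have : get y 0 ≤ y.length := hinst.2.1
      simp only [ofWord, parameter, numSlots, numTuples, numVars]
      rw [min_eq_left this]
      rfl
    obtain ⟨m₂, e₂, w₂, k₂⟩ := hce y m₁ hm₁ (hm₁2 0)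
    rw [← encode_ofWord] at w₂
    obtain ⟨l, hl, ⟨t₀, m₃, e₃, hu, ht₀⟩, hfeas, happ⟩ := hA (ofWord y h γ)
    have hinj : Function.Injective fun a : ℕ => 3 * a + 2 := fun a b hab => by
      simp only at hab; omega
    -- Apart from array `2`, the arrays `3 * a + 2` are still zero, so the renamed program finds its
    -- proper initial memory.
    obtain ⟨m₄, e₄, w₄, k₄⟩ := e₃.rename hinj m₂ fun a => by
      rcases Nat.eq_zero_or_pos a with rfl | ha
      · exact w₂
      · funext i
        rw [k₂ _ (by omega) (by omega), hm₁2]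
        simp [load, ha.ne']
    have hm₄ : Rep id y m₄ := (hm₁.congr (loc' := id) (k₂ 0 (by omega) (by omega))).congr
      (k₄ 0 fun b => by omega)
    obtain ⟨hu0, hu1⟩ := unload_eq hu
    rw [← w₄ 0] at hu0 hu1
    have hsum : ((l.map Fin.val).map fun i => itemSize y h i).sum =
        ∑ i ∈ l.toFinset, itemSize y h i := by
      rw [List.map_map, ← List.sum_toFinset _ hl]
      rfl
    have hfeas' : ∑ i ∈ l.toFinset, itemSize y h i ≤ capacity y h := hfeas
    obtain ⟨m₅, e₅, v₅, k₅⟩ := hcs y m₄ (l.map Fin.val) hm₄ hu0 hu1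
      (by rw [List.length_map]; exact hl.length_le_card.trans_eq (Fintype.card_fin _))
      (fun i hi => by
        obtain ⟨j, _, rfl⟩ := List.mem_map.1 hi
        exact j.2) (hsum.trans_le hfeas')
    obtain ⟨m₆, e₆, v₆, f₆⟩ := hcc y m₅ (hm₄.congr (k₅ 0 (by omega)))
    replace v₆ : m₆ 1 1 = capacity y h := v₆
    have v₆' : m₆ 1 0 = ∑ i ∈ l.toFinset, itemSize y h i := by
      rw [f₆.reg (by omega), v₅, hsum]
    have e₇ := ExecLE.setR m₆ 0 (.sub (.const 1) (.add (.sub (R 0) (R 1)) (.sub (R 1) (R 0))))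
    refine ⟨1 - ((∑ i ∈ l.toFinset, itemSize y h i - capacity y h) +
      (capacity y h - ∑ i ∈ l.toFinset, itemSize y h i)), m₆.set 1 0 (Expr.eval m₆
      (.sub (.const 1) (.add (.sub (R 0) (R 1)) (.sub (R 1) (R 0))))), ExecLE.mono (ExecLE.ite
      (T := Te y + (t₀ + (Ts y + (Tc y + (8 * Nat.size (capacity y h) + 40))))) ?_) ?_, ?_,
      by omega, ?_⟩
    · rw [if_pos (by rw [eval_R, hv]; exact one_ne_zero)]
      refine e₂.seq (ExecLE.seq ⟨_, le_rfl, e₄⟩ (e₅.seq (e₆.seq (e₇.mono ?_))))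
      have s1 := Nat.size_le_size hfeas'
      have s2 := Nat.size_le_size (Nat.sub_le (capacity y h)
        (∑ i ∈ l.toFinset, itemSize y h i))
      simp only [Expr.cost, Expr.eval, v₆, v₆', Nat.sub_eq_zero_of_le hfeas', zero_add,
        Nat.size_zero, h1]
      have s3 : Nat.size (1 - (capacity y h - ∑ i ∈ l.toFinset, itemSize y h i)) ≤ 1 :=
        (size_le_self _).trans (Nat.sub_le _ _)
      omega
    · rw [cost_R, hv, hsl]
      simp only [Nat.size_zero, h1]
      have hZy : RAM.size (ofWord y h γ).encode = Z y := by rw [encode_ofWord, size_map_range]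
      rw [hZy] at ht₀
      omega
    · rw [set_same]
      simp [Expr.eval, v₆, v₆']
    · rw [mem_weightedCircuitSat_iff, exists_exact_iff hγ hfeas happ]
      change _ ↔ IsInstance y h ∧ _
      constructor
      · intro hh
        refine ⟨hinst, ?_⟩
        change ∑ i ∈ l.toFinset, itemSize y h i = capacity y h
        omega
      · rintro ⟨_, hh⟩
        have hh' : ∑ i ∈ l.toFinset, itemSize y h i = capacity y h := hh
        omega
  · have hv : m₁ 1 0 = 0 := by rw [v₁]; exact ind_false hinst
    refine ⟨0, m₁, (ExecLE.ite (T := 1) ?_).mono ?_, hv, by omega, ?_⟩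
    · rw [if_neg (by rw [eval_R, hv]; simp)]
      exact ⟨1, le_rfl, .skip m₁⟩
    · rw [cost_R, hv]
      simp only [Nat.size_zero]
      omega
    · rw [mem_weightedCircuitSat_iff]
      exact ⟨fun hh => absurd hh (by omega), fun hh => absurd hh.1 hinst⟩

end KnapsackUncertainty

/-! ### Equality of W[1] and FPT -/

namespace Parameterized

open RAM KnapsackUncertainty

theorem computable_add {f g : ℕ → ℕ} (hf : Computable f) (hg : Computable g) :
    Computable fun n => f n + g n := Primrec.nat_add.to_comp.comp hf hg

theorem computable_mul {f g : ℕ → ℕ} (hf : Computable f) (hg : Computable g) :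
    Computable fun n => f n * g n := Primrec.nat_mul.to_comp.comp hf hg

theorem computable_pow {f : ℕ → ℕ} (hf : Computable f) (e : ℕ) : Computable fun n => f n ^ e := by
  induction e with
  | zero => simpa using Computable.const 1
  | succ e ih => simpa only [pow_succ] using computable_mul ih hf

theorem computable_sum {f : ℕ → ℕ} (hf : Computable f) :
    Computable fun n => ∑ j ∈ Finset.range n, f j := by
  have := Computable.nat_rec (f := fun n : ℕ => n) (g := fun _ => 0)
    (h := fun _ p => p.2 + f p.1) Computable.id (Computable.const 0)
    (Primrec.nat_add.to_comp.comp (Computable.snd.comp Computable.snd)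
      (hf.comp (Computable.fst.comp Computable.snd)))
  refine this.of_eq fun n => ?_
  induction n with
  | zero => rfl
  | succ n ih => rw [Finset.sum_range_succ, ← ih]

theorem computable_parameter (h : ℕ) : Computable (parameter h) := by
  have h1 : Computable fun k : ℕ => k + 1 := Computable.succ
  exact Primrec.nat_sub.to_comp.comp (computable_mul (Computable.const 2) (computable_add
    (computable_add h1 (Computable.const 1)) (computable_pow h1 _))) (Computable.const 1)

/-- An approximation algorithm for knapsack puts the first level of the W-hierarchy into FPT. -/
theorem W_one_subset_FPT {α : ℝ} {cA : Program} (hA : IsFPTApprox α cA) : W 1 ⊆ FPT := by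
  rintro L ⟨h, c₀, f₀, g₀, d₀, hf₀, hg₀, hc₀⟩
  obtain ⟨c, f, e, hf, hc⟩ := exists_decider h hA
  have hF : Computable fun k => f (parameter h k) + 1 :=
    computable_add (hf.comp (computable_parameter h)) (Computable.const 1)
  -- The reduction produces an instance no longer than its own running time, which accounts for `f₀
  -- k + 2`. The sum replaces a maximum over all parameters up to `g₀ k`, as `f` need not be
  -- monotone.
  let F : ℕ → ℕ := fun k => f₀ k + (∑ j ∈ Finset.range (g₀ k + 1), (f (parameter h j) + 1)) *
    (f₀ k + 2) ^ e + 2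
  -- The reduction works on the arrays divisible by three. It leaves its output in array `0`, where
  -- the decider expects its input, and keeps the arrays `3 * a + 2` zero.
  refine ⟨.seq (c₀.rename (3 * ·)) c, F, d₀ + d₀ * e, ?_, fun x k => ?_⟩
  · exact computable_add (computable_add hf₀ (computable_mul ((computable_sum hF).comp
      (computable_add hg₀ (Computable.const 1))) (computable_pow (computable_add hf₀
        (Computable.const 2)) e))) (Computable.const 2)
  · obtain ⟨x', k', ⟨t₀, m₀, e₀, hu, ht₀⟩, hk', hL⟩ := hc₀ x k
    obtain ⟨m₁, e₁, w₁, k₁⟩ := e₀.rename (ρ := fun a => 3 * a)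
      (fun a b hab => by simp only at hab; omega) (load (k :: x)) fun a => by
        funext i
        rcases Nat.eq_zero_or_pos a with rfl | ha
        · rfl
        · simp [load, ha.ne']
    obtain ⟨hu0, hu1⟩ := unload_eq hu
    rw [← w₁ 0] at hu0 hu1
    have hrep : Rep id (k' :: x') m₁ := ⟨hu0, hu1, fun j hj => absurd hj (Nat.not_lt_zero j)⟩
    obtain ⟨b, m', ⟨t, ht, e₂⟩, hb0, hb1, hb, hbL⟩ := hc k' x' m₁ hrep fun a i => by
      rw [k₁ _ fun b => by omega]
      simp [load]
    refine ⟨b, ⟨_, m', e₁.seq e₂, ?_, ?_⟩, hbL.trans hL.symm⟩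
    · simp [unload, hb0, hb1]
    · have hs : 1 ≤ size (k :: x) := by
        simp [size]
        omega
      set s := size (k :: x) with hs'
      have hsb : size [b] ≤ 2 := by
        have := (size_le_self b).trans hb
        simp [size]
        omega
      have hsd : 1 ≤ s ^ d₀ := Nat.one_le_pow _ _ hs
      have hse : 1 ≤ s ^ (d₀ * e) := Nat.one_le_pow _ _ hs
      have hmeas : RAM.measure (k' :: x') ≤ (f₀ k + 2) * s ^ d₀ := by
        have : RAM.measure (k' :: x') = size (k' :: x') + 2 := rfl
        rw [this, Nat.add_mul]
        omega
      have hfk : f (parameter h k') + 1 ≤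
          ∑ j ∈ Finset.range (g₀ k + 1), (f (parameter h j) + 1) :=
        Finset.single_le_sum (f := fun j => f (parameter h j) + 1) (fun _ _ => Nat.zero_le _)
          (Finset.mem_range.2 (Nat.lt_succ_of_le hk'))
      set S := ∑ j ∈ Finset.range (g₀ k + 1), (f (parameter h j) + 1) with hS
      have ht' : t ≤ S * (f₀ k + 2) ^ e * s ^ (d₀ * e) := by
        refine ht.trans ((Nat.mul_le_mul hfk (Nat.pow_le_pow_left hmeas e)).trans (le_of_eq ?_))
        rw [mul_pow, pow_mul, mul_assoc]
      have h1 : S * (f₀ k + 2) ^ e * s ^ (d₀ * e) ≤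
          S * (f₀ k + 2) ^ e * s ^ (d₀ + d₀ * e) := by
        rw [pow_add]
        exact Nat.mul_le_mul_left _ (Nat.le_mul_of_pos_left _ hsd)
      have h2 : f₀ k * s ^ d₀ ≤ f₀ k * s ^ (d₀ + d₀ * e) := by
        rw [pow_add]
        exact Nat.mul_le_mul_left _ (Nat.le_mul_of_pos_right _ hse)
      have h3 : 1 ≤ s ^ (d₀ + d₀ * e) := Nat.one_le_pow _ _ hs
      change _ ≤ (f₀ k + S * (f₀ k + 2) ^ e + 2) * s ^ (d₀ + d₀ * e)
      rw [Nat.add_mul, Nat.add_mul]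
      omega

/-- A circuit without inputs that outputs true. -/
def trueCircuit : Circuit where
  numInputs := 0
  gates := [.and []]
  output := 0
  args_lt i hi j hj := by
    obtain rfl : i = 0 := by simpa using hi
    simp [Gate.args] at hj
  output_lt := by simp

theorem true_mem : ([0, 0, 1, 2, 0], 0) ∈ WeightedCircuitSat 1 1 := by
  refine ⟨trueCircuit, ?_, ?_, rfl, fun _ => false, by simp, ?_⟩
  · simp [Circuit.weft, Circuit.pathMax, Circuit.labels, trueCircuit, Gate.args]
  · simp [Circuit.depth, Circuit.pathMax, Circuit.labels, trueCircuit, Gate.args]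
  · simp [Circuit.Accepts, Circuit.labels, trueCircuit, Gate.eval]

theorem false_notMem : (([] : List ℕ), 0) ∉ WeightedCircuitSat 1 1 := by
  rintro ⟨C, _, _, h, _⟩
  exact absurd h (by simp [Circuit.encode])

theorem execLE_writeConst (m : Memory) (a i v : ℕ) :
    ExecLE (.write a (.const i) (.const v)) m (i + v + 3) (m.set a i v) :=
  (ExecLE.write m a (.const i) (.const v)).mono (by
    have h1 := size_le_self i
    have h2 := size_le_self v
    simp only [Expr.cost]
    omega)

/-- The reduction solves the given instance by itself and outputs a fixed yes-instance or
no-instance. -/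
theorem FPT_subset_W_one : FPT ⊆ W 1 := by
  rintro L ⟨c, f, d, hf, hc⟩
  let w : ℕ → ℕ → Program := fun i v => .write 0 (.const i) (.const v)
  -- The tested value is the distance of `b` from one. If it is nonzero, parameter `0` and the empty
  -- word are output, otherwise parameter `0` and the word of `trueCircuit`; the cell `0` receives
  -- the length of the output.
  refine ⟨1, .seq c (.ite (.add (.sub (.read 0 (.const 1)) (.const 1))
    (.sub (.const 1) (.read 0 (.const 1)))) (.seq (w 0 1) (w 1 0))
    (.seq (w 0 6) (.seq (w 1 0) (.seq (w 2 0) (.seq (w 3 0) (.seq (w 4 1) (.seq (w 5 2)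
      (w 6 0)))))))), fun k => 200 * f k, fun _ => 0, d,
    computable_mul (Computable.const 200) hf, Computable.const 0, fun x k => ?_⟩
  obtain ⟨b, ⟨t, m, e, hu, ht⟩, hb⟩ := hc x k
  obtain ⟨-, hu1⟩ := unload_eq hu
  have hm : m 0 1 = b := hu1 0 (by simp)
  have h1 : Nat.size 1 = 1 := by simp
  have hsz : size [b] = Nat.size b + 1 := by simp [size]
  have hcost : (Expr.add (.sub (.read 0 (.const 1)) (.const 1))
      (.sub (.const 1) (.read 0 (.const 1)))).cost m ≤ 5 * Nat.size b + 30 := by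
    have e1 : Nat.size (b - 1) ≤ Nat.size b := Nat.size_le_size (Nat.sub_le _ _)
    have e2 : Nat.size (1 - b) ≤ 1 := (size_le_self _).trans (Nat.sub_le _ _)
    have e3 := size_add_le (b - 1) (1 - b)
    simp only [Expr.cost, Expr.eval, hm, h1]
    omega
  rw [mul_assoc]
  generalize f k * size (k :: x) ^ d = T at ht
  by_cases hb1 : b = 1
  · have e' : ExecLE (.seq (w 0 6) (.seq (w 1 0) (.seq (w 2 0) (.seq (w 3 0) (.seq (w 4 1)
        (.seq (w 5 2) (w 6 0))))))) m 60 _ :=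
      ((execLE_writeConst _ 0 0 6).seq ((execLE_writeConst _ 0 1 0).seq
        ((execLE_writeConst _ 0 2 0).seq ((execLE_writeConst _ 0 3 0).seq
          ((execLE_writeConst _ 0 4 1).seq ((execLE_writeConst _ 0 5 2).seq
            (execLE_writeConst _ 0 6 0))))))).mono (by norm_num)
    obtain ⟨t', ht', e''⟩ := ExecLE.seq ⟨t, le_rfl, e⟩ (ExecLE.ite (e := .add
      (.sub (.read 0 (.const 1)) (.const 1)) (.sub (.const 1) (.read 0 (.const 1))))
      (c₁ := .seq (w 0 1) (w 1 0)) (by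
        rw [if_neg (by simp [Expr.eval, hm, hb1])]; exact e'))
    refine ⟨[0, 0, 1, 2, 0], 0, ⟨t', _, e'', ?_, ?_⟩, le_rfl, ?_⟩
    · simp [unload, List.range_succ, set_eq]
    · have : size [0, 0, 0, 1, 2, 0] ≤ 12 := by
        have := size_le_self 2
        simp [size]
        omega
      omega
    · exact ⟨fun _ => true_mem, fun _ => hb.1 hb1⟩
  · have e' : ExecLE (.seq (w 0 1) (w 1 0)) m 60 _ :=
      ((execLE_writeConst _ 0 0 1).seq (execLE_writeConst _ 0 1 0)).mono (by norm_num)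
    obtain ⟨t', ht', e''⟩ := ExecLE.seq ⟨t, le_rfl, e⟩ (ExecLE.ite (e := .add
      (.sub (.read 0 (.const 1)) (.const 1)) (.sub (.const 1) (.read 0 (.const 1))))
      (c₂ := .seq (w 0 6) (.seq (w 1 0) (.seq (w 2 0) (.seq (w 3 0) (.seq (w 4 1)
        (.seq (w 5 2) (w 6 0))))))) (by
        rw [if_pos (by simp only [Expr.eval, hm]; omega)]; exact e'))
    refine ⟨[], 0, ⟨t', _, e'', ?_, ?_⟩, le_rfl, ?_⟩
    · simp [unload, List.range_succ, set_eq]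
    · have : size [0] ≤ 1 := by simp [size]
      omega
    · exact ⟨fun hh => absurd (hb.2 hh) hb1, fun hh => absurd hh false_notMem⟩

end Parameterized

theorem mainTheorem4 (hW : Parameterized.W 1 ≠ Parameterized.FPT) :
    ¬ ∃ (α : ℝ) (c : RAM.Program), 1 ≤ α ∧ KnapsackUncertainty.IsFPTApprox α c := by
  rintro ⟨α, c, _, hc⟩
  exact hW (Set.Subset.antisymm (Parameterized.W_one_subset_FPT hc) Parameterized.FPT_subset_W_one)
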